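/- **Setting.** For $\epsilon,\delta>0$ and $n\in\mathbb Z$ let $D_{Rn}$ and $D_{Ln}$ be the open unit disks in $\mathbb R^2$ centered at $(1+\frac\epsilon2,\,n(2+\delta))$ and $(-1-\frac\epsilon2,\,n(2+\delta))$, let $E=\mathbb R^2\setminus\overline{\bigcup_{n\in\mathbb Z}(D_{Ln}\cup D_{Rn})}$ and $\Omega=\mathbb R\times(-1-\frac\delta2,\,1+\frac\delta2)$. For $a,b\in\mathbb R$ put $H(x,y)=ax+by$. A solution for $H$ is a function $u$, $C^1$ on $\overline E$, with $\Delta u=0$ in $E$, such that $u$ is constant on $\partial D_{L0}$ and constant on $\partial D_{R0}$ (with unprescribed constants), $\int_{\partial D_{L0}}\partial_\nu u\,ds=\int_{\partial D_{R0}}\partial_\nu u\,ds=0$ ($\nu$ the unit normal pointing into the disk), $\int_{\Omega\setminus\overline{D_{L0}\cup D_{R0}}}|\nabla(u-H)|^2\,dx\,dy<\infty$, and $\nabla u(x,y)=\nabla u(x,y+2+\delta)$ for all $(x,y)\in E$. Let $$N_v=\Big\{(x,y):\ |x|<1+\tfrac\epsilon2-\sqrt{1-y^2},\ |y|<\tfrac{\sqrt3}2\Big\},$$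 $$N_h=\Big\{(x,y):\ \big|y-1-\tfrac\delta2\big|<1+\tfrac\delta2-\sqrt{1-(x-1-\tfrac\epsilon2)^2},\ \big|x-1-\tfrac\epsilon2\big|<\tfrac{\sqrt3}2\Big\},$$ $$S(x,y)=-2\sqrt\delta\,\frac{(x-1-\frac\epsilon2)(y-1-\frac\delta2)}{\big((x-1-\frac\epsilon2)^2+\delta\big)^2}.$$ **Theorem.** There are constants $C>0$ and $r>0$ such that for all $\epsilon,\delta\in(0,r)$ there is a constant $\mu_0$ (depending only on $\epsilon$ and $\delta$) with $\frac1C<\mu_0<C$ such that, for all $a,b\in\mathbb R$ and every solution $u$ for $H(x,y)=ax+by$, $$\nabla u(x,y)=2b\left(\frac{1}{\delta+(x-1-\frac\epsilon2)^2}\,(0,1)+\frac1{\sqrt\delta}\,S(x,y)\,(1,0)\right)+R_1(x,y)\quad\text{for all }(x,y)\in N_h,$$ $$\nabla u(x,y)=a\,\mu_0\,\frac{\sqrt\epsilon}{\epsilon+y^2}\,(1,0)+R_2(x,y)\quad\text{for all }(x,y)\in N_v,$$ where $$\|R_1\|_{L^\infty(N_h)}+\|R_2\|_{L^\infty(N_v)}\le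 C(|a|+|b|).$$ Moreover, the blow-up rates are $1/\delta$ in $N_h$ and $1/\sqrt\epsilon$ in $N_v$, and they are optimal: $|\nabla u|\le C(|a|+|b|)/\delta$ in $N_h$ and $|\nabla u|\le C(|a|+|b|)/\sqrt\epsilon$ in $N_v$; if $C\delta(|a|+|b|)\le|b|$, then $|\nabla u|\ge |b|/(C\delta)$ at some point of $N_h$; and if $C\sqrt\epsilon(|a|+|b|)\le|a|$, then $|\nabla u|\ge|a|/(C\sqrt\epsilon)$ at some point of $N_v$. -/

import Mathlib

noncomputable section

namespace TwoRows

/-! The Euclidean plane `ℝ²` is `ℂ` as a real inner product space: the point `(x, y)` is `x + iy`,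
the vector `(1, 0)` is `1` and the vector `(0, 1)` is `Complex.I`. -/

/-- Center of the `n`-th disk of the right row. -/
def centerR (ε δ : ℝ) (n : ℤ) : ℂ := ⟨1 + ε / 2, n * (2 + δ)⟩

/-- Center of the `n`-th disk of the left row. -/
def centerL (ε δ : ℝ) (n : ℤ) : ℂ := ⟨-1 - ε / 2, n * (2 + δ)⟩

/-- The open unit disk `D_{Rn}`. -/
def diskR (ε δ : ℝ) (n : ℤ) : Set ℂ := Metric.ball (centerR ε δ n) 1

/-- The open unit disk `D_{Ln}`. -/
def diskL (ε δ : ℝ) (n : ℤ) : Set ℂ := Metric.ball (centerL ε δ n) 1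

/-- The open region outside all the conductors. -/
def exterior (ε δ : ℝ) : Set ℂ := (closure (⋃ n : ℤ, diskL ε δ n ∪ diskR ε δ n))ᶜ

/-- The horizontal strip `Ω = ℝ × (-1 - δ/2, 1 + δ/2)`, one period of the structure. -/
def strip (δ : ℝ) : Set ℂ := {z | -1 - δ / 2 < z.im ∧ z.im < 1 + δ / 2}

/-- The flux `∫_{∂D} ∂_ν u ds` through the boundary of the unit disk `D` with center `c`. The unit
normal at `z ∈ ∂D` pointing into `D` is `c - z`, and the gradient at a boundary point is the
one-sided gradient taken from the closed region outside the conductors. -/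
def flux (ε δ : ℝ) (u : ℂ → ℝ) (c : ℂ) : ℝ :=
  ∫ θ in (0 : ℝ)..(2 * Real.pi),
    inner ℝ (gradientWithin u (closure (exterior ε δ)) (circleMap c 1 θ)) (c - circleMap c 1 θ)

/-- `u` is a (classical) solution of the perfect conductivity problem with applied potential `H`.
Only the values of `u` on the closed region outside the conductors matter. -/
structure IsSolution (ε δ : ℝ) (H u : ℂ → ℝ) : Prop where
  harmonic : InnerProductSpace.HarmonicOnNhd u (exterior ε δ)
  /-- `u` is `C¹` up to the boundary, so that its boundary values and fluxes make sense. -/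
  contDiffOn : ContDiffOn ℝ 1 u (closure (exterior ε δ))
  const_left : ∃ cL : ℝ, ∀ z ∈ frontier (diskL ε δ 0), u z = cL
  const_right : ∃ cR : ℝ, ∀ z ∈ frontier (diskR ε δ 0), u z = cR
  flux_left : flux ε δ u (centerL ε δ 0) = 0
  flux_right : flux ε δ u (centerR ε δ 0) = 0
  energy : MeasureTheory.IntegrableOn (fun z => ‖gradient (fun w => u w - H w) z‖ ^ 2)
    (strip δ \ closure (diskL ε δ 0 ∪ diskR ε δ 0))
  periodic : ∀ z ∈ exterior ε δ, gradient u z = gradient u (z + (2 + δ : ℝ) * Complex.I)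

/-- The linear potential `H(x, y) = a x + b y`. -/
def linearPotential (a b : ℝ) (z : ℂ) : ℝ := a * z.re + b * z.im

/-- The narrow region between `D_{L0}` and `D_{R0}`. -/
def narrowV (ε : ℝ) : Set ℂ :=
  {z | |z.re| < 1 + ε / 2 - √(1 - z.im ^ 2) ∧ |z.im| < √3 / 2}

/-- The narrow region between `D_{R0}` and `D_{R1}`. -/
def narrowH (ε δ : ℝ) : Set ℂ :=
  {z | |z.im - 1 - δ / 2| < 1 + δ / 2 - √(1 - (z.re - 1 - ε / 2) ^ 2) ∧
    |z.re - 1 - ε / 2| < √3 / 2}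

/-- The function `S`. -/
def S (ε δ : ℝ) (z : ℂ) : ℝ :=
  -2 * √δ * ((z.re - 1 - ε / 2) * (z.im - 1 - δ / 2) / ((z.re - 1 - ε / 2) ^ 2 + δ) ^ 2)

/-- The vector field `(0,1) / (δ + (x - 1 - ε/2)²) + (S(x,y) / √δ) (1,0)`. -/
def asympH (ε δ : ℝ) (z : ℂ) : ℂ :=
  (1 / (δ + (z.re - 1 - ε / 2) ^ 2)) • Complex.I + (1 / √δ * S ε δ z) • (1 : ℂ)

/-- The vector field `√ε / (ε + y²) (1,0)`. -/
def asympV (ε : ℝ) (z : ℂ) : ℂ := (√ε / (ε + z.im ^ 2)) • (1 : ℂ)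

end TwoRows

end

noncomputable section

namespace TwoRows

open Complex Metric Set Topology Filter InnerProductSpace ComplexConjugate MeasureTheory
open scoped ENNReal

/-! ### Harmonic functions of one complex variable -/

/-! The blow-up in a gap is carried by an explicit potential, and what remains after subtracting it
has a gradient bounded uniformly in ε and δ. The circles bounding two unit disks at distance ε are
level sets of log(|p + ζ| / |p - ζ|) with p² = (1 + ε/2)² - 1 (circles of Apollonius); normalized,
this is `gapFun`. If V is the potential difference of the two disks, then u minus its mean value on
them minus V times `gapFun` is bounded and vanishes on both circles, and no other disk comes within
1/5 of the gap point. A logarithmic barrier outside a single disk bounds its gradient with a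
constant depending only on this radius, however close the disks are
(`VanishesNear.norm_gradient_le`, `norm_gradient_sub_gapDeriv_le`). Expanding the derivative of
`gapFun` in the gap (`norm_gapDeriv_sub_le`) gives the asymptotic forms, so everything reduces to
the potential differences.

Within a row, periodicity prescribes the difference b(2 + δ). Between the rows, V = cR - cL is found
from a flux balance. Finite energy forces the gradient of u to tend to (a, b), and the disks carry
no flux, so the flux through one period of the axis x = 0 is a(2 + δ). The model contributes VΦ to
it with Φ of order 1/√ε (`abs_flux_sub_le`, `gapFlux_bounds`), whence |V| ≤ const · √ε(|a| + |b|).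
Averaging with the reflection y ↦ -y removes b without changing V. By linearity two solutions with
the same a then differ by a solution with a = b = 0, for which this bound gives V = 0. Hence V =
aμ₀√ε with μ₀ independent of the solution; existence of solutions plays no role.

For the lower bound on μ₀ the error in the flux balance must be at most half of the total flux, so
for (a, b) = (1, 0) the potential must be nearly confined between cL and cR near the axis. This is
screening: when δ is small, a cosh · cos barrier makes u nearly equal to the row's constant at the
waist of each thin gap of that row (`le_of_gap`), and the maximum principle transfers this to the
strip between the rows. -/

theorem hasGradientAt_re {F : ℂ → ℂ} {F' z : ℂ} (h : HasDerivAt F F' z) :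
    HasGradientAt (fun w => (F w).re) (conj F') z := by
  rw [hasGradientAt_iff_hasFDerivAt]
  have h1 := reCLM.hasFDerivAt.comp z (h.hasFDerivAt.restrictScalars ℝ)
  refine HasFDerivAt.congr_fderiv h1 ?_
  ext
  simp [toDual_apply_apply, Complex.inner]

theorem gradient_eq_fderiv {u : ℂ → ℝ} (z : ℂ) :
    gradient u z = (fderiv ℝ u z 1 : ℂ) + I * fderiv ℝ u z I := by
  have h1 : inner ℝ (gradient u z) 1 = fderiv ℝ u z 1 := inner_gradient_left ..
  have h2 : inner ℝ (gradient u z) I = fderiv ℝ u z I := inner_gradient_left ..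
  rw [Complex.inner] at h1 h2
  apply Complex.ext
  · simpa using h1
  · simpa using h2

theorem harmonicOnNhd_ball_exists {u : ℂ → ℝ} {z : ℂ} (h : HarmonicAt u z) :
    ∃ d > 0, HarmonicOnNhd u (ball z d) := by
  obtain ⟨d, hd, hb⟩ := Metric.eventually_nhds_iff_ball.1 h.eventually
  exact ⟨d, hd, fun w hw => hb w hw⟩

/-- With u = Re F and M' > M, the function exp(F/M') has modulus between e⁻¹ and e. Cauchy's
estimate for it bounds F' from a bound on the real part alone, without controlling the harmonic
conjugate. -/
theorem norm_gradient_le_of_abs_le {u : ℂ → ℝ} {z : ℂ} {d M : ℝ} (hd : 0 < d)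
    (hu : HarmonicOnNhd u (ball z d)) (hM : ∀ w ∈ ball z d, |u w| ≤ M) :
    ‖gradient u z‖ ≤ 16 * M / d := by
  obtain ⟨F, hF, hFu⟩ := hu.exists_analyticOnNhd_ball_re_eq
  have hz : z ∈ ball z d := mem_ball_self hd
  have hgrad : gradient u z = conj (deriv F z) := by
    have h1 := hasGradientAt_re (hF z hz).differentiableAt.hasDerivAt
    have h2 : (fun w => (F w).re) =ᶠ[𝓝 z] u := by
      filter_upwards [isOpen_ball.mem_nhds hz] with w hw using hFu hw
    exact (h1.congr_of_eventuallyEq h2.symm).gradient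
  rw [hgrad, RCLike.norm_conj]
  have hM0 : 0 ≤ M := (abs_nonneg _).trans (hM z hz)
  -- M' is strictly larger than M so that the division below also makes sense for M = 0; M' → M at
  -- the end.
  have key : ∀ M' > M, ‖deriv F z‖ ≤ 16 * M' / d := by
    intro M' hM'
    have hM'0 : 0 < M' := hM0.trans_lt hM'
    set G : ℂ → ℂ := fun w => exp (F w / M') with hG
    have hdiff : ∀ w ∈ ball z d, DifferentiableAt ℂ G w := fun w hw =>
      ((hF w hw).differentiableAt.div_const _).cexp
    have hGn : ∀ w ∈ ball z d, ‖G w‖ ≤ Real.exp 1 := by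
      intro w hw
      rw [hG, norm_exp, div_ofReal_re]
      gcongr
      rw [show (F w).re = u w from hFu hw, div_le_one hM'0]
      exact (le_abs_self _).trans ((hM w hw).trans hM'.le)
    have hGz : Real.exp (-1) ≤ ‖G z‖ := by
      rw [hG, norm_exp, div_ofReal_re]
      gcongr
      rw [show (F z).re = u z from hFu hz, le_div_iff₀ hM'0]
      have := (neg_abs_le (u z)).trans' (neg_le_neg ((hM z hz).trans hM'.le))
      linarith
    have hsub : closedBall z (d / 2) ⊆ ball z d := closedBall_subset_ball (by linarith)
    have hC : ‖deriv G z‖ ≤ Real.exp 1 / (d / 2) := by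
      refine norm_deriv_le_of_forall_mem_sphere_norm_le (by positivity) ?_ ?_
      · refine DifferentiableOn.diffContOnCl ?_
        rw [closure_ball _ (by positivity)]
        exact fun w hw => (hdiff w (hsub hw)).differentiableWithinAt
      · exact fun w hw => hGn w (hsub (sphere_subset_closedBall hw))
    have hdG : deriv G z = G z * (deriv F z / M') :=
      (((hF z hz).differentiableAt.hasDerivAt.div_const _).cexp).deriv
    rw [hdG, norm_mul, norm_div, norm_real, Real.norm_of_nonneg hM'0.le] at hC
    have h3 : Real.exp (-1) * (‖deriv F z‖ / M') ≤ Real.exp 1 / (d / 2) :=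
      (mul_le_mul_of_nonneg_right hGz (by positivity)).trans hC
    have h4 : ‖deriv F z‖ / M' ≤ Real.exp 2 * 2 / d := by
      have := mul_le_mul_of_nonneg_left h3 (Real.exp_pos 1).le
      rw [← mul_assoc, ← Real.exp_add] at this
      norm_num at this
      refine this.trans (le_of_eq ?_)
      rw [show (2 : ℝ) = 1 + 1 by norm_num, Real.exp_add]
      field_simp
    have he : Real.exp 2 ≤ 8 := by
      have h5 := Real.exp_one_lt_d9
      rw [show (2 : ℝ) = 1 + 1 by norm_num, Real.exp_add]
      nlinarith [Real.exp_pos 1]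
    rw [div_le_iff₀ hM'0] at h4
    calc ‖deriv F z‖ ≤ Real.exp 2 * 2 / d * M' := h4
      _ ≤ 8 * 2 / d * M' := by gcongr
      _ = 16 * M' / d := by ring
  have hlim : Tendsto (fun M' : ℝ => 16 * M' / d) (𝓝[>] M) (𝓝 (16 * M / d)) := by
    refine (Continuous.tendsto (by fun_prop) M).mono_left nhdsWithin_le_nhds
  refine ge_of_tendsto hlim ?_
  filter_upwards [self_mem_nhdsWithin] with M' hM' using key M' hM'

/-- The maximum modulus principle applies to exp F with Re F = w, since its modulus is exp w. -/
theorem eventually_eq_of_isLocalMax {w : ℂ → ℝ} {z : ℂ} (hw : HarmonicAt w z)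
    (hmax : IsLocalMax w z) : ∀ᶠ y in 𝓝 z, w y = w z := by
  obtain ⟨d, hd, hb⟩ := harmonicOnNhd_ball_exists hw
  obtain ⟨F, hF, hFu⟩ := hb.exists_analyticOnNhd_ball_re_eq
  have hz : z ∈ ball z d := mem_ball_self hd
  have hev : ∀ᶠ y in 𝓝 z, y ∈ ball z d := isOpen_ball.mem_nhds hz
  have h1 : ∀ᶠ y in 𝓝 z, DifferentiableAt ℂ (fun y => exp (F y)) y := by
    filter_upwards [hev] with y hy using (hF y hy).differentiableAt.cexp
  have hn : ∀ y ∈ ball z d, ‖exp (F y)‖ = Real.exp (w y) := fun y hy => by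
    rw [norm_exp, show (F y).re = w y from hFu hy]
  have h2 : IsLocalMax (norm ∘ fun y => exp (F y)) z := by
    filter_upwards [hev, hmax] with y hy hy2
    simp only [Function.comp, hn y hy, hn z hz]
    gcongr
  filter_upwards [hev, Complex.eventually_eq_of_isLocalMax_norm h1 h2] with y hy hy2
  have := congrArg norm hy2
  rw [hn y hy, hn z hz] at this
  exact Real.exp_injective this

/-- A maximum principle for a function on `P` that is determined, along each vertical line, by its
values on a compact subset of `P`. -/
theorem le_of_harmonicOnNhd {P U C₀ : Set ℂ} {w : ℂ → ℝ} {m : ℝ} (hU : IsOpen U) (hUP : U ⊆ P)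
    (hC₀ : IsCompact C₀) (hC₀P : C₀ ⊆ P) (hcont : ContinuousOn w C₀) (hw : HarmonicOnNhd w U)
    (hrep : ∀ z ∈ P, ∃ z' ∈ C₀, z'.re = z.re ∧ w z' = w z)
    (hbd : ∀ z ∈ P, z ∉ U → w z ≤ m) : ∀ z ∈ P, w z ≤ m := by
  intro z hz
  by_contra! hlt
  obtain ⟨z', hz', -, -⟩ := hrep z hz
  obtain ⟨s, hs, hmax⟩ := hC₀.exists_isMaxOn ⟨z', hz'⟩ hcont
  have hmaxP : ∀ y ∈ P, w y ≤ w s := fun y hy => by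
    obtain ⟨y', hy', -, h⟩ := hrep y hy
    exact h ▸ hmax hy'
  have hsm : m < w s := hlt.trans_le (hmaxP z hz)
  have hZ : IsCompact (C₀ ∩ w ⁻¹' {w s}) :=
    hC₀.of_isClosed_subset (hcont.preimage_isClosed_of_isClosed hC₀.isClosed isClosed_singleton)
      inter_subset_left
  -- Among all maximum points, take one with the largest real part. If it were in U, then w would be
  -- constant nearby and a point slightly to its right would also be a maximum; its representative
  -- in C₀ has the same real part, a contradiction. No connectedness of U is needed.
  obtain ⟨t, ht, hre⟩ := hZ.exists_isMaxOn ⟨s, hs, rfl⟩ continuous_re.continuousOn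
  have htw : w t = w s := ht.2
  have htU : t ∈ U := by
    by_contra h
    exact (hbd t (hC₀P ht.1) h).not_gt (htw ▸ hsm)
  have hloc : IsLocalMax w t := by
    filter_upwards [hU.mem_nhds htU] with y hy
    exact htw ▸ hmaxP y (hUP hy)
  have hev := (eventually_eq_of_isLocalMax (hw t htU) hloc).and (hU.mem_nhds htU)
  obtain ⟨e, he, hball⟩ := Metric.eventually_nhds_iff_ball.1 hev
  have hmem : t + (e / 2 : ℝ) ∈ ball t e := by
    simp [abs_of_pos he, he]
  obtain ⟨h1, h2⟩ := hball _ hmem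
  obtain ⟨y, hy, hyre, hyw⟩ := hrep _ (hUP h2)
  have := hre (a := y) ⟨hy, hyw.trans (h1.trans htw)⟩
  simp only [mem_ofPred_eq, hyre, add_re, ofReal_re] at this
  linarith

/-- The set of points near which w equals its maximum is open by definition, and relatively closed
by continuity and the local principle. -/
theorem eq_of_isMax_of_isPreconnected {U : Set ℂ} {w : ℂ → ℝ} (hU : IsOpen U)
    (hc : IsPreconnected U) (hw : HarmonicOnNhd w U) {z : ℂ} (hz : z ∈ U)
    (hmax : ∀ y ∈ U, w y ≤ w z) : ∀ y ∈ U, w y = w z := by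
  have hcont : ContinuousOn w U := fun y hy => (hw y hy).1.continuousAt.continuousWithinAt
  set A : Set ℂ := {y | ∀ᶠ x in 𝓝 y, w x = w z} with hA
  have hAo : IsOpen A := isOpen_iff_mem_nhds.2 fun y hy => by
    have := eventually_eventually_nhds.2 hy
    exact this
  have hmem : ∀ y ∈ U, w y = w z → y ∈ A := fun y hy h => by
    have hloc : IsLocalMax w y := by
      filter_upwards [hU.mem_nhds hy] with x hx
      exact h ▸ hmax x hx
    have := eventually_eq_of_isLocalMax (hw y hy) hloc
    rwa [h] at this
  have hsub : U ⊆ A := by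
    refine hc.subset_of_closure_inter_subset hAo ⟨z, hz, hmem z hz rfl⟩ ?_
    rintro y ⟨hy, hyU⟩
    refine hmem y hyU ?_
    by_contra hne
    have h1 : ∀ᶠ x in 𝓝 y, w x ≠ w z :=
      (hw y hyU).1.continuousAt.eventually_ne hne
    obtain ⟨x, hx, hxA⟩ := mem_closure_iff_nhds.1 hy _ h1
    exact hx (hxA.self_of_nhds)
  exact fun y hy => (hsub hy).self_of_nhds

/-! ### Geometry of the two rows of disks -/

/-- The centers of all the disks. -/
def centers (ε δ : ℝ) : Set ℂ := range (centerL ε δ) ∪ range (centerR ε δ)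

/-- The closed region outside the open disks. -/
def closedExterior (ε δ : ℝ) : Set ℂ := {z | ∀ c ∈ centers ε δ, 1 ≤ dist z c}

theorem one_lt_dist_iff {z c : ℂ} :
    1 < dist z c ↔ 1 < (z.re - c.re) ^ 2 + (z.im - c.im) ^ 2 := by
  rw [dist_eq_re_im, Real.lt_sqrt zero_le_one, one_pow]

theorem one_le_dist_iff {z c : ℂ} :
    1 ≤ dist z c ↔ 1 ≤ (z.re - c.re) ^ 2 + (z.im - c.im) ^ 2 := by
  rw [dist_eq_re_im, Real.le_sqrt' one_pos, one_pow]

/-- The row is locally finite: the heights of the centers grow at least like 2|n|, so a unit ball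
meets finitely many of the disks. -/
theorem isClosed_iUnion_closedBall {δ : ℝ} (hδ : 0 < δ) (c : ℤ → ℂ)
    (hc : ∀ n, (c n).im = n * (2 + δ)) : IsClosed (⋃ n, closedBall (c n) 1) := by
  refine LocallyFinite.isClosed_iUnion (fun z => ⟨ball z 1, ball_mem_nhds z one_pos, ?_⟩)
    fun n => isClosed_closedBall
  refine (Set.finite_Icc (-⌈|z.im| + 2⌉) ⌈|z.im| + 2⌉).subset ?_
  rintro n ⟨w, hw, hwz⟩
  have h1 : |w.im - (c n).im| ≤ 1 := by
    rw [← sub_im]; exact (abs_im_le_norm _).trans (by simpa [dist_eq] using hw)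
  have h2 : |w.im - z.im| ≤ 1 := by
    rw [← sub_im]; exact (abs_im_le_norm _).trans (mem_ball_iff_norm.1 hwz).le
  have h3 : |(n : ℝ)| ≤ |z.im| + 2 := by
    have h4 : |(n : ℝ)| ≤ |(n : ℝ) * (2 + δ)| := by
      rw [abs_mul, abs_of_pos (by linarith : 0 < 2 + δ)]
      nlinarith [abs_nonneg (n : ℝ)]
    rw [← hc] at h4
    rw [abs_le] at h1 h2
    refine h4.trans (abs_le.2 ⟨?_, ?_⟩)
    · linarith [neg_abs_le z.im]
    · linarith [le_abs_self z.im]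
  have h4 := h3.trans (Int.le_ceil _)
  rw [← Int.cast_abs, Int.cast_le, abs_le] at h4
  exact h4

theorem mem_exterior {ε δ : ℝ} (hδ : 0 < δ) {z : ℂ} :
    z ∈ exterior ε δ ↔ ∀ c ∈ centers ε δ, 1 < dist z c := by
  have hcl : closure (⋃ n : ℤ, diskL ε δ n ∪ diskR ε δ n) =
      (⋃ n, closedBall (centerL ε δ n) 1) ∪ ⋃ n, closedBall (centerR ε δ n) 1 := by
    rw [iUnion_union_distrib, closure_union]
    have hrow : ∀ c : ℤ → ℂ, (∀ n, (c n).im = n * (2 + δ)) →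
        closure (⋃ n, ball (c n) 1) = ⋃ n, closedBall (c n) 1 := fun c hc => by
      refine subset_antisymm (closure_minimal (iUnion_mono fun n => ball_subset_closedBall)
        (isClosed_iUnion_closedBall hδ c hc)) (iUnion_subset fun n => ?_)
      rw [← closure_ball _ one_ne_zero]
      exact closure_mono (subset_iUnion (fun n => ball (c n) 1) n)
    exact congrArg₂ _ (hrow _ fun _ => rfl) (hrow _ fun _ => rfl)
  rw [exterior, hcl]
  simp [centers, or_imp, forall_and]

theorem isOpen_exterior (ε δ : ℝ) : IsOpen (exterior ε δ) := isClosed_closure.isOpen_compl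

theorem isClosed_closedExterior (ε δ : ℝ) : IsClosed (closedExterior ε δ) := by
  have : closedExterior ε δ = ⋂ c ∈ centers ε δ, {z | 1 ≤ dist z c} := by
    ext; simp [closedExterior]
  rw [this]
  exact isClosed_biInter fun c _ => isClosed_le continuous_const (by fun_prop)

theorem exterior_subset {ε δ : ℝ} (hδ : 0 < δ) : exterior ε δ ⊆ closedExterior ε δ :=
  fun _ hz c hc => ((mem_exterior hδ).1 hz c hc).le

theorem mem_exterior_iff {ε δ : ℝ} (hδ : 0 < δ) {z : ℂ} :
    z ∈ exterior ε δ ↔ ∀ n : ℤ, 1 < (z.re - (-1 - ε / 2)) ^ 2 + (z.im - n * (2 + δ)) ^ 2 ∧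
      1 < (z.re - (1 + ε / 2)) ^ 2 + (z.im - n * (2 + δ)) ^ 2 := by
  rw [mem_exterior hδ]
  simp [centers, or_imp, forall_and, one_lt_dist_iff, centerL, centerR]

theorem abs_im_sub_ge {δ y : ℝ} (hδ : 0 < δ) (hy : |y| ≤ 1 + δ / 2) {n : ℤ} (hn : n ≠ 0) :
    1 + δ / 2 ≤ |y - n * (2 + δ)| := by
  have h1 : (1 : ℝ) ≤ |(n : ℝ)| := by
    rw [← Int.cast_abs]; exact_mod_cast Int.one_le_abs hn
  have h2 : |(n : ℝ) * (2 + δ)| = |(n : ℝ)| * (2 + δ) := by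
    rw [abs_mul, abs_of_pos (by linarith : 0 < 2 + δ)]
  have h3 := abs_sub_abs_le_abs_sub ((n : ℝ) * (2 + δ)) y
  rw [abs_sub_comm, h2] at h3
  nlinarith

theorem one_lt_sq_of_ne_zero {δ y x : ℝ} (hδ : 0 < δ) (hy : |y| ≤ 1 + δ / 2) {n : ℤ}
    (hn : n ≠ 0) : 1 < x ^ 2 + (y - n * (2 + δ)) ^ 2 := by
  have h := abs_im_sub_ge hδ hy hn
  rw [← sq_abs (y - n * (2 + δ))]
  nlinarith [sq_nonneg x]

theorem mem_exterior_of_abs_im_le {ε δ : ℝ} (hδ : 0 < δ) {z : ℂ} (hy : |z.im| ≤ 1 + δ / 2)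
    (hL : 1 < (z.re - (-1 - ε / 2)) ^ 2 + z.im ^ 2) (hR : 1 < (z.re - (1 + ε / 2)) ^ 2 + z.im ^ 2) :
    z ∈ exterior ε δ := by
  rw [mem_exterior_iff hδ]
  intro n
  rcases eq_or_ne n 0 with rfl | hn
  · simpa using ⟨hL, hR⟩
  · exact ⟨one_lt_sq_of_ne_zero hδ hy hn, one_lt_sq_of_ne_zero hδ hy hn⟩

theorem add_period_mem_centers {ε δ : ℝ} (n : ℤ) {c : ℂ} (hc : c ∈ centers ε δ) :
    c + n * (2 + δ : ℝ) * I ∈ centers ε δ := by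
  rcases hc with ⟨m, rfl⟩ | ⟨m, rfl⟩
  · exact Or.inl ⟨m + n, by apply Complex.ext <;> simp [centerL]; ring⟩
  · exact Or.inr ⟨m + n, by apply Complex.ext <;> simp [centerR]; ring⟩

theorem forall_centers_period {ε δ : ℝ} (n : ℤ) {p : ℝ → Prop} {z : ℂ} :
    (∀ c ∈ centers ε δ, p (dist (z + n * (2 + δ : ℝ) * I) c)) ↔
      ∀ c ∈ centers ε δ, p (dist z c) := by
  refine ⟨fun h c hc => ?_, fun h c hc => ?_⟩
  · have := h _ (add_period_mem_centers n hc)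
    rwa [dist_add_right] at this
  · have := h _ (add_period_mem_centers (-n) hc)
    convert this using 1
    rw [dist_eq, dist_eq]
    congr 1; push_cast; ring

theorem add_period_mem_exterior {ε δ : ℝ} (hδ : 0 < δ) (n : ℤ) {z : ℂ} :
    z + n * (2 + δ : ℝ) * I ∈ exterior ε δ ↔ z ∈ exterior ε δ := by
  rw [mem_exterior hδ, mem_exterior hδ]
  exact forall_centers_period n

theorem add_period_mem_closedExterior {ε δ : ℝ} (n : ℤ) {z : ℂ} :
    z + n * (2 + δ : ℝ) * I ∈ closedExterior ε δ ↔ z ∈ closedExterior ε δ :=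
  forall_centers_period n

theorem exists_period_abs_im_le {δ : ℝ} (hδ : 0 < δ) (z : ℂ) :
    ∃ n : ℤ, |(z + n * (2 + δ : ℝ) * I).im| ≤ 1 + δ / 2 := by
  refine ⟨-round (z.im / (2 + δ)), ?_⟩
  have h := abs_sub_round (z.im / (2 + δ))
  have hT : 0 < 2 + δ := by linarith
  have h2 : (z + ((-round (z.im / (2 + δ)) : ℤ) : ℂ) * (2 + δ : ℝ) * I).im =
      (z.im / (2 + δ) - round (z.im / (2 + δ))) * (2 + δ) := by
    simp; field_simp; ring
  rw [h2, abs_mul, abs_of_pos hT]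
  nlinarith

/-- This is what isolates each circle: a neighbourhood of radius min ε δ of a point of one circle
meets no other disk. -/
theorem two_add_le_dist_centers {ε δ : ℝ} (hδ : 0 < δ) {c c' : ℂ}
    (hc : c ∈ centers ε δ) (hc' : c' ∈ centers ε δ) (hne : c ≠ c') :
    2 + min ε δ ≤ dist c c' := by
  have hv : ∀ m n : ℤ, m ≠ n → 2 + δ ≤ |(m : ℝ) * (2 + δ) - n * (2 + δ)| := fun m n h => by
    rw [← sub_mul, abs_mul, abs_of_pos (by linarith : 0 < 2 + δ)]
    have : (1 : ℝ) ≤ |(m : ℝ) - n| := by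
      rw [← Int.cast_sub, ← Int.cast_abs]; exact_mod_cast Int.one_le_abs (sub_ne_zero.2 h)
    nlinarith
  have him : |c.im - c'.im| ≤ dist c c' := by rw [dist_eq, ← sub_im]; exact abs_im_le_norm _
  have hre : |c.re - c'.re| ≤ dist c c' := by rw [dist_eq, ← sub_re]; exact abs_re_le_norm _
  have h1 := min_le_left ε δ
  have h2 := min_le_right ε δ
  rcases hc with ⟨m, rfl⟩ | ⟨m, rfl⟩ <;> rcases hc' with ⟨n, rfl⟩ | ⟨n, rfl⟩
  · have := hv m n (fun h => hne (by rw [h]))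
    simp only [centerL] at him ⊢; linarith
  · have := neg_abs_le ((centerL ε δ m).re - (centerR ε δ n).re)
    simp only [centerL, centerR] at hre this ⊢; linarith
  · have := le_abs_self ((centerR ε δ m).re - (centerL ε δ n).re)
    simp only [centerL, centerR] at hre this ⊢; linarith
  · have := hv m n (fun h => hne (by rw [h]))
    simp only [centerR] at him ⊢; linarith

/-- Near a boundary point of a disk, the complement of that disk is outside all the disks. -/
theorem one_lt_dist_of_dist_eq_one {ε δ : ℝ} (hδ : 0 < δ) {c c' z w : ℂ}
    (hc : c ∈ centers ε δ) (hc' : c' ∈ centers ε δ) (hne : c' ≠ c) (hz : dist z c = 1)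
    (hw : dist w z < min ε δ) : 1 < dist w c' := by
  have h1 := two_add_le_dist_centers hδ hc hc' hne.symm
  have h2 := dist_triangle c z c'
  have h3 := dist_triangle z w c'
  rw [dist_comm c z] at h2
  rw [dist_comm z w] at h3
  linarith

theorem mem_exterior_of_dist_lt {ε δ : ℝ} (hδ : 0 < δ) {c z w : ℂ}
    (hc : c ∈ centers ε δ) (hz : dist z c = 1) (hw : dist w z < min ε δ) (hwc : 1 < dist w c) :
    w ∈ exterior ε δ := by
  rw [mem_exterior hδ]
  intro c' hc'
  rcases eq_or_ne c' c with rfl | hne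
  · exact hwc
  · exact one_lt_dist_of_dist_eq_one hδ hc hc' hne hz hw

theorem exists_center_of_mem_diff {ε δ : ℝ} (hδ : 0 < δ) {z : ℂ} (hz : z ∈ closedExterior ε δ)
    (hzE : z ∉ exterior ε δ) : ∃ c ∈ centers ε δ, dist z c = 1 := by
  rw [mem_exterior hδ] at hzE
  push Not at hzE
  obtain ⟨c, hc, h⟩ := hzE
  exact ⟨c, hc, le_antisymm h (hz c hc)⟩

theorem dist_center_add_mul {c z : ℂ} (hz : dist z c = 1) {t : ℝ} (ht : 0 ≤ 1 + t) :
    dist (z + t * (z - c)) c = 1 + t := by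
  rw [dist_eq, show z + t * (z - c) - c = ((1 + t : ℝ) : ℂ) * (z - c) by push_cast; ring,
    norm_mul, ← dist_eq, hz, norm_real, Real.norm_of_nonneg ht, mul_one]

theorem dist_add_mul {c z : ℂ} (hz : dist z c = 1) {t : ℝ} (ht : 0 ≤ t) :
    dist (z + t * (z - c)) z = t := by
  rw [dist_eq, add_sub_cancel_left, norm_mul, ← dist_eq, hz, norm_real, Real.norm_of_nonneg ht,
    mul_one]

theorem closure_exterior {ε δ : ℝ} (hε : 0 < ε) (hδ : 0 < δ) :
    closure (exterior ε δ) = closedExterior ε δ := by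
  refine subset_antisymm (closure_minimal (exterior_subset hδ) (isClosed_closedExterior ε δ)) ?_
  intro z hz
  by_cases hzE : z ∈ exterior ε δ
  · exact subset_closure hzE
  obtain ⟨c, hc, hzc⟩ := exists_center_of_mem_diff hδ hz hzE
  rw [Metric.mem_closure_iff]
  intro r hr
  have hmin : 0 < min (min ε δ) r := by positivity
  have ht : 0 ≤ min (min ε δ) r / 2 := by positivity
  have h1 := min_le_left (min ε δ) r
  have h2 := min_le_right (min ε δ) r
  refine ⟨z + (min (min ε δ) r / 2 : ℝ) * (z - c),
    mem_exterior_of_dist_lt hδ hc hzc ?_ ?_, ?_⟩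
  · rw [dist_add_mul hzc ht]; linarith
  · rw [dist_center_add_mul hzc (by linarith)]; linarith
  · rw [dist_comm, dist_add_mul hzc ht]; linarith

/-- Each boundary point lies on a small closed ball that touches its circle from outside and stays
in the region. This makes the one-sided gradient in the definition of the flux well determined and
continuous. -/
theorem uniqueDiffOn_closedExterior {ε δ : ℝ} (hε : 0 < ε) (hδ : 0 < δ) :
    UniqueDiffOn ℝ (closedExterior ε δ) := by
  intro z hz
  by_cases hzE : z ∈ exterior ε δ
  · exact ((isOpen_exterior ε δ).uniqueDiffWithinAt hzE).mono (exterior_subset hδ)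
  obtain ⟨c, hc, hzc⟩ := exists_center_of_mem_diff hδ hz hzE
  have hmin : 0 < min ε δ := by positivity
  set t : ℝ := min ε δ / 4 with ht
  have ht0 : 0 < t := by positivity
  have hu : UniqueDiffWithinAt ℝ (closedBall (z + t * (z - c)) t) z := by
    refine uniqueDiffWithinAt_convex (convex_closedBall _ _) ?_ ?_
    · rw [interior_closedBall _ ht0.ne']; exact ⟨_, mem_ball_self ht0⟩
    · refine subset_closure ?_
      rw [mem_closedBall, dist_comm, dist_add_mul hzc ht0.le]
  refine hu.mono fun w hw c' hc' => ?_
  rw [mem_closedBall] at hw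
  rcases eq_or_ne c' c with rfl | hne
  · have h1 := dist_center_add_mul hzc (by linarith : 0 ≤ 1 + t)
    have h2 := dist_triangle (z + t * (z - c')) w c'
    rw [dist_comm _ w] at h2
    linarith
  · refine (one_lt_dist_of_dist_eq_one hδ hc hc' hne hzc ?_).le
    have := dist_triangle w (z + t * (z - c)) z
    rw [dist_add_mul hzc ht0.le] at this
    linarith

/-- The vertical lines x = 0 and |x| > 2 + ε/2 avoid all disks, and the horizontal line at half a
period joins them. Every point reaches one of these vertical lines by a horizontal segment along
which it either recedes from each center or is already at horizontal distance more than 1. -/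
theorem isPreconnected_exterior {ε δ : ℝ} (hε : 0 < ε) (hδ : 0 < δ) :
    IsPreconnected (exterior ε δ) := by
  have hseg : ∀ {z w : ℂ}, segment ℝ z w ⊆ exterior ε δ → JoinedIn (exterior ε δ) z w :=
    fun h => JoinedIn.of_segment_subset h
  have hmem : ∀ x : ℝ, (x = 0 ∨ 2 + ε / 2 < |x|) → ∀ y : ℝ, (⟨x, y⟩ : ℂ) ∈ exterior ε δ := by
    intro x hx y
    rw [mem_exterior_iff hδ]
    intro n
    rcases hx with rfl | hx
    · constructor <;> nlinarith [sq_nonneg (y - n * (2 + δ))]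
    · rcases lt_abs.1 hx with h | h
      · constructor <;> nlinarith [sq_nonneg (y - n * (2 + δ))]
      · constructor <;> nlinarith [sq_nonneg (y - n * (2 + δ))]
  have hvert : ∀ x : ℝ, (x = 0 ∨ 2 + ε / 2 < |x|) → ∀ y y' : ℝ,
      JoinedIn (exterior ε δ) ⟨x, y⟩ ⟨x, y'⟩ := by
    intro x hx y y'
    refine hseg ?_
    rw [segment_subset_iff]
    intro a b ha hb hab
    convert hmem x hx (a * y + b * y') using 1
    apply Complex.ext
    · simp [← add_mul, hab]
    · simp
  have hhor : ∀ x : ℝ, JoinedIn (exterior ε δ) ⟨x, 1 + δ / 2⟩ ⟨0, 1 + δ / 2⟩ := by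
    intro x
    refine hseg ?_
    rw [segment_subset_iff]
    intro a b ha hb hab
    have him : (a • (⟨x, 1 + δ / 2⟩ : ℂ) + b • (⟨0, 1 + δ / 2⟩ : ℂ)).im = 1 + δ / 2 := by
      simp [← add_mul, hab]
    have h1 : 1 < (1 + δ / 2) ^ 2 := by nlinarith
    refine mem_exterior_of_abs_im_le hδ ?_ ?_ ?_ <;> rw [him]
    · rw [abs_of_pos (by linarith)]
    · nlinarith [sq_nonneg ((a • (⟨x, 1 + δ / 2⟩ : ℂ) + b • (⟨0, 1 + δ / 2⟩ : ℂ)).re - (-1 - ε / 2))]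
    · nlinarith [sq_nonneg ((a • (⟨x, 1 + δ / 2⟩ : ℂ) + b • (⟨0, 1 + δ / 2⟩ : ℂ)).re - (1 + ε / 2))]
  have hline : ∀ x : ℝ, (x = 0 ∨ 2 + ε / 2 < |x|) → ∀ y : ℝ,
      JoinedIn (exterior ε δ) ⟨x, y⟩ ⟨0, 0⟩ := fun x hx y =>
    (hvert x hx y (1 + δ / 2)).trans ((hhor x).trans (hvert 0 (Or.inl rfl) _ _))
  suffices h : ∀ z ∈ exterior ε δ, JoinedIn (exterior ε δ) z ⟨0, 0⟩ by
    have h0 := hmem 0 (Or.inl rfl) 0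
    exact (IsPathConnected.isConnected ⟨⟨0, 0⟩, h0, fun {y} hy => (h y hy).symm⟩).isPreconnected
  intro z hz
  -- move horizontally away from the center of the only disk at this height
  have key : ∀ x : ℝ, (x = 0 ∨ 2 + ε / 2 < |x|) →
      (∀ n : ℤ, ∀ s ∈ Icc (0 : ℝ) 1, |z.im - n * (2 + δ)| ≤ 1 →
        (z.re - (-1 - ε / 2)) ^ 2 ≤ ((1 - s) * z.re + s * x - (-1 - ε / 2)) ^ 2 ∧
        (z.re - (1 + ε / 2)) ^ 2 ≤ ((1 - s) * z.re + s * x - (1 + ε / 2)) ^ 2 ∨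
        1 < ((1 - s) * z.re + s * x - (-1 - ε / 2)) ^ 2 ∧
        (z.re - (1 + ε / 2)) ^ 2 ≤ ((1 - s) * z.re + s * x - (1 + ε / 2)) ^ 2 ∨
        1 < ((1 - s) * z.re + s * x - (1 + ε / 2)) ^ 2 ∧
        (z.re - (-1 - ε / 2)) ^ 2 ≤ ((1 - s) * z.re + s * x - (-1 - ε / 2)) ^ 2) →
      JoinedIn (exterior ε δ) z ⟨0, 0⟩ := by
    intro x hx hs
    refine JoinedIn.trans (hseg ?_) (hline x hx z.im)
    rw [segment_subset_iff]
    intro a b ha hb hab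
    obtain rfl : a = 1 - b := by linarith
    have hre : ((1 - b) • z + b • (⟨x, z.im⟩ : ℂ)).re = (1 - b) * z.re + b * x := by simp
    have him : ((1 - b) • z + b • (⟨x, z.im⟩ : ℂ)).im = z.im := by simp; ring
    rw [mem_exterior_iff hδ] at hz ⊢
    intro n
    rw [hre, him]
    have hzn := hz n
    by_cases hn : |z.im - n * (2 + δ)| ≤ 1
    · have h2 := sq_nonneg (z.im - n * (2 + δ))
      rcases hs n b ⟨hb, by linarith⟩ hn with ⟨h, h'⟩ | ⟨h, h'⟩ | ⟨h, h'⟩ <;>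
        constructor <;> linarith [hzn.1, hzn.2]
    · have h2 : 1 < (z.im - n * (2 + δ)) ^ 2 := by
        rw [← sq_abs]; nlinarith [not_le.1 hn]
      constructor
      · linarith [sq_nonneg ((1 - b) * z.re + b * x - (-1 - ε / 2))]
      · linarith [sq_nonneg ((1 - b) * z.re + b * x - (1 + ε / 2))]
  rcases le_total (|z.re|) (1 + ε / 2) with hx | hx
  · refine key 0 (Or.inl rfl) fun n s hs _ => ?_
    rw [abs_le] at hx
    rcases le_total 0 z.re with h0 | h0
    · right; left
      have : 0 ≤ (1 - s) * z.re := mul_nonneg (by linarith [hs.2]) h0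
      have h3 : 0 ≤ s * z.re := mul_nonneg hs.1 h0
      constructor <;> nlinarith
    · right; right
      have : (1 - s) * z.re ≤ 0 := mul_nonpos_of_nonneg_of_nonpos (by linarith [hs.2]) h0
      have h3 : s * z.re ≤ 0 := mul_nonpos_of_nonneg_of_nonpos hs.1 h0
      constructor <;> nlinarith
  · rcases le_abs.1 hx with h0 | h0
    · refine key (z.re + 2 + ε) (Or.inr ?_) fun n s hs _ => ?_
      · rw [abs_of_pos (by linarith)]; linarith
      · left
        have : 0 ≤ s * (2 + ε) := mul_nonneg hs.1 (by linarith)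
        constructor <;> nlinarith
    · refine key (z.re - 2 - ε) (Or.inr ?_) fun n s hs _ => ?_
      · rw [abs_of_neg (by linarith)]; linarith
      · left
        have : 0 ≤ s * (2 + ε) := mul_nonneg hs.1 (by linarith)
        constructor <;> nlinarith

theorem exterior_of_abs_re {ε δ : ℝ} (hε : 0 < ε) (hδ : 0 < δ) {z : ℂ} (hz : 2 + ε / 2 < |z.re|) :
    z ∈ exterior ε δ := by
  rw [mem_exterior_iff hδ]
  intro n
  rcases lt_abs.1 hz with h | h
  · constructor <;> nlinarith [sq_nonneg (z.im - n * (2 + δ))]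
  · constructor <;> nlinarith [sq_nonneg (z.im - n * (2 + δ))]

/-! ### Gradient bounds up to the boundary -/

/-- Parallelogram identity: 4|ζ - (c + z₀)/2|² = 2|ζ - c|² + 2|ζ - z₀|² - |c - z₀|². Geometrically,
the disk of radius 1/2 around the midpoint touches the unit disk from inside at z₀ only, which makes
log(2|ζ - (c + z₀)/2|) a barrier at z₀. -/
theorem normSq_sub_midpoint_ge {c z₀ ζ : ℂ} {r : ℝ} (hz₀ : dist z₀ c = 1) (hζ : 1 ≤ dist ζ c)
    (hr : 0 ≤ r) (h : r ≤ dist ζ z₀) : 1 + 2 * r ^ 2 ≤ (2 * ‖ζ - (c + z₀) / 2‖) ^ 2 := by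
  have h1 : dist z₀ c ^ 2 = (z₀.re - c.re) ^ 2 + (z₀.im - c.im) ^ 2 := by
    rw [dist_eq_re_im, Real.sq_sqrt (by positivity)]
  have h2 : dist ζ z₀ ^ 2 = (ζ.re - z₀.re) ^ 2 + (ζ.im - z₀.im) ^ 2 := by
    rw [dist_eq_re_im, Real.sq_sqrt (by positivity)]
  have h3 := one_le_dist_iff.1 hζ
  have h4 : ‖ζ - (c + z₀) / 2‖ ^ 2 =
      (ζ.re - (c.re + z₀.re) / 2) ^ 2 + (ζ.im - (c.im + z₀.im) / 2) ^ 2 := by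
    rw [← dist_eq, dist_eq_re_im, Real.sq_sqrt (by positivity)]
    simp
  have h5 : r ^ 2 ≤ dist ζ z₀ ^ 2 := by gcongr
  rw [hz₀] at h1
  rw [mul_pow, h4]
  nlinarith

/-- The data of a function harmonic outside the disks in a ball around `z`, vanishing on the
circles and bounded by `M`. -/
structure VanishesNear (ε δ : ℝ) (w : ℂ → ℝ) (z : ℂ) (ρ M : ℝ) : Prop where
  cont : ContinuousOn w (closedExterior ε δ ∩ closedBall z ρ)
  harmonic : HarmonicOnNhd w (exterior ε δ ∩ ball z ρ)
  bound : ∀ y ∈ closedExterior ε δ ∩ closedBall z ρ, |w y| ≤ M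
  zero : ∀ y ∈ closedExterior ε δ ∩ closedBall z ρ, y ∉ exterior ε δ → w y = 0

theorem harmonicAt_log_norm_sub {c z : ℂ} (hz : z ≠ c) (A : ℂ) (hA : A ≠ 0) :
    HarmonicAt (fun y => Real.log ‖A * (y - c)‖) z :=
  AnalyticAt.harmonicAt_log_norm (by fun_prop) (mul_ne_zero hA (sub_ne_zero.2 hz))

theorem VanishesNear.neg {ε δ : ℝ} {w : ℂ → ℝ} {z : ℂ} {ρ M : ℝ} (h : VanishesNear ε δ w z ρ M) :
    VanishesNear ε δ (-w) z ρ M where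
  cont := h.cont.neg
  harmonic := h.harmonic.neg
  bound y hy := by simpa using h.bound y hy
  zero y hy hy' := by simp [h.zero y hy hy']

/-- The logarithm is a barrier: it is nonnegative outside the disk around c, zero at z₀, and at
least L/2 at distance r from z₀. The circles of other disks do no harm, because w vanishes there
while the barrier is nonnegative; hence the constant does not see the widths of the gaps. -/
theorem VanishesNear.le_log {ε δ : ℝ} (hδ : 0 < δ) {w : ℂ → ℝ} {z₀ c : ℂ} {r M : ℝ}
    (hr : 0 < r) (h : VanishesNear ε δ w z₀ r M) (hM : 0 ≤ M) (hc : c ∈ centers ε δ)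
    (hz₀ : dist z₀ c = 1) {y : ℂ} (hy : y ∈ closedExterior ε δ ∩ closedBall z₀ r) :
    w y ≤ 2 * M / Real.log (1 + 2 * r ^ 2) * Real.log (2 * ‖y - (c + z₀) / 2‖) := by
  set L := Real.log (1 + 2 * r ^ 2) with hL
  have hLpos : 0 < L := Real.log_pos (by nlinarith [pow_pos hr 2])
  set φ : ℂ → ℝ := fun y => Real.log ‖(2 : ℂ) * (y - (c + z₀) / 2)‖ with hφ
  have hφeq : ∀ y, φ y = Real.log (2 * ‖y - (c + z₀) / 2‖) := fun y => by simp [hφ]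
  rw [← hφeq]
  have hsq : ∀ y ∈ closedExterior ε δ, ∀ s, 0 ≤ s → s ≤ dist y z₀ →
      Real.log (1 + 2 * s ^ 2) ≤ 2 * φ y := fun y hy s hs hsy => by
    have := normSq_sub_midpoint_ge hz₀ (hy c hc) hs hsy
    rw [hφeq]
    calc _ ≤ Real.log ((2 * ‖y - (c + z₀) / 2‖) ^ 2) := Real.log_le_log (by positivity) this
      _ = _ := by rw [Real.log_pow]; norm_num
  have hne : ∀ y ∈ closedExterior ε δ, y ≠ (c + z₀) / 2 := fun y hy he => by
    have := normSq_sub_midpoint_ge hz₀ (hy c hc) le_rfl dist_nonneg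
    rw [he] at this
    norm_num at this
  have hφ0 : ∀ y ∈ closedExterior ε δ, 0 ≤ φ y := fun y hy => by
    have := hsq y hy 0 le_rfl dist_nonneg
    simp at this
    linarith
  have hφh : ∀ y ∈ closedExterior ε δ, HarmonicAt φ y := fun y hy =>
    harmonicAt_log_norm_sub (hne y hy) 2 two_ne_zero
  have key := le_of_harmonicOnNhd (P := closedExterior ε δ ∩ closedBall z₀ r)
    (U := exterior ε δ ∩ ball z₀ r) (C₀ := closedExterior ε δ ∩ closedBall z₀ r)
    (w := w - (2 * M / L) • φ) (m := 0) ((isOpen_exterior ε δ).inter isOpen_ball)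
    (inter_subset_inter (exterior_subset hδ) ball_subset_closedBall)
    ((isCompact_closedBall z₀ r).inter_left (isClosed_closedExterior ε δ)) subset_rfl
    (h.cont.sub (ContinuousOn.const_smul (fun y hy =>
      (hφh y hy.1).1.continuousAt.continuousWithinAt) _))
    (h.harmonic.sub (HarmonicOnNhd.const_smul fun y hy => hφh y (exterior_subset hδ hy.1)))
    (fun y hy => ⟨y, hy, rfl, rfl⟩) ?_ y hy
  · simpa using key
  · intro y hy hyU
    simp only [Pi.sub_apply, Pi.smul_apply, smul_eq_mul, sub_nonpos]
    have h0 := hφ0 y hy.1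
    by_cases hyE : y ∈ exterior ε δ
    · have hd : r ≤ dist y z₀ := not_lt.1 fun hlt => hyU ⟨hyE, hlt⟩
      have h1 := hsq y hy.1 r hr.le hd
      calc w y ≤ M := (le_abs_self _).trans (h.bound y hy)
        _ = M / L * L := by field_simp
        _ ≤ M / L * (2 * φ y) := by gcongr
        _ = _ := by ring
    · rw [h.zero y hy hyE]
      positivity

theorem VanishesNear.mono {ε δ : ℝ} {w : ℂ → ℝ} {z z' : ℂ} {ρ ρ' M : ℝ}
    (h : VanishesNear ε δ w z ρ M) (hz : dist z' z + ρ' ≤ ρ) : VanishesNear ε δ w z' ρ' M := by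
  have h1 : closedBall z' ρ' ⊆ closedBall z ρ := closedBall_subset_closedBall' (by linarith)
  have h2 : ball z' ρ' ⊆ ball z ρ := ball_subset_ball' (by linarith)
  exact ⟨h.cont.mono (inter_subset_inter_right _ h1), h.harmonic.mono (inter_subset_inter_right _ h2),
    fun y hy => h.bound y ⟨hy.1, h1 hy.2⟩, fun y hy => h.zero y ⟨hy.1, h1 hy.2⟩⟩

/-- The barrier is placed at the radial projection z₀ of y onto the circle. On the ray through z₀ it
equals log(1 + 2(t - 1)), where t is the distance of y from c, so it grows at most linearly. -/
theorem VanishesNear.abs_le_mul_dist {ε δ : ℝ} (hδ : 0 < δ) {w : ℂ → ℝ} {z c y : ℂ} {ρ M : ℝ}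
    (hρ : 0 < ρ) (h : VanishesNear ε δ w z ρ M) (hM : 0 ≤ M) (hc : c ∈ centers ε δ)
    (hy : y ∈ closedExterior ε δ) (hyz : dist y z ≤ ρ / 2) (hyc : dist y c ≤ 1 + ρ / 4) :
    |w y| ≤ 4 * M / Real.log (1 + 2 * (ρ / 4) ^ 2) * (dist y c - 1) := by
  have hyc1 := hy c hc
  have hpos : 0 < dist y c := by linarith
  set t := dist y c with ht
  set z₀ : ℂ := c + (t⁻¹ : ℝ) * (y - c) with hz₀
  have hyc2 : y - c = (t : ℂ) * (z₀ - c) := by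
    rw [hz₀, add_sub_cancel_left, ← mul_assoc, ← ofReal_mul, mul_inv_cancel₀ hpos.ne']; simp
  have h0 : dist z₀ c = 1 := by
    rw [dist_eq, hz₀, add_sub_cancel_left, norm_mul, norm_real, ← dist_eq, ← ht,
      Real.norm_of_nonneg (by positivity), inv_mul_cancel₀ hpos.ne']
  have hyz₀ : dist y z₀ = t - 1 := by
    rw [dist_eq, show y - z₀ = ((t - 1 : ℝ) : ℂ) * (z₀ - c) by
      push_cast; linear_combination hyc2, norm_mul, ← dist_eq, h0,
      norm_real, Real.norm_of_nonneg (by linarith), mul_one]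
  have hmid : ‖y - (c + z₀) / 2‖ = t - 1 / 2 := by
    rw [show y - (c + z₀) / 2 = ((t - 1 / 2 : ℝ) : ℂ) * (z₀ - c) by
      push_cast; linear_combination hyc2, norm_mul, ← dist_eq, h0, norm_real,
      Real.norm_of_nonneg (by linarith), mul_one]
  have hV : VanishesNear ε δ w z₀ (ρ / 4) M := h.mono (by
    have := dist_triangle z₀ y z
    rw [dist_comm z₀ y] at this
    linarith)
  have hymem : y ∈ closedExterior ε δ ∩ closedBall z₀ (ρ / 4) :=
    ⟨hy, by rw [mem_closedBall]; linarith⟩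
  have hlog : Real.log (2 * ‖y - (c + z₀) / 2‖) ≤ 2 * (t - 1) := by
    rw [hmid]
    exact (Real.log_le_sub_one_of_pos (by linarith)).trans (by linarith)
  have hLpos : 0 < Real.log (1 + 2 * (ρ / 4) ^ 2) := Real.log_pos (by nlinarith [pow_pos hρ 2])
  have hfin : 2 * M / Real.log (1 + 2 * (ρ / 4) ^ 2) * Real.log (2 * ‖y - (c + z₀) / 2‖) ≤
      4 * M / Real.log (1 + 2 * (ρ / 4) ^ 2) * (t - 1) := by
    calc _ ≤ 2 * M / Real.log (1 + 2 * (ρ / 4) ^ 2) * (2 * (t - 1)) := by gcongr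
      _ = _ := by ring
  rw [abs_le']
  exact ⟨(hV.le_log hδ (by positivity) hM hc h0 hymem).trans hfin,
    (hV.neg.le_log hδ (by positivity) hM hc h0 hymem).trans hfin⟩

/-- The constant in the gradient bound `VanishesNear.norm_gradient_le`. -/
def gradConst (ρ : ℝ) : ℝ := 16 * (8 / ρ + 16 / Real.log (1 + 2 * (ρ / 4) ^ 2))

theorem gradConst_pos {ρ : ℝ} (hρ : 0 < ρ) : 0 < gradConst ρ := by
  have hLpos : 0 < Real.log (1 + 2 * (ρ / 4) ^ 2) := Real.log_pos (by nlinarith [pow_pos hρ 2])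
  unfold gradConst
  positivity

/-- Far from the disks this is the interior estimate. At distance d < ρ/8 from the nearest disk, the
linear barrier gives |w| = O(d) on the ball of radius d, and the factor 1/d of the interior estimate
cancels. -/
theorem VanishesNear.norm_gradient_le {ε δ : ℝ} (hδ : 0 < δ) {w : ℂ → ℝ} {z : ℂ} {ρ M : ℝ}
    (hρ : 0 < ρ) (h : VanishesNear ε δ w z ρ M) (hz : z ∈ exterior ε δ) :
    ‖gradient w z‖ ≤ gradConst ρ * M := by
  have hM : 0 ≤ M :=
    (abs_nonneg _).trans (h.bound z ⟨exterior_subset hδ hz, mem_closedBall_self hρ.le⟩)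
  have hLpos : 0 < Real.log (1 + 2 * (ρ / 4) ^ 2) := Real.log_pos (by nlinarith [pow_pos hρ 2])
  set L := Real.log (1 + 2 * (ρ / 4) ^ 2) with hL
  by_cases hfar : ball z (ρ / 8) ⊆ exterior ε δ
  · have h1 := norm_gradient_le_of_abs_le (u := w) (z := z) (d := ρ / 8) (M := M) (by positivity)
      (h.harmonic.mono fun y hy => ⟨hfar hy, ball_subset_ball (by linarith) hy⟩)
      (fun y hy => h.bound y ⟨exterior_subset hδ (hfar hy),
        (ball_subset_ball (by linarith)).trans ball_subset_closedBall hy⟩)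
    refine h1.trans ?_
    rw [gradConst, ← hL]
    have : 16 * M / (ρ / 8) = 16 * (8 / ρ + 0) * M := by field_simp; ring
    rw [this]
    gcongr
    positivity
  · obtain ⟨y₀, hy₀, hy₀E⟩ := not_subset.1 hfar
    obtain ⟨x, hx, hdx⟩ := (isOpen_exterior ε δ).isClosed_compl.exists_infDist_eq_dist
      ⟨y₀, hy₀E⟩ z
    set d := infDist z (exterior ε δ)ᶜ with hd
    have hdρ : d < ρ / 8 := (infDist_le_dist_of_mem hy₀E).trans_lt (by rwa [dist_comm])
    have hdpos : 0 < d :=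
      ((isOpen_exterior ε δ).isClosed_compl.notMem_iff_infDist_pos ⟨y₀, hy₀E⟩).1 (by simpa using hz)
    rw [mem_compl_iff, mem_exterior hδ] at hx
    push Not at hx
    obtain ⟨c, hc, hxc⟩ := hx
    have hball : ball z d ⊆ exterior ε δ := fun y hy => by
      by_contra hyE
      have := infDist_le_dist_of_mem (x := z) (s := (exterior ε δ)ᶜ) hyE
      rw [mem_ball, dist_comm] at hy
      linarith
    have hb : ∀ y ∈ ball z d, |w y| ≤ 4 * M / L * (2 * d) := fun y hy => by
      rw [mem_ball] at hy
      have hyc : dist y c ≤ 1 + 2 * d := by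
        have h1 := dist_triangle y z c
        have h2 := dist_triangle z x c
        linarith
      refine (h.abs_le_mul_dist hδ hρ hM hc (exterior_subset hδ (hball hy)) (by linarith)
        (by linarith)).trans ?_
      gcongr
      linarith
    have h1 := norm_gradient_le_of_abs_le hdpos
      (h.harmonic.mono fun y hy => ⟨hball hy, ball_subset_ball (by linarith) hy⟩) hb
    refine h1.trans ?_
    rw [gradConst, ← hL]
    have : 16 * (4 * M / L * (2 * d)) / d = 16 * (0 + 8 / L) * M := by field_simp; ring
    rw [this]
    gcongr
    · positivity
    · norm_num

/-! ### Decay of square integrable periodic holomorphic functions -/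

/-- Mean value property of the holomorphic function g²; the averaging factor 1/(2π) is estimated by
1. -/
theorem enorm_sq_le_lintegral_circle {g : ℂ → ℂ} {z : ℂ} (hg : DifferentiableOn ℂ g (ball z 1))
    {r : ℝ} (hr : r ∈ Ioo (0 : ℝ) 1) :
    ‖g z‖ₑ ^ 2 ≤ ∫⁻ θ in Ioo (-Real.pi) Real.pi, ‖g (z + Complex.polarCoord.symm (r, θ))‖ₑ ^ 2 := by
  have hsub : closedBall z |r| ⊆ ball z 1 :=
    closedBall_subset_ball (by rw [abs_of_pos hr.1]; exact hr.2)
  have hd : DiffContOnCl ℂ (fun w => g w ^ 2) (ball z |r|) := by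
    refine DifferentiableOn.diffContOnCl ((hg.pow 2).mono ?_)
    rwa [closure_ball _ (abs_pos.2 hr.1.ne').ne']
  have h1 := DiffContOnCl.circleAverage hd
  rw [Real.circleAverage_eq_integral_add (-Real.pi), intervalIntegral.integral_comp_add_right
    (fun θ => g (circleMap z r θ) ^ 2) (-Real.pi)] at h1
  rw [zero_add, show 2 * Real.pi + -Real.pi = Real.pi by ring,
    intervalIntegral.integral_of_le (by linarith [Real.pi_pos]), integral_Ioc_eq_integral_Ioo] at h1
  rw [← enorm_pow, ← h1]
  have h2 : ‖(2 * Real.pi)⁻¹‖ₑ ≤ 1 := by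
    rw [Real.enorm_of_nonneg (by positivity), ENNReal.ofReal_le_one]
    exact inv_le_one_of_one_le₀ (by linarith [Real.pi_gt_three])
  calc ‖(2 * Real.pi)⁻¹ • ∫ θ in Ioo (-Real.pi) Real.pi, g (circleMap z r θ) ^ 2‖ₑ
      ≤ 1 * ∫⁻ θ in Ioo (-Real.pi) Real.pi, ‖g (circleMap z r θ) ^ 2‖ₑ := by
        rw [enorm_smul]
        gcongr
        exact enorm_integral_le_lintegral_enorm _
    _ = _ := by
        rw [one_mul]
        refine lintegral_congr fun θ => ?_
        rw [enorm_pow, circleMap, Complex.polarCoord_symm_apply, exp_mul_I, ofReal_cos, ofReal_sin]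

/-- The circle estimate is integrated in polar coordinates over radii between 1/2 and 1, where the
weight r is at least 1/2; the factors 1/2 · 1/2 give the 4. -/
theorem enorm_sq_le_lintegral_ball {g : ℂ → ℂ} {z : ℂ} (hg : DifferentiableOn ℂ g (ball z 1)) :
    ‖g z‖ₑ ^ 2 ≤ 4 * ∫⁻ w in ball z 1, ‖g w‖ₑ ^ 2 := by
  set G : ℂ → ℝ≥0∞ := (ball z 1).indicator fun w => ‖g w‖ₑ ^ 2 with hG
  have hGm : Measurable G := by
    classical
    rw [hG, ← piecewise_eq_indicator]
    exact ContinuousOn.measurable_piecewise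
      ((ENNReal.continuous_pow 2).comp_continuousOn hg.continuousOn.enorm) continuousOn_const
      measurableSet_ball
  have h1 : ∫⁻ w in ball z 1, ‖g w‖ₑ ^ 2 = ∫⁻ w, G (z + w) := by
    rw [← lintegral_indicator measurableSet_ball, lintegral_add_left_eq_self G]
  have hmeas : Measurable fun p : ℝ × ℝ =>
      ENNReal.ofReal p.1 • G (z + Complex.polarCoord.symm p) := by
    simp only [Complex.polarCoord_symm_apply]
    fun_prop
  rw [h1, ← Complex.lintegral_comp_polarCoord_symm, polarCoord_target,
    Measure.volume_eq_prod, ← Measure.prod_restrict, lintegral_prod _ hmeas.aemeasurable]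
  have h2 : ∀ r ∈ Ioo (1 / 2 : ℝ) 1, ENNReal.ofReal (1 / 2) * ‖g z‖ₑ ^ 2 ≤
      ∫⁻ θ in Ioo (-Real.pi) Real.pi, ENNReal.ofReal r • G (z + Complex.polarCoord.symm (r, θ)) := by
    intro r hr
    have hr0 : 0 < r := by linarith [hr.1]
    have hin : ∀ θ, G (z + Complex.polarCoord.symm (r, θ)) =
        ‖g (z + Complex.polarCoord.symm (r, θ))‖ₑ ^ 2 := fun θ => by
      rw [hG, indicator_of_mem]
      rw [mem_ball, dist_eq, add_sub_cancel_left, norm_polarCoord_symm, abs_of_pos hr0]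
      exact hr.2
    simp only [hin, smul_eq_mul]
    rw [lintegral_const_mul' _ _ ENNReal.ofReal_ne_top]
    gcongr
    · exact hr.1.le
    · exact enorm_sq_le_lintegral_circle hg ⟨hr0, hr.2⟩
  have h3 : ∫⁻ _ in Ioo (1 / 2 : ℝ) 1, ENNReal.ofReal (1 / 2) * ‖g z‖ₑ ^ 2 ≤
      ∫⁻ r in Ioi (0 : ℝ), ∫⁻ θ in Ioo (-Real.pi) Real.pi,
        ENNReal.ofReal r • G (z + Complex.polarCoord.symm (r, θ)) :=
    (setLIntegral_mono' measurableSet_Ioo h2).trans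
      (lintegral_mono_set fun r hr => lt_trans (by norm_num) hr.1)
  rw [setLIntegral_const, Real.volume_Ioo] at h3
  calc ‖g z‖ₑ ^ 2 = 4 * (ENNReal.ofReal (1 / 2) * ‖g z‖ₑ ^ 2 * ENNReal.ofReal (1 - 1 / 2)) := by
        rw [mul_comm (ENNReal.ofReal _), mul_assoc, ← ENNReal.ofReal_mul (by norm_num), mul_left_comm,
          show (4 : ℝ≥0∞) = ENNReal.ofReal 4 by norm_num, ← ENNReal.ofReal_mul (by norm_num)]
        norm_num
    _ ≤ _ := by gcongr

theorem volume_im_eq (c : ℝ) : volume {z : ℂ | z.im = c} = 0 := by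
  rw [← frontier_setOfPred_im_lt]
  exact (convex_halfSpace_im_lt c).addHaar_frontier _

/-- A holomorphic function, periodic in the vertical direction and square integrable over one
period, tends to zero at infinity. -/
theorem exists_norm_le_of_periodic {δ R : ℝ} (hδ : 0 < δ) {g : ℂ → ℂ}
    (hg : ∀ z : ℂ, R < |z.re| → DifferentiableAt ℂ g z)
    (hper : ∀ z : ℂ, R < |z.re| → ∀ n : ℤ, g (z + n * (2 + δ : ℝ) * I) = g z)
    (hint : ∫⁻ z in strip δ ∩ {z | R < |z.re|}, ‖g z‖ₑ ^ 2 ≠ ⊤) {η : ℝ} (hη : 0 < η) :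
    ∃ X > R, ∀ z : ℂ, X < |z.re| → ‖g z‖ ≤ η := by
  set A : ℕ → Set ℂ := fun n => strip δ ∩ {z | R + n < |z.re|} with hA
  have hstrip : IsOpen (strip δ) :=
    (isOpen_lt continuous_const continuous_im).inter (isOpen_lt continuous_im continuous_const)
  have hAm : ∀ n, MeasurableSet (A n) := fun n =>
    (hstrip.inter (isOpen_lt continuous_const (by fun_prop))).measurableSet
  -- The energy as a measure: it is finite on the first of the decreasing sets A n, so continuity
  -- from above makes the energy of the tails tend to zero.
  set ν := (volume : Measure ℂ).withDensity fun z => ‖g z‖ₑ ^ 2 with hν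
  have hνA : ∀ n, ν (A n) = ∫⁻ z in A n, ‖g z‖ₑ ^ 2 := fun n => withDensity_apply _ (hAm n)
  have hlim : Tendsto (ν ∘ A) atTop (𝓝 0) := by
    have h := tendsto_measure_iInter_atTop (μ := ν) (s := A) (fun n => (hAm n).nullMeasurableSet)
      (fun m n hmn z hz => ⟨hz.1, by
        have h1 : (m : ℝ) ≤ n := by exact_mod_cast hmn
        exact lt_of_le_of_lt (add_le_add_right h1 R) hz.2⟩) ⟨0, by
        rw [hνA]; simpa [hA] using hint⟩
    have hempty : ⋂ n, A n = ∅ := by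
      rw [eq_empty_iff_forall_notMem]
      intro z hz
      obtain ⟨n, hn⟩ := exists_nat_gt (|z.re| - R)
      have := (mem_iInter.1 hz n).2
      simp only [mem_ofPred_eq] at this
      linarith
    simpa [hempty] using h
  -- 12 = 4 · 3: the constant of the mean value estimate times the three periods that cover a unit
  -- ball.
  have hpos : (0 : ℝ≥0∞) < ENNReal.ofReal (η ^ 2) / 12 := by
    refine ENNReal.div_pos (by simpa using hη.ne') (by norm_num)
  obtain ⟨n, hn⟩ := (hlim.eventually (gt_mem_nhds hpos)).exists
  refine ⟨R + n + 1, by linarith [(n : ℕ).cast_nonneg (α := ℝ)], fun z hz => ?_⟩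
  set B : Set ℂ := {w | |w.im| ≤ 1 + δ / 2 ∧ R + n < |w.re|} with hB
  have hR : ∀ w : ℂ, R + n < |w.re| → R < |w.re| := fun w hw => by
    linarith [(n : ℕ).cast_nonneg (α := ℝ)]
  have hBA : ∫⁻ w in B, ‖g w‖ₑ ^ 2 ≤ ν (A n) := by
    rw [hνA]
    have hnull : ∀ c : ℝ, ∀ᵐ w : ℂ, w.im ≠ c := fun c => by
      rw [ae_iff]; simpa using volume_im_eq c
    refine le_of_eq (setLIntegral_congr ?_)
    filter_upwards [hnull (1 + δ / 2), hnull (-1 - δ / 2)] with w h1 h2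
    refine propext ⟨fun h => ?_, fun h => ?_⟩
    · have h3 := abs_le.1 h.1
      exact ⟨⟨lt_of_le_of_ne (by linarith) (Ne.symm h2), lt_of_le_of_ne h3.2 h1⟩, h.2⟩
    · exact ⟨abs_le.2 ⟨by linarith [h.1.1], h.1.2.le⟩, h.2⟩
  have htrans : ∀ k : ℤ, ∫⁻ w in (fun w => w + k * (2 + δ : ℝ) * I) ⁻¹' B, ‖g w‖ₑ ^ 2 ≤
      ν (A n) := fun k => by
    refine le_trans (le_of_eq ?_) hBA
    have hmp := (measurePreserving_add_right (volume : Measure ℂ)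
      ((k : ℂ) * (2 + δ : ℝ) * I)).setLIntegral_comp_preimage_emb (measurableEmbedding_addRight _)
      (fun w => ‖g w‖ₑ ^ 2) B
    rw [← hmp]
    refine setLIntegral_congr_fun ?_ fun w hw => ?_
    · refine MeasurableSet.preimage ?_ (by fun_prop)
      exact (isClosed_le continuous_im.abs continuous_const).measurableSet.inter
        (isOpen_lt continuous_const continuous_re.abs).measurableSet
    · have hw2 := hw.2
      simp only [add_re, mul_re, intCast_re, intCast_im, ofReal_re, ofReal_im, I_re, I_im, mul_zero,
        zero_mul, sub_zero, mul_im, add_zero, mul_one] at hw2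
      rw [hper w (hR w hw2) k]
  obtain ⟨m, hm⟩ := exists_period_abs_im_le hδ z
  set z' := z + m * (2 + δ : ℝ) * I with hz'
  have hre : z'.re = z.re := by simp [hz']
  have hzR : R < |z.re| := hR z (by linarith)
  rw [← hper z hzR m, ← hz']
  have hballre : ∀ w ∈ ball z' 1, R + n < |w.re| ∧ |w.im - z'.im| < 1 := fun w hw => by
    rw [mem_ball_iff_norm] at hw
    have h1 := (abs_re_le_norm (w - z')).trans_lt hw
    have h2 := (abs_im_le_norm (w - z')).trans_lt hw
    rw [sub_re, hre] at h1
    rw [sub_im] at h2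
    have h3 := abs_sub_abs_le_abs_sub z.re w.re
    rw [abs_sub_comm] at h3
    exact ⟨by linarith, h2⟩
  have hdiff : DifferentiableOn ℂ g (ball z' 1) := fun w hw =>
    (hg w (hR w (hballre w hw).1)).differentiableWithinAt
  have hcover : ball z' 1 ⊆ ((fun w => w + (0 : ℤ) * (2 + δ : ℝ) * I) ⁻¹' B ∪
      (fun w => w + (1 : ℤ) * (2 + δ : ℝ) * I) ⁻¹' B) ∪
      (fun w => w + (-1 : ℤ) * (2 + δ : ℝ) * I) ⁻¹' B := fun w hw => by
    obtain ⟨h1, h2⟩ := hballre w hw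
    rw [abs_le] at hm
    rw [abs_lt] at h2
    rcases le_or_gt (|w.im|) (1 + δ / 2) with h | h
    · left; left
      simpa [hB] using ⟨h, h1⟩
    · rcases lt_abs.1 h with h | h
      · right
        simp only [hB, mem_preimage, mem_ofPred_eq, abs_le]
        simp
        exact ⟨⟨by linarith, by linarith⟩, h1⟩
      · left; right
        simp only [hB, mem_preimage, mem_ofPred_eq, abs_le]
        simp
        exact ⟨⟨by linarith, by linarith⟩, h1⟩
  have hfin : ‖g z'‖ₑ ^ 2 ≤ ENNReal.ofReal (η ^ 2) := by
    calc ‖g z'‖ₑ ^ 2 ≤ 4 * ∫⁻ w in ball z' 1, ‖g w‖ₑ ^ 2 := enorm_sq_le_lintegral_ball hdiff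
      _ ≤ 4 * (ν (A n) + ν (A n) + ν (A n)) := by
          gcongr
          refine (lintegral_mono_set hcover).trans ((lintegral_union_le _ _ _).trans ?_)
          exact add_le_add ((lintegral_union_le _ _ _).trans (add_le_add (htrans 0) (htrans 1)))
            (htrans (-1))
      _ = 12 * ν (A n) := by ring
      _ ≤ 12 * (ENNReal.ofReal (η ^ 2) / 12) := by
          gcongr
          exact hn.le
      _ = ENNReal.ofReal (η ^ 2) := ENNReal.mul_div_cancel (by norm_num) (by norm_num)
  rw [← ofReal_norm, ← ENNReal.ofReal_pow (norm_nonneg _),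
    ENNReal.ofReal_le_ofReal_iff (by positivity)] at hfin
  exact (sq_le_sq₀ (norm_nonneg _) hη.le).1 hfin

/-! ### Flux through vertical lines -/

theorem integral_complex_eq {h : ℂ → ℂ} (hc : Continuous h) (hs : HasCompactSupport h) :
    ∫ z, h z = ∫ x : ℝ, ∫ y : ℝ, h (x + y * I) := by
  rw [← (volume_preserving_equiv_real_prod.symm).integral_comp
    measurableEquivRealProd.symm.measurableEmbedding]
  have he : ∀ p : ℝ × ℝ, measurableEquivRealProd.symm p = p.1 + p.2 * I := fun p => by
    rw [← mk_eq_add_mul_I]; rfl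
  simp only [he]
  rw [Measure.volume_eq_prod, integral_prod]
  refine Continuous.integrable_of_hasCompactSupport (by fun_prop) ?_
  have hcomp := hs.comp_homeomorph equivRealProdCLM.symm.toHomeomorph
  rwa [show h ∘ equivRealProdCLM.symm.toHomeomorph = fun p : ℝ × ℝ => h (p.1 + p.2 * I) from
    funext fun p => congrArg h (he p)] at hcomp

/-- A smooth function vanishing on `(-∞, 1 + κ]` and equal to `1` on `[1 + 2κ, ∞)`. -/
def cutoff (κ s : ℝ) : ℝ := Real.smoothTransition ((s - 1 - κ) / κ)

theorem contDiff_cutoff (κ : ℝ) : ContDiff ℝ 1 (cutoff κ) :=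
  Real.smoothTransition.contDiff.comp (by fun_prop)

theorem cutoff_eq_zero {κ s : ℝ} (hκ : 0 < κ) (hs : s ≤ 1 + κ) : cutoff κ s = 0 :=
  Real.smoothTransition.zero_of_nonpos (div_nonpos_of_nonpos_of_nonneg (by linarith) hκ.le)

theorem cutoff_eq_one {κ s : ℝ} (hκ : 0 < κ) (hs : 1 + 2 * κ ≤ s) : cutoff κ s = 1 :=
  Real.smoothTransition.one_of_one_le (by rw [le_div_iff₀ hκ]; linarith)

theorem deriv_cutoff_eq_zero {κ s : ℝ} (hκ : 0 < κ) (hs : s < 1 + κ ∨ 1 + 2 * κ < s) :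
    deriv (cutoff κ) s = 0 := by
  rcases hs with hs | hs
  · have : cutoff κ =ᶠ[𝓝 s] fun _ => 0 := by
      filter_upwards [gt_mem_nhds hs] with t ht using cutoff_eq_zero hκ ht.le
    rw [this.deriv_eq, deriv_const]
  · have : cutoff κ =ᶠ[𝓝 s] fun _ => 1 := by
      filter_upwards [lt_mem_nhds hs] with t ht using cutoff_eq_one hκ ht.le
    rw [this.deriv_eq, deriv_const]

/-- If the flux of `f` through all circles around `c` of radius slightly larger than `1` is zero,
then so is the integral of the `∂̄`-derivative of the truncation of `f`. -/
theorem im_integral_cutoff_eq_zero {κ : ℝ} (hκ : 0 < κ) {c : ℂ} {f h : ℂ → ℂ} (hc : Continuous h)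
    (hh : ∀ z, h z = 2 * I * ((deriv (cutoff κ) (‖z - c‖ ^ 2) : ℝ) : ℂ) * (f z * (z - c)))
    (hflux : ∀ r ∈ Ioo 1 (1 + κ), (∫ θ in Ioo (-Real.pi) Real.pi,
      f (c + Complex.polarCoord.symm (r, θ)) * Complex.polarCoord.symm (r, θ)).re = 0) :
    (∫ z, h z).im = 0 := by
  rw [← integral_add_left_eq_self h c, ← Complex.integral_comp_polarCoord_symm, polarCoord_target,
    Measure.volume_eq_prod, setIntegral_prod]
  · have hinner : ∀ r ∈ Ioi (0 : ℝ), (∫ θ in Ioo (-Real.pi) Real.pi,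
        r • h (c + Complex.polarCoord.symm (r, θ))) = (((∫ θ in Ioo (-Real.pi) Real.pi,
        r • h (c + Complex.polarCoord.symm (r, θ))).re : ℝ) : ℂ) := by
      intro r hr
      have h1 : ∀ θ, r • h (c + Complex.polarCoord.symm (r, θ)) =
          (((2 * r * deriv (cutoff κ) (r ^ 2) : ℝ) : ℂ) * I) *
          (f (c + Complex.polarCoord.symm (r, θ)) * Complex.polarCoord.symm (r, θ)) := fun θ => by
        rw [hh, add_sub_cancel_left, norm_polarCoord_symm, sq_abs, real_smul]
        push_cast
        ring
      simp only [h1]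
      rw [integral_const_mul]
      apply Complex.ext
      · simp
      · rw [mul_assoc, im_ofReal_mul, I_mul_im, ofReal_im]
        -- The cutoff is a function of the squared distance, and varies only for 1 + κ ≤ r² ≤ 1 +
        -- 2κ. Then 1 < r < 1 + κ, the range in which the flux is known to vanish.
        by_cases hr2 : r ^ 2 < 1 + κ ∨ 1 + 2 * κ < r ^ 2
        · rw [deriv_cutoff_eq_zero hκ hr2]; simp
        · push Not at hr2
          rw [hflux r ⟨by nlinarith [mem_Ioi.1 hr], by nlinarith [mem_Ioi.1 hr]⟩, mul_zero]
    rw [setIntegral_congr_fun measurableSet_Ioi hinner, integral_complex_ofReal, ofReal_im]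
  · rw [← Measure.volume_eq_prod]
    have hcont : Continuous fun p : ℝ × ℝ => p.1 • h (c + Complex.polarCoord.symm p) := by
      simp only [Complex.polarCoord_symm_apply]
      fun_prop
    have hint : IntegrableOn (fun p : ℝ × ℝ => p.1 • h (c + Complex.polarCoord.symm p))
        (Icc 0 (1 + κ) ×ˢ Icc (-Real.pi) Real.pi) :=
      hcont.continuousOn.integrableOn_compact (isCompact_Icc.prod isCompact_Icc)
    refine hint.of_forall_sdiff_eq_zero (measurableSet_Ioi.prod measurableSet_Ioo) ?_
    rintro ⟨r, θ⟩ ⟨⟨hr, hθ⟩, hn⟩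
    have hr1 : 1 + κ < r := by
      by_contra! hle
      exact hn ⟨⟨le_of_lt hr, hle⟩, Ioo_subset_Icc_self hθ⟩
    simp only
    rw [hh, add_sub_cancel_left, norm_polarCoord_symm, sq_abs,
      deriv_cutoff_eq_zero hκ (Or.inr (by nlinarith))]
    simp

/-- Green's formula on the rectangle for f times a cutoff that removes the disk. The horizontal
sides cancel by periodicity, and the area term, supported in a thin annulus, contributes nothing to
the difference of the fluxes because the circles carry no flux. -/
theorem re_integral_vertical_eq {κ x₀ x₁ y₀ y₁ : ℝ} (hκ : 0 < κ) {c : ℂ} {f : ℂ → ℂ}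
    (hball : closedBall c (1 + κ) ⊆ Ioo x₀ x₁ ×ℂ Ioo y₀ y₁)
    (hd : ∀ z ∈ Icc x₀ x₁ ×ℂ Icc y₀ y₁, 1 < dist z c → DifferentiableAt ℂ f z)
    (hper : ∀ x : ℝ, x ∈ Icc x₀ x₁ → f (x + y₁ * I) = f (x + y₀ * I))
    (hflux : ∀ r ∈ Ioo 1 (1 + κ), (∫ θ in Ioo (-Real.pi) Real.pi,
      f (c + Complex.polarCoord.symm (r, θ)) * Complex.polarCoord.symm (r, θ)).re = 0) :
    (∫ y in y₀..y₁, f (x₁ + y * I)).re = (∫ y in y₀..y₁, f (x₀ + y * I)).re := by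
  have hcball := hball (mem_closedBall_self (by linarith : 0 ≤ 1 + κ))
  have hx : x₀ < x₁ := hcball.1.1.trans hcball.1.2
  have hy : y₀ < y₁ := hcball.2.1.trans hcball.2.2
  set N : ℂ → ℝ := fun z => ‖z - c‖ ^ 2 with hN
  have hNc : Continuous N := by fun_prop
  set h : ℂ → ℂ := fun z => 2 * I * ((deriv (cutoff κ) (N z) : ℝ) : ℂ) * (f z * (z - c)) with hh
  have hNd : ∀ z, HasFDerivAt N (2 • (innerSL ℝ (z - c))) z := fun z => by
    simpa using ((hasFDerivAt_id z).sub_const c).norm_sq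
  have hmem : ∀ z, N z ≤ 1 + 2 * κ → z ∈ closedBall c (1 + κ) := fun z hz => by
    rw [mem_closedBall, dist_eq]
    refine abs_le_of_sq_le_sq' ?_ (by linarith) |>.2
    nlinarith [hN ▸ hz]
  have hout : ∀ z, 1 < N z → 1 < dist z c := fun z hz => by
    rw [dist_eq]; by_contra! hle
    have : N z ≤ 1 := pow_le_one₀ (norm_nonneg _) hle
    linarith
  have hrect : Ioo x₀ x₁ ×ℂ Ioo y₀ y₁ ⊆ Icc x₀ x₁ ×ℂ Icc y₀ y₁ := fun z hz =>
    ⟨Ioo_subset_Icc_self hz.1, Ioo_subset_Icc_self hz.2⟩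
  have hderivc : Continuous (deriv (cutoff κ)) := (contDiff_cutoff κ).continuous_deriv le_rfl
  have hhc : Continuous h := by
    rw [continuous_iff_continuousAt]
    intro z
    by_cases hz : N z < 1 + κ ∨ 1 + 2 * κ < N z
    · have hev : h =ᶠ[𝓝 z] fun _ => 0 := by
        have hopen : IsOpen {w | N w < 1 + κ ∨ 1 + 2 * κ < N w} :=
          (isOpen_lt hNc continuous_const).union (isOpen_lt continuous_const hNc)
        filter_upwards [hopen.mem_nhds hz] with w hw
        simp [hh, deriv_cutoff_eq_zero hκ hw]
      exact continuousAt_const.congr hev.symm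
    · push Not at hz
      have hfd : ContinuousAt f z :=
        (hd z (hrect (hball (hmem z hz.2))) (hout z (by linarith))).continuousAt
      have h1 : ContinuousAt (fun z => ((deriv (cutoff κ) (N z) : ℝ) : ℂ)) z := by fun_prop
      fun_prop
  have hsupp : ∀ z, h z ≠ 0 → z ∈ closedBall c (1 + κ) := fun z hz => by
    refine hmem z ?_
    by_contra! hlt
    exact hz (by simp [hh, deriv_cutoff_eq_zero hκ (Or.inr hlt)])
  have hcs : HasCompactSupport h := HasCompactSupport.intro (isCompact_closedBall c (1 + κ))
    fun z hz => by_contra fun hne => hz (hsupp z hne)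
  set F : ℂ → ℂ := fun z => cutoff κ (N z) • f z with hF
  set F' : ℂ → ℂ →L[ℝ] ℂ := fun z => cutoff κ (N z) •
    ((ContinuousLinearMap.toSpanSingleton ℂ (deriv f z)).restrictScalars ℝ) +
    (deriv (cutoff κ) (N z) • (2 • (innerSL ℝ (z - c)))).smulRight (f z) with hF'
  have hFd : ∀ z ∈ Icc x₀ x₁ ×ℂ Icc y₀ y₁, HasFDerivAt F (F' z) z := fun z hz => by
    by_cases hz1 : N z < 1 + κ
    · have hev : F =ᶠ[𝓝 z] fun _ => 0 := by
        filter_upwards [(isOpen_lt hNc continuous_const).mem_nhds hz1] with w hw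
        simp [hF, cutoff_eq_zero hκ (le_of_lt hw)]
      have : F' z = 0 := by
        ext v
        simp [hF', cutoff_eq_zero hκ hz1.le, deriv_cutoff_eq_zero hκ (Or.inl hz1)]
      rw [this]
      exact (hasFDerivAt_const (0 : ℂ) z).congr_of_eventuallyEq hev
    · have hfd := (hd z hz (hout z (by linarith))).hasDerivAt.hasFDerivAt.restrictScalars ℝ
      have hcd : HasDerivAt (cutoff κ) (deriv (cutoff κ) (N z)) (N z) :=
        ((contDiff_cutoff κ).differentiable one_ne_zero _).hasDerivAt
      exact (hcd.comp_hasFDerivAt z (hNd z)).smul hfd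
  -- The complex linear part of the derivative cancels in this combination; only the derivative of
  -- the cutoff survives.
  have hI : ∀ z, I • F' z 1 - F' z I = h z := fun z => by
    have h1 : inner ℝ (z - c) 1 = (z - c).re := by simp [Complex.inner]
    have h2 : inner ℝ (z - c) I = (z - c).im := by simp [Complex.inner]; ring
    simp only [hF', hh, add_apply, smul_apply,
      ContinuousLinearMap.smulRight_apply, innerSL_apply_apply, h1, h2, real_smul, smul_eq_mul,
      nsmul_eq_mul, ContinuousLinearMap.coe_restrictScalars',
      ContinuousLinearMap.toSpanSingleton_apply, one_mul]
    conv_rhs => rw [← re_add_im (z - c)]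
    push_cast
    linear_combination (-2 * ((deriv (cutoff κ) (N z) : ℝ) : ℂ) * f z * ((z - c).im : ℂ)) * I_sq
  have huI : (uIcc x₀ x₁ ×ℂ uIcc y₀ y₁ : Set ℂ) = Icc x₀ x₁ ×ℂ Icc y₀ y₁ := by
    rw [uIcc_of_le hx.le, uIcc_of_le hy.le]
  have hgreen := integral_boundary_rect_of_continuousOn_of_hasFDerivAt_real F F' (x₀ + y₀ * I)
    (x₁ + y₁ * I) (by
      simp only [add_re, add_im, mul_re, mul_im, ofReal_re, ofReal_im, I_re, I_im, mul_zero,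
        sub_zero, mul_one, add_zero, zero_add, huI]
      exact fun z hz => (hFd z hz).continuousAt.continuousWithinAt) (by
      simp only [add_re, add_im, mul_re, mul_im, ofReal_re, ofReal_im, I_re, I_im, mul_zero,
        sub_zero, mul_one, add_zero, zero_add, min_eq_left hx.le, max_eq_right hx.le,
        min_eq_left hy.le, max_eq_right hy.le]
      exact fun z hz => hFd z (hrect hz)) (by
      simp only [hI]
      exact hhc.continuousOn.integrableOn_compact (isCompact_uIcc.reProdIm isCompact_uIcc))
  simp only [hI, add_re, add_im, mul_re, mul_im, ofReal_re, ofReal_im, I_re, I_im, mul_zero,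
    sub_zero, mul_one, add_zero, zero_add] at hgreen
  have hFf : ∀ z, z ∉ closedBall c (1 + κ) → F z = f z := fun z hz => by
    have : 1 + 2 * κ ≤ N z := by
      by_contra! hlt
      exact hz (hmem z hlt.le)
    simp [hF, cutoff_eq_one hκ this]
  have hvert : ∀ x : ℝ, x ∉ Ioo x₀ x₁ → ∀ y : ℝ, F (x + y * I) = f (x + y * I) := fun x hx y =>
    hFf _ fun hm => hx (by simpa using (hball hm).1)
  have hhorz : ∀ y : ℝ, y ∉ Ioo y₀ y₁ → ∀ x : ℝ, F (x + y * I) = f (x + y * I) := fun y hy x =>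
    hFf _ fun hm => hy (by simpa using (hball hm).2)
  have hright : (∫ x in x₀..x₁, ∫ y in y₀..y₁, h (x + y * I)) = ∫ z, h z := by
    rw [integral_complex_eq hhc hcs, ← intervalIntegral.integral_eq_integral_of_support_subset]
    · refine intervalIntegral.integral_congr fun x _ => ?_
      refine intervalIntegral.integral_eq_integral_of_support_subset fun y hy => ?_
      exact Ioo_subset_Ioc_self (by simpa using (hball (hsupp _ hy)).2)
    · intro x hx
      by_contra hxn
      refine hx (integral_eq_zero_of_ae (Eventually.of_forall fun y => ?_))
      by_contra hne
      exact hxn (Ioo_subset_Ioc_self (by simpa using (hball (hsupp _ hne)).1))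
  simp only [hvert x₁ (by simp), hvert x₀ (by simp), hhorz y₀ (by simp), hhorz y₁ (by simp),
    hright] at hgreen
  rw [intervalIntegral.integral_congr (g := fun x : ℝ => f (x + y₁ * I))
    (fun x hm => (hper x (by rwa [uIcc_of_le hx.le] at hm)).symm)] at hgreen
  have h0 := im_integral_cutoff_eq_zero hκ hhc (fun _ => rfl) hflux
  rw [← hgreen] at h0
  simp only [sub_self, zero_add, smul_eq_mul, sub_im, I_mul_im] at h0
  linarith

/-! ### What is used of a solution -/

/-- The properties of a solution that the estimates rest on: the gradient condition at the boundary
is replaced by the flux through one period of the line `x = 0`, the energy condition by sublinear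
growth of `u - H`. -/
structure PeriodicSolution (ε δ a b cL cR : ℝ) (u : ℂ → ℝ) : Prop where
  cont : ContinuousOn u (closedExterior ε δ)
  harmonic : HarmonicOnNhd u (exterior ε δ)
  periodic : ∀ z ∈ closedExterior ε δ, u (z + (2 + δ : ℝ) * I) = u z + b * (2 + δ)
  left : ∀ z, dist z (centerL ε δ 0) = 1 → u z = cL
  right : ∀ z, dist z (centerR ε δ 0) = 1 → u z = cR
  growth : ∀ η > 0, ∃ C : ℝ, ∀ z ∈ closedExterior ε δ,
    |u z - linearPotential a b z| ≤ C + η * |z.re|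
  flux : ∫ y in (-(1 + δ / 2))..(1 + δ / 2), fderiv ℝ u (y * I) 1 = a * (2 + δ)

theorem int_periodic {δ : ℝ} {M : Type*} [AddCommGroup M] {A : Set ℂ} {φ : ℂ → M} {β : M}
    (hA : ∀ z ∈ A, ∀ n : ℤ, z + n * (2 + δ : ℝ) * I ∈ A)
    (h : ∀ z ∈ A, φ (z + (2 + δ : ℝ) * I) = φ z + β) {z : ℂ} (hz : z ∈ A) (n : ℤ) :
    φ (z + n * (2 + δ : ℝ) * I) = φ z + n • β := by
  induction n using Int.induction_on with
  | zero => simp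
  | succ k ih =>
    have h1 := h _ (hA z hz k)
    rw [ih, add_assoc, add_assoc] at h1
    rw [show ((k + 1 : ℤ) : ℂ) * (2 + δ : ℝ) * I = (k : ℤ) * (2 + δ : ℝ) * I + (2 + δ : ℝ) * I by
      push_cast; ring, h1, add_smul, one_smul]
  | pred k ih =>
    have h1 := h _ (hA z hz (-k - 1))
    rw [show z + ((-k - 1 : ℤ) : ℂ) * (2 + δ : ℝ) * I + (2 + δ : ℝ) * I =
      z + ((-k : ℤ) : ℂ) * (2 + δ : ℝ) * I by push_cast; ring, ih] at h1
    rw [sub_smul, one_smul, ← add_sub_assoc, h1, add_sub_cancel_right]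

theorem hasFDerivAt_linearPotential (a b : ℝ) (z : ℂ) :
    HasFDerivAt (linearPotential a b) (a • reCLM + b • imCLM) z :=
  (a • reCLM + b • imCLM).hasFDerivAt

theorem harmonicAt_linearPotential (a b : ℝ) (z : ℂ) : HarmonicAt (linearPotential a b) z := by
  have h : AnalyticAt ℂ (fun w : ℂ => (a - b * I) * w) z := by fun_prop
  convert h.harmonicAt_re using 1
  ext w
  simp [linearPotential]

theorem linearPotential_add_period (a b δ : ℝ) (z : ℂ) :
    linearPotential a b (z + (2 + δ : ℝ) * I) = linearPotential a b z + b * (2 + δ) := by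
  simp [linearPotential]; ring

/-- The complex derivative `u_x - i u_y`. -/
def cgrad (u : ℂ → ℝ) (z : ℂ) : ℂ := fderiv ℝ u z 1 - I * fderiv ℝ u z I

theorem cgrad_eq_conj (u : ℂ → ℝ) (z : ℂ) : cgrad u z = conj (gradient u z) := by
  rw [gradient_eq_fderiv, cgrad]; simp [sub_eq_add_neg]

theorem differentiableAt_cgrad {u : ℂ → ℝ} {U : Set ℂ} (h : HarmonicOnNhd u U)
    {z : ℂ} (hz : z ∈ U) : DifferentiableAt ℂ (cgrad u) z :=
  HarmonicAt.differentiableAt_complex_partial (h z hz)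

theorem norm_fderiv_eq_norm_gradient (u : ℂ → ℝ) (z : ℂ) : ‖fderiv ℝ u z‖ = ‖gradient u z‖ := by
  rw [← toDual_gradient, LinearIsometryEquiv.norm_map]

theorem cgrad_sub_linearPotential {u : ℂ → ℝ} {z : ℂ} (hu : DifferentiableAt ℝ u z) (a b : ℝ) :
    cgrad (fun w => u w - linearPotential a b w) z = cgrad u z - (a - b * I) := by
  have h := (hu.hasFDerivAt.sub (hasFDerivAt_linearPotential a b z)).fderiv
  have h' : fderiv ℝ (fun w => u w - linearPotential a b w) z =
    fderiv ℝ u z - (a • reCLM + b • imCLM) := h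
  rw [cgrad, cgrad, h']
  simp
  ring

theorem sub_eq_zero_of_forall_abs_le {x y c : ℝ} (h : ∀ η > 0, |x - y| ≤ η * c) : x = y := by
  by_contra hne
  have hpos : 0 < |x - y| := abs_pos.2 (sub_ne_zero.2 hne)
  have h1 := h (|x - y| / (2 * (|c| + 1))) (by positivity)
  have h2 : |x - y| / (2 * (|c| + 1)) * c ≤ |x - y| / 2 := by
    rw [div_mul_eq_mul_div, div_le_div_iff₀ (by positivity) two_pos]
    nlinarith [le_abs_self c]
  linarith

/-! ### Behaviour of a solution at infinity -/

namespace IsSolution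

variable {ε δ a b : ℝ} {u : ℂ → ℝ}

theorem differentiableAt {H : ℂ → ℝ} (h : IsSolution ε δ H u) {z : ℂ} (hz : z ∈ exterior ε δ) :
    DifferentiableAt ℝ u z := (h.harmonic z hz).1.differentiableAt two_ne_zero

theorem cgrad_periodic {H : ℂ → ℝ} (h : IsSolution ε δ H u) (hδ : 0 < δ) {z : ℂ}
    (hz : z ∈ exterior ε δ) (n : ℤ) : cgrad u (z + n * (2 + δ : ℝ) * I) = cgrad u z := by
  have := int_periodic (φ := cgrad u) (β := 0) (A := exterior ε δ)
    (fun z hz n => (add_period_mem_exterior hδ n).2 hz)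
    (fun z hz => by rw [cgrad_eq_conj, cgrad_eq_conj, ← h.periodic z hz, add_zero]) hz n
  simpa using this

/-- u_x - i u_y - (a - bi) is holomorphic and periodic for |x| > 3, and its square integrability
over a period is the energy condition. -/
theorem decay (h : IsSolution ε δ (linearPotential a b) u) (hε : 0 < ε) (hε1 : ε < 1) (hδ : 0 < δ)
    {η : ℝ} (hη : 0 < η) : ∃ X > 3, ∀ z : ℂ, X < |z.re| → ‖cgrad u z - (a - b * I)‖ ≤ η := by
  have hE : ∀ z : ℂ, 3 < |z.re| → z ∈ exterior ε δ := fun z hz =>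
    exterior_of_abs_re hε hδ (by linarith)
  refine exists_norm_le_of_periodic hδ (g := fun z => cgrad u z - (a - b * I)) (R := 3)
    (fun z hz => (differentiableAt_cgrad h.harmonic (hE z hz)).sub_const _)
    (fun z hz n => by rw [h.cgrad_periodic hδ (hE z hz)]) ?_ hη
  have hfin := h.energy.2
  rw [hasFiniteIntegral_iff_enorm] at hfin
  refine ne_top_of_le_ne_top hfin.ne ?_
  have hsub : strip δ ∩ {z | 3 < |z.re|} ⊆ strip δ \ closure (diskL ε δ 0 ∪ diskR ε δ 0) := by
    rintro z ⟨hz, hre⟩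
    refine ⟨hz, fun hcl => hE z hre (closure_mono ?_ hcl)⟩
    exact subset_iUnion (fun n : ℤ => diskL ε δ n ∪ diskR ε δ n) 0
  refine le_trans (le_of_eq ?_) (lintegral_mono_set hsub)
  refine setLIntegral_congr_fun ?_ fun z hz => ?_
  · exact ((isOpen_lt continuous_const continuous_im).inter
      (isOpen_lt continuous_im continuous_const)).measurableSet.inter
      (isOpen_lt continuous_const continuous_re.abs).measurableSet
  · rw [← cgrad_sub_linearPotential (h.differentiableAt (hE z hz.2)), cgrad_eq_conj, enorm_pow,
      enorm_norm]
    simp [← ofReal_norm]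

theorem decay_lipschitz (h : IsSolution ε δ (linearPotential a b) u) (hε : 0 < ε) (hε1 : ε < 1)
    (hδ : 0 < δ) {η : ℝ} (hη : 0 < η) : ∃ X > 3, ∀ z w : ℂ,
      (X < z.re ∧ X < w.re ∨ z.re < -X ∧ w.re < -X) →
      |(u z - linearPotential a b z) - (u w - linearPotential a b w)| ≤ η * ‖z - w‖ := by
  obtain ⟨X, hX, hdec⟩ := h.decay hε hε1 hδ hη
  refine ⟨X, hX, fun z w hzw => ?_⟩
  have hE : ∀ z : ℂ, X < |z.re| → z ∈ exterior ε δ := fun z hz =>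
    exterior_of_abs_re hε hδ (by linarith)
  have key : ∀ A : Set ℂ, Convex ℝ A → (∀ y ∈ A, X < |y.re|) → z ∈ A → w ∈ A →
      |(u z - linearPotential a b z) - (u w - linearPotential a b w)| ≤ η * ‖z - w‖ := by
    intro A hA hAX hz hw
    refine hA.norm_image_sub_le_of_norm_fderiv_le (𝕜 := ℝ)
      (f := fun y => u y - linearPotential a b y) (fun y hy => ?_) (fun y hy => ?_) hw hz
    · exact (h.differentiableAt (hE y (hAX y hy))).sub
        (hasFDerivAt_linearPotential a b y).differentiableAt
    · rw [norm_fderiv_eq_norm_gradient, ← RCLike.norm_conj, ← cgrad_eq_conj,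
        cgrad_sub_linearPotential (h.differentiableAt (hE y (hAX y hy)))]
      exact hdec y (hAX y hy)
  rcases hzw with ⟨hz, hw⟩ | ⟨hz, hw⟩
  · exact key {y | X < y.re} (convex_halfSpace_re_gt X)
      (fun y hy => lt_of_lt_of_le hy (le_abs_self _)) hz hw
  · refine key {y | y.re < -X} (convex_halfSpace_re_lt (-X)) (fun y hy => ?_) hz hw
    have : y.re < -X := hy
    exact lt_of_lt_of_le (by linarith) (neg_le_abs _)

theorem continuousOn {H : ℂ → ℝ} (h : IsSolution ε δ H u) (hε : 0 < ε) (hδ : 0 < δ) :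
    ContinuousOn u (closedExterior ε δ) := by
  rw [← closure_exterior hε hδ]; exact h.contDiffOn.continuousOn

/-- The gradient is periodic and the exterior connected, so u(z + (2 + δ)i) - u(z) is constant. Far
out, where the gradient is close to (a, b), this constant is seen to be b(2 + δ). Continuity extends
the identity to the circles. -/
theorem add_period (h : IsSolution ε δ (linearPotential a b) u) (hε : 0 < ε) (hε1 : ε < 1)
    (hδ : 0 < δ) {z : ℂ} (hz : z ∈ closedExterior ε δ) :
    u (z + (2 + δ : ℝ) * I) = u z + b * (2 + δ) := by
  have hsh : ∀ z, z + ((2 + δ : ℝ) : ℂ) * I = z + (1 : ℤ) * (2 + δ : ℝ) * I := fun z => by simp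
  have hE : ∀ z ∈ exterior ε δ, z + (2 + δ : ℝ) * I ∈ exterior ε δ := fun z hz => by
    rw [hsh]; exact (add_period_mem_exterior hδ 1).2 hz
  have hK : ∀ z ∈ closedExterior ε δ, z + (2 + δ : ℝ) * I ∈ closedExterior ε δ := fun z hz => by
    rw [hsh]; exact (add_period_mem_closedExterior 1).2 hz
  have hd : ∀ z ∈ exterior ε δ, HasFDerivAt (fun z => u (z + (2 + δ : ℝ) * I) - u z)
      (0 : ℂ →L[ℝ] ℝ) z := by
    intro z hz
    have h1 : HasFDerivAt (fun z => u (z + (2 + δ : ℝ) * I)) (fderiv ℝ u (z + (2 + δ : ℝ) * I)) z :=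
      (hasFDerivAt_comp_add_right _).2 (h.differentiableAt (hE z hz)).hasFDerivAt
    have h2 := h1.sub (h.differentiableAt hz).hasFDerivAt
    have h3 : fderiv ℝ u (z + (2 + δ : ℝ) * I) = fderiv ℝ u z := by
      rw [← toDual_gradient, ← toDual_gradient, h.periodic z hz]
    rwa [h3, sub_self] at h2
  obtain ⟨κ, hκ⟩ := (isOpen_exterior ε δ).exists_is_const_of_fderiv_eq_zero (𝕜 := ℝ)
    (isPreconnected_exterior hε hδ)
    (fun z hz => (hd z hz).differentiableAt.differentiableWithinAt) (fun z hz => (hd z hz).fderiv)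
  have hκb : κ = b * (2 + δ) := by
    refine sub_eq_zero_of_forall_abs_le (c := 2 + δ) fun η hη => ?_
    obtain ⟨X, hX, hlip⟩ := h.decay_lipschitz hε hε1 hδ hη
    set x : ℂ := ((X + 1 : ℝ) : ℂ) with hx
    have hxE : x ∈ exterior ε δ := exterior_of_abs_re hε hδ (by
      rw [hx, ofReal_re, abs_of_pos (by linarith)]; linarith)
    have h1 := hlip (x + (2 + δ : ℝ) * I) x (Or.inl (by simp [hx]))
    rw [linearPotential_add_period, add_sub_cancel_left, norm_mul, norm_I, mul_one, norm_real,
      Real.norm_of_nonneg (by linarith)] at h1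
    have h2 : u (x + (2 + δ : ℝ) * I) - u x = κ := hκ x hxE
    rwa [← h2, show u (x + (2 + δ : ℝ) * I) - u x - b * (2 + δ) = u (x + (2 + δ : ℝ) * I) -
      (linearPotential a b x + b * (2 + δ)) - (u x - linearPotential a b x) by ring]
  have hcont := h.continuousOn hε hδ
  have heq : EqOn (fun z => u (z + (2 + δ : ℝ) * I) - u z) (fun _ => κ) (closedExterior ε δ) := by
    refine EqOn.of_subset_closure (fun z hz => hκ z hz) ((ContinuousOn.comp hcont (by fun_prop) hK).sub
      hcont) continuousOn_const (exterior_subset hδ) (closure_exterior hε hδ).ge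
  have := heq hz
  simp only at this
  linarith

/-- Since u - H is periodic, it is bounded for bounded x by compactness of one period; beyond, it
has Lipschitz constant η. -/
theorem growth (h : IsSolution ε δ (linearPotential a b) u) (hε : 0 < ε) (hε1 : ε < 1)
    (hδ : 0 < δ) {η : ℝ} (hη : 0 < η) : ∃ C : ℝ, ∀ z ∈ closedExterior ε δ,
    |u z - linearPotential a b z| ≤ C + η * |z.re| := by
  obtain ⟨X, hX, hlip⟩ := h.decay_lipschitz hε hε1 hδ hη
  set v : ℂ → ℝ := fun z => u z - linearPotential a b z with hv
  have hper : ∀ z ∈ closedExterior ε δ, ∀ n : ℤ, v (z + n * (2 + δ : ℝ) * I) = v z :=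
    fun z hz n => by
      have := int_periodic (φ := v) (β := 0) (A := closedExterior ε δ)
        (fun z hz n => (add_period_mem_closedExterior n).2 hz) (fun z hz => by
          simp only [hv, linearPotential_add_period, h.add_period hε hε1 hδ hz]; ring) hz n
      simpa using this
  have hcont : ContinuousOn v (closedExterior ε δ) := (h.continuousOn hε hδ).sub fun z _ =>
    (hasFDerivAt_linearPotential a b z).continuousAt.continuousWithinAt
  have hcomp : IsCompact (closedExterior ε δ ∩ (Icc (-(X + 1)) (X + 1) ×ℂ
      Icc (-(1 + δ / 2)) (1 + δ / 2))) :=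
    (isCompact_Icc.reProdIm isCompact_Icc).inter_left (isClosed_closedExterior ε δ)
  obtain ⟨C, hC⟩ := hcomp.exists_bound_of_continuousOn (hcont.mono inter_subset_left)
  have hCv : ∀ z ∈ closedExterior ε δ, |z.re| ≤ X + 1 → |v z| ≤ C := fun z hz hre => by
    obtain ⟨n, hn⟩ := exists_period_abs_im_le hδ z
    rw [← hper z hz n]
    refine hC _ ⟨(add_period_mem_closedExterior n).2 hz, ?_, abs_le.1 hn⟩
    simpa using abs_le.1 hre
  refine ⟨C, fun z hz => ?_⟩
  change |v z| ≤ _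
  by_cases hre : |z.re| ≤ X + 1
  · have := hCv z hz hre
    have : 0 ≤ η * |z.re| := by positivity
    linarith
  · push Not at hre
    have key : ∀ x : ℝ, |x| = X + 1 → |z.re - x| ≤ |z.re| →
        (X < z.re ∧ X < x ∨ z.re < -X ∧ x < -X) → |v z| ≤ C + η * |z.re| := by
      intro x hx hd hc
      have hw : (⟨x, z.im⟩ : ℂ) ∈ closedExterior ε δ :=
        exterior_subset hδ (exterior_of_abs_re hε hδ (by simp only [hx]; linarith))
      have h1 := hlip z ⟨x, z.im⟩ hc
      have h2 := hCv ⟨x, z.im⟩ hw hx.le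
      have h3 : ‖z - ⟨x, z.im⟩‖ = |z.re - x| := by
        rw [show z - ⟨x, z.im⟩ = ((z.re - x : ℝ) : ℂ) by apply Complex.ext <;> simp, norm_real,
          Real.norm_eq_abs]
      rw [h3] at h1
      have h4 : η * |z.re - x| ≤ η * |z.re| := by gcongr
      have h5 := abs_sub_abs_le_abs_sub (v z) (v ⟨x, z.im⟩)
      simp only [hv] at h2 h5 ⊢
      linarith
    rcases lt_abs.1 hre with h' | h'
    · exact key (X + 1) (abs_of_pos (by linarith))
        (by rw [abs_of_pos (by linarith : 0 < z.re), abs_of_pos (by linarith)]; linarith)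
        (Or.inl ⟨by linarith, by linarith⟩)
    · exact key (-(X + 1)) (by rw [abs_neg, abs_of_pos (by linarith)])
        (by rw [abs_of_neg (by linarith : z.re < 0), abs_of_neg (by linarith)]; linarith)
        (Or.inr ⟨by linarith, by linarith⟩)

end IsSolution

/-! ### The properties of a solution -/

namespace IsSolution

variable {ε δ a b : ℝ} {u : ℂ → ℝ}

/-- The real part of (u_x - i u_y)(z - c) is the inner product of the gradient with z - c. Cauchy's
theorem on the annulus between the radii 1 and r therefore carries the vanishing flux from the unit
circle to nearby circles inside the domain of harmonicity. -/
theorem integral_circleMap_re_eq_zero {H : ℂ → ℝ} (h : IsSolution ε δ H u) (hε : 0 < ε) (hδ : 0 < δ)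
    {r : ℝ} (hr : r ∈ Ioo 1 (1 + min ε δ / 4)) :
    (∫ θ in (0 : ℝ)..2 * Real.pi, cgrad u (circleMap (centerR ε δ 0) r θ) * circleMap 0 r θ).re
      = 0 := by
  set c := centerR ε δ 0 with hc
  have hcm : c ∈ centers ε δ := Or.inr ⟨0, rfl⟩
  have hmin : 0 < min ε δ := by positivity
  -- G continues `cgrad u` up to the unit circle, where the two-sided derivative of u carries no
  -- information.
  set G : ℂ → ℂ := fun z => conj (gradientWithin u (closedExterior ε δ) z) with hG
  have hann : ∀ z, 1 ≤ dist z c → dist z c ≤ r → z ∈ closedExterior ε δ ∧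
      (1 < dist z c → z ∈ exterior ε δ) := by
    intro z h1 h2
    have hpos : 0 < dist z c := by linarith
    set z₀ : ℂ := c + ((dist z c)⁻¹ : ℝ) * (z - c) with hz₀
    have h0 : dist z₀ c = 1 := by
      rw [dist_eq, hz₀, add_sub_cancel_left, norm_mul, norm_real, ← dist_eq,
        Real.norm_of_nonneg (by positivity), inv_mul_cancel₀ hpos.ne']
    have hzz : z - z₀ = ((dist z c - 1 : ℝ) : ℂ) * (z₀ - c) := by
      have : z - c = (dist z c : ℂ) * (z₀ - c) := by
        rw [hz₀, add_sub_cancel_left, ← mul_assoc, ← ofReal_mul, mul_inv_cancel₀ hpos.ne']; simp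
      push_cast
      linear_combination this
    have hd : dist z z₀ < min ε δ := by
      rw [dist_eq, hzz, norm_mul, ← dist_eq, h0, norm_real, Real.norm_of_nonneg (by linarith), mul_one]
      linarith [hr.2]
    refine ⟨fun c' hc' => ?_, fun hlt => mem_exterior_of_dist_lt hδ hcm h0 hd hlt⟩
    rcases eq_or_ne c' c with rfl | hne
    · exact h1
    · exact (one_lt_dist_of_dist_eq_one hδ hcm hc' hne h0 hd).le
  have hGE : ∀ z ∈ exterior ε δ, G z = cgrad u z := fun z hz => by
    rw [cgrad_eq_conj, hG]
    have : fderivWithin ℝ u (closedExterior ε δ) z = fderiv ℝ u z :=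
      fderivWithin_of_mem_nhds (mem_of_superset ((isOpen_exterior ε δ).mem_nhds hz)
        (exterior_subset hδ))
    simp only [gradientWithin, gradient, this]
  have hGc : ContinuousOn G (closedExterior ε δ) := by
    have hcd := h.contDiffOn
    rw [closure_exterior hε hδ] at hcd
    have h1 := hcd.continuousOn_fderivWithin (uniqueDiffOn_closedExterior hε hδ) le_rfl
    exact continuous_conj.comp_continuousOn
      ((toDual ℝ ℂ).symm.continuous.comp_continuousOn h1)
  have hcircle : ∀ s : ℝ, (∮ z in C(c, s), G z) =
      I * ∫ θ in (0 : ℝ)..2 * Real.pi, G (circleMap c s θ) * circleMap 0 s θ := fun s => by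
    rw [circleIntegral, ← intervalIntegral.integral_const_mul]
    refine intervalIntegral.integral_congr fun θ _ => ?_
    simp only [deriv_circleMap, smul_eq_mul]
    ring
  have heq := circleIntegral_eq_of_differentiable_on_annulus_off_countable (c := c) (r := 1) (R := r)
    one_pos hr.1.le countable_empty (f := G)
    (hGc.mono fun z hz => (hann z (not_lt.1 hz.2) hz.1).1) (by
      rintro z ⟨⟨hz1, hz2⟩, -⟩
      have hzc : 1 < dist z c := not_le.1 hz2
      have hzE := (hann z hzc.le (le_of_lt hz1)).2 hzc
      refine (differentiableAt_cgrad h.harmonic hzE).congr_of_eventuallyEq ?_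
      filter_upwards [(isOpen_exterior ε δ).mem_nhds hzE] with w hw using hGE w hw)
  rw [hcircle, hcircle] at heq
  have heq2 := mul_left_cancel₀ I_ne_zero heq
  have hr1 : ∀ θ, circleMap c r θ ∈ exterior ε δ := fun θ => by
    have hd : dist (circleMap c r θ) c = r := by
      rw [dist_eq, circleMap_sub_center, norm_circleMap_zero, abs_of_pos (by linarith [hr.1])]
    exact (hann _ (by rw [hd]; exact hr.1.le) hd.le).2 (by rw [hd]; exact hr.1)
  have hK1 : ∀ θ, circleMap c 1 θ ∈ closedExterior ε δ := fun θ => by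
    have hd : dist (circleMap c 1 θ) c = 1 := by
      rw [dist_eq, circleMap_sub_center, norm_circleMap_zero, abs_one]
    exact (hann _ hd.ge (by rw [hd]; exact hr.1.le)).1
  rw [intervalIntegral.integral_congr (g := fun θ => cgrad u (circleMap c r θ) * circleMap 0 r θ)
    (fun θ _ => by simp only [hGE _ (hr1 θ)])] at heq2
  rw [heq2]
  have hcont : Continuous fun θ => G (circleMap c 1 θ) * circleMap 0 1 θ :=
    (hGc.comp_continuous (continuous_circleMap c 1) hK1).mul (continuous_circleMap 0 1)
  have hre := reCLM.intervalIntegral_comp_comm (μ := volume)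
    (hcont.intervalIntegrable 0 (2 * Real.pi))
  simp only [reCLM_apply] at hre
  rw [← hre]
  have hfl := h.flux_right
  rw [flux, closure_exterior hε hδ, ← neg_eq_zero, ← intervalIntegral.integral_neg] at hfl
  refine (intervalIntegral.integral_congr fun θ _ => ?_).trans hfl
  simp only [hG, Complex.inner, ← circleMap_sub_center c 1 θ, ← hc]
  rw [← neg_sub c, mul_neg, neg_re, mul_comm]

theorem integral_polar_re_eq_zero {H : ℂ → ℝ} (h : IsSolution ε δ H u) (hε : 0 < ε) (hδ : 0 < δ)
    {r : ℝ} (hr : r ∈ Ioo 1 (1 + min ε δ / 4)) :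
    (∫ θ in Ioo (-Real.pi) Real.pi, cgrad u (centerR ε δ 0 + Complex.polarCoord.symm (r, θ)) *
      Complex.polarCoord.symm (r, θ)).re = 0 := by
  have hpol : ∀ θ, Complex.polarCoord.symm (r, θ) = circleMap 0 r θ := fun θ => by
    rw [circleMap, Complex.polarCoord_symm_apply, exp_mul_I, ofReal_cos, ofReal_sin, zero_add]
  have h1 := h.integral_circleMap_re_eq_zero hε hδ hr
  have hp : Function.Periodic
      (fun θ => cgrad u (circleMap (centerR ε δ 0) r θ) * circleMap 0 r θ) (2 * Real.pi) :=
    fun θ => by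
      simp only [periodic_circleMap _ _ θ]
  have h2 := hp.intervalIntegral_add_eq 0 (-Real.pi)
  rw [zero_add, show -Real.pi + 2 * Real.pi = Real.pi by ring,
    intervalIntegral.integral_of_le (a := -Real.pi) (by linarith [Real.pi_pos]),
    integral_Ioc_eq_integral_Ioo] at h2
  rw [h2] at h1
  rw [← h1]
  congr 1
  refine integral_congr_ae (Eventually.of_forall fun θ => ?_)
  simp only [hpol, circleMap, zero_add]

/-- The right disk has zero flux, so moving the line x = 0 across it to large x does not change the
flux per period; there the gradient is within η of (a, b). Only the disk D_R0 is crossed, so the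
left row does not enter. -/
theorem flux_vertical (h : IsSolution ε δ (linearPotential a b) u) (hε : 0 < ε) (hε1 : ε < 1)
    (hδ : 0 < δ) :
    ∫ y in (-(1 + δ / 2))..(1 + δ / 2), fderiv ℝ u (y * I) 1 = a * (2 + δ) := by
  have hle : -(1 + δ / 2) ≤ 1 + δ / 2 := by linarith
  have hline : ∀ y : ℝ, (0 : ℝ) + y * I ∈ exterior ε δ := fun y => by
    rw [mem_exterior_iff hδ]
    intro n
    simp only [ofReal_zero, zero_add, mul_re, ofReal_re, I_re, mul_zero, ofReal_im, I_im, mul_one, sub_self,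
      zero_sub, mul_im, add_zero]
    constructor <;> nlinarith [sq_nonneg (y - n * (2 + δ))]
  have hcont0 : Continuous fun y : ℝ => cgrad u ((0 : ℝ) + y * I) :=
    continuous_iff_continuousAt.2 fun y => ContinuousAt.comp (f := fun y : ℝ => ((0 : ℝ) : ℂ) + y * I)
      (differentiableAt_cgrad h.harmonic (hline y)).continuousAt (by fun_prop)
  have hre := reCLM.intervalIntegral_comp_comm (μ := volume)
    (hcont0.intervalIntegrable (-(1 + δ / 2)) (1 + δ / 2))
  have hLHS : ∫ y in (-(1 + δ / 2))..(1 + δ / 2), fderiv ℝ u (y * I) 1 =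
      (∫ y in (-(1 + δ / 2))..(1 + δ / 2), cgrad u ((0 : ℝ) + y * I)).re := by
    rw [← reCLM_apply, ← hre]
    refine intervalIntegral.integral_congr fun y _ => ?_
    simp [cgrad]
  rw [hLHS]
  refine sub_eq_zero_of_forall_abs_le (c := 2 + δ) fun η hη => ?_
  obtain ⟨X, hX, hdec⟩ := h.decay hε hε1 hδ hη
  have hmin : 0 < min ε δ := by positivity
  have hm1 := min_le_left ε δ
  have hm2 := min_le_right ε δ
  have hvert := re_integral_vertical_eq (κ := min ε δ / 4) (x₀ := 0) (x₁ := X + 1)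
    (y₀ := -(1 + δ / 2)) (y₁ := 1 + δ / 2) (by positivity) (c := centerR ε δ 0) (f := cgrad u)
    (fun z hz => by
      rw [mem_closedBall, dist_eq] at hz
      have h1 := abs_le.1 ((abs_re_le_norm _).trans hz)
      have h2 := abs_le.1 ((abs_im_le_norm _).trans hz)
      simp only [sub_re, sub_im, centerR, Int.cast_zero, zero_mul] at h1 h2
      exact ⟨⟨by linarith, by linarith⟩, ⟨by linarith, by linarith⟩⟩)
    (fun z hz hzc => by
      refine differentiableAt_cgrad h.harmonic (mem_exterior_of_abs_im_le hδ (abs_le.2 hz.2) ?_ ?_)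
      · have : 0 ≤ z.re := hz.1.1
        nlinarith [sq_nonneg z.im]
      · simpa [centerR] using one_lt_dist_iff.1 hzc)
    (fun x hx => by
      have hmem : (x + (-(1 + δ / 2) : ℝ) * I : ℂ) ∈ exterior ε δ := by
        have him : (x + (-(1 + δ / 2) : ℝ) * I : ℂ).im = -(1 + δ / 2) := by simp
        refine mem_exterior_of_abs_im_le hδ ?_ ?_ ?_ <;> rw [him]
        · rw [abs_neg, abs_of_pos (by linarith)]
        · nlinarith [sq_nonneg ((x + (-(1 + δ / 2) : ℝ) * I : ℂ).re - (-1 - ε / 2))]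
        · nlinarith [sq_nonneg ((x + (-(1 + δ / 2) : ℝ) * I : ℂ).re - (1 + ε / 2))]
      have := h.cgrad_periodic hδ hmem 1
      rw [← this]
      congr 1
      push_cast
      ring)
    (fun r hr => h.integral_polar_re_eq_zero hε hδ hr)
  rw [← hvert]
  have hX1 : ∀ y : ℝ, X < |((X + 1 : ℝ) + y * I : ℂ).re| := fun y => by
    rw [show ((X + 1 : ℝ) + y * I : ℂ).re = X + 1 by simp, abs_of_pos (by linarith)]; linarith
  have hcont1 : Continuous fun y : ℝ => cgrad u ((X + 1 : ℝ) + y * I) :=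
    continuous_iff_continuousAt.2 fun y => ContinuousAt.comp
      (f := fun y : ℝ => ((X + 1 : ℝ) : ℂ) + y * I)
      (differentiableAt_cgrad h.harmonic (exterior_of_abs_re hε hδ (by
        linarith [hX1 y]))).continuousAt (by fun_prop)
  have hsub : (∫ y in (-(1 + δ / 2))..(1 + δ / 2), cgrad u ((X + 1 : ℝ) + y * I)) -
      ((2 + δ : ℝ) : ℂ) * (a - b * I) =
      ∫ y in (-(1 + δ / 2))..(1 + δ / 2), (cgrad u ((X + 1 : ℝ) + y * I) - (a - b * I)) := by
    rw [intervalIntegral.integral_sub (hcont1.intervalIntegrable _ _) (by simp),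
      intervalIntegral.integral_const, real_smul]
    congr 2
    push_cast
    ring
  have hnorm := intervalIntegral.norm_integral_le_of_norm_le_const (C := η)
    (a := -(1 + δ / 2)) (b := 1 + δ / 2)
    (f := fun y : ℝ => cgrad u ((X + 1 : ℝ) + y * I) - (a - b * I)) (fun y _ => hdec _ (hX1 y))
  rw [← hsub, show 1 + δ / 2 - -(1 + δ / 2) = 2 + δ by ring,
    abs_of_pos (by linarith : 0 < 2 + δ)] at hnorm
  refine le_trans ?_ hnorm
  refine le_trans (le_of_eq ?_) (abs_re_le_norm _)
  rw [sub_re, re_ofReal_mul, show (a - b * I : ℂ).re = a by simp, mul_comm a]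

theorem exists_periodicSolution (h : IsSolution ε δ (linearPotential a b) u) (hε : 0 < ε)
    (hε1 : ε < 1) (hδ : 0 < δ) : ∃ cL cR : ℝ, PeriodicSolution ε δ a b cL cR u := by
  obtain ⟨cL, hL⟩ := h.const_left
  obtain ⟨cR, hR⟩ := h.const_right
  rw [diskL, frontier_ball _ one_ne_zero] at hL
  rw [diskR, frontier_ball _ one_ne_zero] at hR
  exact ⟨cL, cR, h.continuousOn hε hδ, h.harmonic, fun z hz => h.add_period hε hε1 hδ hz, hL, hR,
    fun η hη => h.growth hε hε1 hδ hη, h.flux_vertical hε hε1 hδ⟩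

end IsSolution

/-! ### Linearity, reflection, and the maximum principle -/

theorem harmonicAt_comp_conj {u : ℂ → ℝ} {z : ℂ} (h : HarmonicAt u (conj z)) :
    HarmonicAt (fun w => u (conj w)) z := by
  obtain ⟨d, hd, hb⟩ := harmonicOnNhd_ball_exists h
  obtain ⟨F, hF, hFu⟩ := hb.exists_analyticOnNhd_ball_re_eq
  have hmem : ∀ w ∈ ball z d, conj w ∈ ball (conj z) d := fun w hw => by
    rwa [mem_ball, dist_conj_conj]
  have hdiff : DifferentiableOn ℂ (fun w => conj (F (conj w))) (ball z d) := fun w hw => by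
    have h1 := (hF _ (hmem w hw)).differentiableAt.conj_conj
    rw [conj_conj] at h1
    exact h1.differentiableWithinAt
  have han := hdiff.analyticAt (ball_mem_nhds z hd)
  refine (harmonicAt_congr_nhds ?_).1 han.harmonicAt_re
  filter_upwards [ball_mem_nhds z hd] with w hw
  rw [conj_re]
  exact hFu (hmem w hw)

theorem conj_mem_centers {ε δ : ℝ} {c : ℂ} (hc : c ∈ centers ε δ) : conj c ∈ centers ε δ := by
  rcases hc with ⟨n, rfl⟩ | ⟨n, rfl⟩
  · exact Or.inl ⟨-n, by apply Complex.ext <;> simp [centerL]⟩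
  · exact Or.inr ⟨-n, by apply Complex.ext <;> simp [centerR]⟩

theorem conj_mem_exterior {ε δ : ℝ} (hδ : 0 < δ) {z : ℂ} (hz : z ∈ exterior ε δ) :
    conj z ∈ exterior ε δ := by
  rw [mem_exterior hδ] at hz ⊢
  intro c hc
  rw [← conj_conj c, dist_conj_conj]
  exact hz _ (conj_mem_centers hc)

theorem conj_mem_closedExterior {ε δ : ℝ} {z : ℂ} (hz : z ∈ closedExterior ε δ) :
    conj z ∈ closedExterior ε δ := by
  intro c hc
  rw [← conj_conj c, dist_conj_conj]
  exact hz _ (conj_mem_centers hc)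

theorem mul_I_mem_exterior {ε δ : ℝ} (hε : 0 < ε) (hδ : 0 < δ) (y : ℝ) :
    (y * I : ℂ) ∈ exterior ε δ := by
  rw [mem_exterior_iff hδ]
  intro n
  simp only [mul_re, ofReal_re, I_re, mul_zero, ofReal_im, I_im, mul_one, sub_self,
    zero_sub, mul_im, add_zero]
  constructor <;> nlinarith [sq_nonneg (y - n * (2 + δ))]

namespace PeriodicSolution

variable {ε δ a b cL cR a' b' cL' cR' : ℝ} {u u' : ℂ → ℝ}

theorem differentiableAt (h : PeriodicSolution ε δ a b cL cR u) {z : ℂ} (hz : z ∈ exterior ε δ) :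
    DifferentiableAt ℝ u z := (h.harmonic z hz).1.differentiableAt two_ne_zero

theorem continuous_fderiv_one (h : PeriodicSolution ε δ a b cL cR u) (hε : 0 < ε) (hδ : 0 < δ) :
    Continuous fun y : ℝ => fderiv ℝ u (y * I) 1 := by
  have h1 : Continuous fun y : ℝ => (cgrad u (y * I)).re :=
    continuous_re.comp (continuous_iff_continuousAt.2 fun y => ContinuousAt.comp
      (f := fun y : ℝ => (y : ℂ) * I)
      (differentiableAt_cgrad h.harmonic (mul_I_mem_exterior hε hδ y)).continuousAt (by fun_prop))
  convert h1 using 2 with y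
  simp [cgrad]

theorem linear (h : PeriodicSolution ε δ a b cL cR u) (h' : PeriodicSolution ε δ a' b' cL' cR' u')
    (hε : 0 < ε) (hδ : 0 < δ) (s t : ℝ) :
    PeriodicSolution ε δ (s * a + t * a') (s * b + t * b') (s * cL + t * cL') (s * cR + t * cR')
      (s • u + t • u') where
  cont := (h.cont.const_smul s).add (h'.cont.const_smul t)
  harmonic := (h.harmonic.const_smul (c := s)).add (h'.harmonic.const_smul (c := t))
  periodic z hz := by
    simp only [Pi.add_apply, Pi.smul_apply, smul_eq_mul, h.periodic z hz, h'.periodic z hz]; ring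
  left z hz := by simp [h.left z hz, h'.left z hz]
  right z hz := by simp [h.right z hz, h'.right z hz]
  growth η hη := by
    obtain ⟨C, hC⟩ := h.growth (η / (2 * (|s| + 1))) (by positivity)
    obtain ⟨C', hC'⟩ := h'.growth (η / (2 * (|t| + 1))) (by positivity)
    refine ⟨|s| * C + |t| * C', fun z hz => ?_⟩
    have h1 := mul_le_mul_of_nonneg_left (hC z hz) (abs_nonneg s)
    have h2 := mul_le_mul_of_nonneg_left (hC' z hz) (abs_nonneg t)
    rw [← abs_mul] at h1 h2
    have h3 : ∀ s : ℝ, |s| * (η / (2 * (|s| + 1)) * |z.re|) ≤ η / 2 * |z.re| := fun s => by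
      rw [← mul_assoc]
      gcongr
      rw [mul_div_assoc', div_le_div_iff₀ (by positivity) two_pos]
      nlinarith [abs_nonneg s]
    have h4 := abs_add_le (s * (u z - linearPotential a b z)) (t * (u' z - linearPotential a' b' z))
    have h5 : (s • u + t • u') z - linearPotential (s * a + t * a') (s * b + t * b') z =
        s * (u z - linearPotential a b z) + t * (u' z - linearPotential a' b' z) := by
      simp [linearPotential]; ring
    rw [h5]
    have := h3 s
    have := h3 t
    linarith
  flux := by
    have hd : ∀ y : ℝ, fderiv ℝ (s • u + t • u') (y * I) 1 =
        s * fderiv ℝ u (y * I) 1 + t * fderiv ℝ u' (y * I) 1 := fun y => by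
      have h1 := (h.differentiableAt (mul_I_mem_exterior hε hδ y)).hasFDerivAt.const_smul s
      have h2 := (h'.differentiableAt (mul_I_mem_exterior hε hδ y)).hasFDerivAt.const_smul t
      rw [(h1.add h2).fderiv]
      simp
    simp only [hd]
    rw [intervalIntegral.integral_add
      (((h.continuous_fderiv_one hε hδ).const_mul s).intervalIntegrable _ _)
      (((h'.continuous_fderiv_one hε hδ).const_mul t).intervalIntegrable _ _),
      intervalIntegral.integral_const_mul, intervalIntegral.integral_const_mul, h.flux, h'.flux]
    ring

theorem reflect (h : PeriodicSolution ε δ a b cL cR u) (hε : 0 < ε) (hδ : 0 < δ) :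
    PeriodicSolution ε δ a (-b) cL cR (fun z => u (conj z)) where
  cont := h.cont.comp continuous_conj.continuousOn fun _ hz => conj_mem_closedExterior hz
  harmonic z hz := harmonicAt_comp_conj (h.harmonic _ (conj_mem_exterior hδ hz))
  periodic z hz := by
    have hz' : conj (z + (2 + δ : ℝ) * I) ∈ closedExterior ε δ := by
      refine conj_mem_closedExterior ?_
      have := (add_period_mem_closedExterior (δ := δ) 1).2 hz
      simpa using this
    have h1 := h.periodic _ hz'
    rw [show conj (z + (2 + δ : ℝ) * I) + (2 + δ : ℝ) * I = conj z by
      rw [map_add, map_mul, conj_ofReal, conj_I]; ring] at h1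
    linarith
  left z hz := h.left _ (by
    rw [show centerL ε δ 0 = conj (centerL ε δ 0) by apply Complex.ext <;> simp [centerL],
      dist_conj_conj, hz])
  right z hz := h.right _ (by
    rw [show centerR ε δ 0 = conj (centerR ε δ 0) by apply Complex.ext <;> simp [centerR],
      dist_conj_conj, hz])
  growth η hη := by
    obtain ⟨C, hC⟩ := h.growth η hη
    refine ⟨C, fun z hz => ?_⟩
    have := hC _ (conj_mem_closedExterior hz)
    simpa [linearPotential] using this
  flux := by
    have hd : ∀ y : ℝ, fderiv ℝ (fun z => u (conj z)) (y * I) 1 =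
        fderiv ℝ u ((-y : ℝ) * I) 1 := fun y => by
      have hc : conj ((y : ℂ) * I) = (-y : ℝ) * I := by simp
      have h1 := (h.differentiableAt (mul_I_mem_exterior hε hδ (-y))).hasFDerivAt
      rw [← hc] at h1
      have h2 := h1.comp (y * I : ℂ) (conjCLE.toContinuousLinearMap.hasFDerivAt (x := (y * I : ℂ)))
      have h3 : fderiv ℝ (fun z => u (conj z)) (y * I) = _ := h2.fderiv
      rw [h3, ← hc]
      simp
    simp only [hd]
    rw [intervalIntegral.integral_comp_neg (fun y : ℝ => fderiv ℝ u (y * I) 1), neg_neg]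
    exact h.flux

end PeriodicSolution

/-- The maximum principle for periodic functions of sublinear growth. -/
theorem le_of_le_on_circles {ε δ m : ℝ} (hε : 0 < ε) (hε1 : ε < 1) (hδ : 0 < δ) {v : ℂ → ℝ}
    (hcont : ContinuousOn v (closedExterior ε δ)) (hharm : HarmonicOnNhd v (exterior ε δ))
    (hper : ∀ z ∈ closedExterior ε δ, ∀ n : ℤ, v (z + n * (2 + δ : ℝ) * I) = v z)
    (hgrowth : ∀ η > 0, ∃ C : ℝ, ∀ z ∈ closedExterior ε δ, v z ≤ C + η * |z.re|)
    (hbd : ∀ z ∈ closedExterior ε δ, z ∉ exterior ε δ → v z ≤ m) :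
    ∀ z ∈ closedExterior ε δ, v z ≤ m := by
  have hE3 : ∀ z : ℂ, 3 ≤ |z.re| → z ∈ exterior ε δ := fun z hz =>
    exterior_of_abs_re hε hδ (by linarith)
  -- A Phragmén–Lindelöf argument: on each half-plane s · x ≥ 3 the supremum is attained on the
  -- boundary line. The correction η s x absorbs the sublinear growth, and then η → 0.
  have hhalf : ∀ s : ℝ, s = 1 ∨ s = -1 → ∃ z₃ : ℂ, z₃.re = s * 3 ∧ |z₃.im| ≤ 1 + δ / 2 ∧
      ∀ z : ℂ, 3 ≤ s * z.re → v z ≤ v z₃ := by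
    intro s hs
    have hs2 : s * s = 1 := by rcases hs with rfl | rfl <;> norm_num
    have habs : |s| = 1 := by rcases hs with rfl | rfl <;> norm_num
    have hre : ∀ z : ℂ, 3 ≤ s * z.re → z ∈ exterior ε δ := fun z hz => hE3 z (by
      have := hz.trans (le_abs_self _)
      rwa [abs_mul, habs, one_mul] at this)
    have hcomp : IsCompact (({s * 3} : Set ℝ) ×ℂ Icc (-(1 + δ / 2)) (1 + δ / 2)) :=
      isCompact_singleton.reProdIm isCompact_Icc
    have hsub : (({s * 3} : Set ℝ) ×ℂ Icc (-(1 + δ / 2)) (1 + δ / 2)) ⊆ closedExterior ε δ :=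
      fun z hz => exterior_subset hδ (hre z (by
        rw [show z.re = s * 3 from hz.1, ← mul_assoc, hs2, one_mul]))
    obtain ⟨z₃, hz₃, hmax⟩ := hcomp.exists_isMaxOn
      ⟨⟨s * 3, 0⟩, rfl, by constructor <;> simp <;> linarith⟩ (hcont.mono hsub)
    refine ⟨z₃, hz₃.1, abs_le.2 hz₃.2, fun z hz => ?_⟩
    have hline : ∀ w : ℂ, w.re = s * 3 → v w ≤ v z₃ := fun w hw => by
      obtain ⟨n, hn⟩ := exists_period_abs_im_le hδ w
      rw [← hper w (exterior_subset hδ (hre w (by rw [hw, ← mul_assoc, hs2, one_mul]))) n]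
      exact hmax ⟨by simpa using hw, abs_le.1 hn⟩
    have key : ∀ η > 0, v z ≤ v z₃ + η * (s * z.re - 3) := by
      intro η hη
      obtain ⟨C, hC⟩ := hgrowth (η / 2) (by positivity)
      -- X is so large that growth with slope η/2 is beaten by the slope η of the correction on the
      -- line s · x = X, and that z lies in the truncated strip.
      set X : ℝ := max (s * z.re) (max 4 (2 * (C - v z₃ + 3 * η) / η)) with hX
      have hX4 : 4 ≤ X := (le_max_left _ _).trans (le_max_right _ _)
      have hXC : C + η / 2 * X ≤ v z₃ + η * (X - 3) := by
        have : 2 * (C - v z₃ + 3 * η) / η ≤ X := (le_max_right _ _).trans (le_max_right _ _)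
        rw [div_le_iff₀ hη] at this
        linarith
      set w : ℂ → ℝ := v - linearPotential (η * s) 0 with hw
      have hlin : ∀ y : ℂ, linearPotential (η * s) 0 y = η * (s * y.re) := fun y => by
        simp [linearPotential]; ring
      have hsc : Continuous fun y : ℂ => s * y.re := continuous_const.mul continuous_re
      have hres := le_of_harmonicOnNhd (P := {y : ℂ | 3 ≤ s * y.re ∧ s * y.re ≤ X})
        (U := {y : ℂ | 3 < s * y.re ∧ s * y.re < X})
        (C₀ := {y : ℂ | (3 ≤ s * y.re ∧ s * y.re ≤ X) ∧ |y.im| ≤ 1 + δ / 2}) (w := w)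
        (m := v z₃ - η * 3) ?_ ?_ ?_ ?_ ?_ ?_ ?_ ?_ z ⟨hz, le_max_left _ _⟩
      · simp only [hw, Pi.sub_apply, hlin] at hres
        linarith
      · exact (isOpen_lt continuous_const hsc).inter (isOpen_lt hsc continuous_const)
      · exact fun y hy => ⟨le_of_lt hy.1, le_of_lt hy.2⟩
      · refine IsCompact.of_isClosed_subset
          ((isCompact_Icc (a := -X) (b := X)).reProdIm
            (isCompact_Icc (a := -(1 + δ / 2)) (b := 1 + δ / 2))) ?_ ?_
        · exact ((isClosed_le continuous_const hsc).inter (isClosed_le hsc continuous_const)).inter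
            (isClosed_le continuous_im.abs continuous_const)
        · rintro y ⟨⟨h1, h2⟩, h3⟩
          refine ⟨?_, abs_le.1 h3⟩
          rcases hs with rfl | rfl <;> constructor <;> linarith
      · exact fun y hy => hy.1
      · exact (hcont.mono fun y hy => exterior_subset hδ (hre y hy.1.1)).sub fun y _ =>
          (hasFDerivAt_linearPotential _ _ y).continuousAt.continuousWithinAt
      · exact (hharm.mono fun y hy => hre y (le_of_lt hy.1)).sub fun y _ =>
          harmonicAt_linearPotential _ _ y
      · intro y hy
        obtain ⟨n, hn⟩ := exists_period_abs_im_le hδ y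
        have hyre : (y + n * (2 + δ : ℝ) * I).re = y.re := by simp
        refine ⟨_, ⟨?_, hn⟩, hyre, ?_⟩
        · rw [hyre]; exact hy
        · simp only [hw, Pi.sub_apply, hlin, hyre, hper y (exterior_subset hδ (hre y hy.1)) n]
      · intro y hy hyU
        simp only [hw, Pi.sub_apply, hlin]
        rcases eq_or_lt_of_le hy.1 with h3 | h3
        · have := hline y (by rw [h3, ← mul_assoc, hs2, one_mul])
          rw [← h3]
          linarith
        · have hyX : s * y.re = X := le_antisymm hy.2 (not_lt.1 fun hlt => hyU ⟨h3, hlt⟩)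
          have hyabs : |y.re| = X := by
            rw [← one_mul |y.re|, ← habs, ← abs_mul, hyX, abs_of_pos (by linarith)]
          have := hC y (exterior_subset hδ (hre y hy.1))
          rw [hyabs] at this
          rw [hyX]
          linarith
    refine le_of_forall_pos_le_add fun e he => ?_
    have hpos : 0 ≤ s * z.re - 3 := by linarith
    refine (key (e / (s * z.re - 3 + 1)) (by positivity)).trans ?_
    gcongr
    rw [div_mul_eq_mul_div, div_le_iff₀ (by positivity)]
    nlinarith
  have hcomp : IsCompact (closedExterior ε δ ∩
      (Icc (-3) 3 ×ℂ Icc (-(1 + δ / 2)) (1 + δ / 2))) :=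
    (isCompact_Icc.reProdIm isCompact_Icc).inter_left (isClosed_closedExterior ε δ)
  obtain ⟨zm, hzm, hmax⟩ := hcomp.exists_isMaxOn ⟨0, exterior_subset hδ (by
      simpa using mul_I_mem_exterior hε hδ 0), by constructor <;> simp, by
      constructor <;> simp <;> linarith⟩ (hcont.mono inter_subset_left)
  have hglob : ∀ z ∈ closedExterior ε δ, v z ≤ v zm := by
    intro z hz
    rcases le_or_gt (|z.re|) 3 with h3 | h3
    · obtain ⟨n, hn⟩ := exists_period_abs_im_le hδ z
      rw [← hper z hz n]
      exact hmax ⟨(add_period_mem_closedExterior n).2 hz, by simpa using abs_le.1 h3, abs_le.1 hn⟩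
    · have hs : ∃ s : ℝ, (s = 1 ∨ s = -1) ∧ 3 ≤ s * z.re := by
        rcases lt_abs.1 h3 with h | h
        · exact ⟨1, Or.inl rfl, by linarith⟩
        · exact ⟨-1, Or.inr rfl, by linarith⟩
      obtain ⟨s, hs, hsz⟩ := hs
      obtain ⟨z₃, h1, h2, h3⟩ := hhalf s hs
      refine (h3 z hsz).trans (hmax ⟨exterior_subset hδ (hE3 _ ?_), ?_, abs_le.1 h2⟩)
      · rw [h1]; rcases hs with rfl | rfl <;> norm_num
      · simp only [mem_preimage, h1]
        rcases hs with rfl | rfl <;> constructor <;> norm_num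
  suffices hm : v zm ≤ m from fun z hz => (hglob z hz).trans hm
  -- If the global maximum is in the interior, then v is constant, and its value is read off at a
  -- point of a circle.
  by_cases hzE : zm ∈ exterior ε δ
  · have hconst := eq_of_isMax_of_isPreconnected (isOpen_exterior ε δ)
      (isPreconnected_exterior hε hδ) hharm hzE fun y hy => hglob y (exterior_subset hδ hy)
    have hext : EqOn v (fun _ => v zm) (closedExterior ε δ) :=
      EqOn.of_subset_closure hconst hcont continuousOn_const (exterior_subset hδ)
        (closure_exterior hε hδ).ge
    have hp : dist (centerR ε δ 0 + 1) (centerR ε δ 0) = 1 := by simp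
    have hpK : centerR ε δ 0 + 1 ∈ closedExterior ε δ := by
      intro c hc
      rcases eq_or_ne c (centerR ε δ 0) with rfl | hne
      · exact hp.ge
      · exact (one_lt_dist_of_dist_eq_one hδ (Or.inr ⟨0, rfl⟩) hc hne hp
          (by rw [dist_self]; positivity)).le
    have hpm : v (centerR ε δ 0 + 1) = v zm := hext hpK
    rw [← hpm]
    refine hbd _ hpK fun hE => ?_
    exact ((mem_exterior hδ).1 hE _ (Or.inr ⟨0, rfl⟩)).ne' hp
  · exact hbd _ hzm.1 hzE

theorem mem_closedExterior_of_dist_eq_one {ε δ : ℝ} (hε : 0 < ε) (hδ : 0 < δ) {c z : ℂ}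
    (hc : c ∈ centers ε δ) (hz : dist z c = 1) : z ∈ closedExterior ε δ := by
  intro c' hc'
  rcases eq_or_ne c' c with rfl | hne
  · exact hz.ge
  · exact (one_lt_dist_of_dist_eq_one hδ hc hc' hne hz (by rw [dist_self]; positivity)).le

namespace PeriodicSolution

variable {ε δ a b cL cR : ℝ} {u : ℂ → ℝ}

theorem periodic_int (h : PeriodicSolution ε δ a b cL cR u) {z : ℂ} (hz : z ∈ closedExterior ε δ)
    (n : ℤ) : u (z + n * (2 + δ : ℝ) * I) = u z + n * (b * (2 + δ)) := by
  have := int_periodic (φ := u) (β := b * (2 + δ)) (A := closedExterior ε δ)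
    (fun z hz n => (add_period_mem_closedExterior n).2 hz) h.periodic hz n
  rwa [zsmul_eq_mul] at this

theorem eq_right (h : PeriodicSolution ε δ a b cL cR u) (hε : 0 < ε) (hδ : 0 < δ) {z : ℂ} {n : ℤ}
    (hz : dist z (centerR ε δ n) = 1) : u z = cR + n * (b * (2 + δ)) := by
  have hd : dist (z + ((-n : ℤ) : ℂ) * (2 + δ : ℝ) * I) (centerR ε δ 0) = 1 := by
    rw [← hz, dist_eq, dist_eq]
    congr 1
    apply Complex.ext <;> simp [centerR]; ring
  have h1 := h.periodic_int (mem_closedExterior_of_dist_eq_one hε hδ (Or.inr ⟨0, rfl⟩) hd) n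
  rw [h.right _ hd] at h1
  rw [← h1]
  congr 1
  push_cast; ring

theorem eq_left (h : PeriodicSolution ε δ a b cL cR u) (hε : 0 < ε) (hδ : 0 < δ) {z : ℂ} {n : ℤ}
    (hz : dist z (centerL ε δ n) = 1) : u z = cL + n * (b * (2 + δ)) := by
  have hd : dist (z + ((-n : ℤ) : ℂ) * (2 + δ : ℝ) * I) (centerL ε δ 0) = 1 := by
    rw [← hz, dist_eq, dist_eq]
    congr 1
    apply Complex.ext <;> simp [centerL]; ring
  have h1 := h.periodic_int (mem_closedExterior_of_dist_eq_one hε hδ (Or.inl ⟨0, rfl⟩) hd) n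
  rw [h.left _ hd] at h1
  rw [← h1]
  congr 1
  push_cast; ring

/-- u - H is periodic of sublinear growth, so its values on the circles control it. There b times
the height of the center cancels the period increments of u, leaving a x with |x| ≤ 3 and b times an
offset at most 1. -/
theorem abs_sub_linearPotential_le (h : PeriodicSolution ε δ a b cL cR u) (hε : 0 < ε)
    (hε1 : ε < 1) (hδ : 0 < δ) {z : ℂ} (hz : z ∈ closedExterior ε δ) :
    |u z - linearPotential a b z - (cL + cR) / 2| ≤ |cR - cL| / 2 + 3 * (|a| + |b|) := by
  set v : ℂ → ℝ := u - linearPotential a b with hv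
  have hcont : ContinuousOn v (closedExterior ε δ) := h.cont.sub fun z _ =>
    (hasFDerivAt_linearPotential a b z).continuousAt.continuousWithinAt
  have hharm : HarmonicOnNhd v (exterior ε δ) :=
    h.harmonic.sub fun z _ => harmonicAt_linearPotential a b z
  have hper : ∀ z ∈ closedExterior ε δ, ∀ n : ℤ, v (z + n * (2 + δ : ℝ) * I) = v z := by
    intro z hz n
    simp only [hv, Pi.sub_apply, h.periodic_int hz n]
    simp [linearPotential]; ring
  have hcirc : ∀ (z c : ℂ) (n : ℤ) (k : ℝ), dist z c = 1 → c.im = n * (2 + δ) → |c.re| = 1 + ε / 2 →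
      |k - (cL + cR) / 2| = |cR - cL| / 2 → u z = k + n * (b * (2 + δ)) →
      |v z - (cL + cR) / 2| ≤ |cR - cL| / 2 + 3 * (|a| + |b|) := by
    intro z c n k hd him hre hk hu
    have h1 : |z.re - c.re| ≤ 1 := by
      rw [← hd, dist_eq, ← sub_re]; exact abs_re_le_norm _
    have h2 : |z.im - c.im| ≤ 1 := by
      rw [← hd, dist_eq, ← sub_im]; exact abs_im_le_norm _
    have h3 : |z.re| ≤ 3 := by
      have := abs_sub_abs_le_abs_sub z.re c.re
      linarith
    have h4 : v z - (cL + cR) / 2 =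
        (k - (cL + cR) / 2) - a * z.re - b * (z.im - c.im) := by
      simp only [hv, Pi.sub_apply, hu, linearPotential, him]; ring
    have h5 : |a * z.re| ≤ |a| * 3 := by rw [abs_mul]; gcongr
    have h6 : |b * (z.im - c.im)| ≤ |b| * 1 := by rw [abs_mul]; gcongr
    rw [h4]
    have h7 := abs_sub (k - (cL + cR) / 2 - a * z.re) (b * (z.im - c.im))
    have h8 := abs_sub (k - (cL + cR) / 2) (a * z.re)
    have := abs_nonneg b
    linarith
  have hbd : ∀ z ∈ closedExterior ε δ, z ∉ exterior ε δ →
      |v z - (cL + cR) / 2| ≤ |cR - cL| / 2 + 3 * (|a| + |b|) := by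
    intro z hz hzE
    obtain ⟨c, ⟨n, rfl⟩ | ⟨n, rfl⟩, hd⟩ := exists_center_of_mem_diff hδ hz hzE
    · refine hcirc z _ n cL hd rfl ?_ ?_ (h.eq_left hε hδ hd)
      · rw [show (centerL ε δ n).re = -(1 + ε / 2) by simp [centerL]; ring, abs_neg,
          abs_of_pos (by linarith)]
      · rw [show cL - (cL + cR) / 2 = -((cR - cL) / 2) by ring, abs_neg, abs_div, abs_two]
    · refine hcirc z _ n cR hd rfl ?_ ?_ (h.eq_right hε hδ hd)
      · rw [show (centerR ε δ n).re = 1 + ε / 2 by simp [centerR], abs_of_pos (by linarith)]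
      · rw [show cR - (cL + cR) / 2 = (cR - cL) / 2 by ring, abs_div, abs_two]
  have h1 := le_of_le_on_circles (m := (cL + cR) / 2 + (|cR - cL| / 2 + 3 * (|a| + |b|))) hε hε1 hδ
    hcont hharm hper (fun η hη => by
      obtain ⟨C, hC⟩ := h.growth η hη
      exact ⟨C, fun z hz => (le_abs_self _).trans (hC z hz)⟩)
    (fun z hz hzE => by linarith [(abs_le.1 (hbd z hz hzE)).2]) z hz
  have h2 := le_of_le_on_circles (m := -((cL + cR) / 2) + (|cR - cL| / 2 + 3 * (|a| + |b|))) hε hε1 hδ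
    (v := -v) hcont.neg hharm.neg (fun z hz n => by simp only [Pi.neg_apply, hper z hz n])
    (fun η hη => by
      obtain ⟨C, hC⟩ := h.growth η hη
      exact ⟨C, fun z hz => (neg_le_abs _).trans (hC z hz)⟩)
    (fun z hz hzE => by
      have := (abs_le.1 (hbd z hz hzE)).1
      simp only [Pi.neg_apply]
      linarith) z hz
  simp only [hv, Pi.neg_apply, Pi.sub_apply] at h1 h2
  rw [abs_le]
  constructor <;> linarith

end PeriodicSolution

/-! ### The potential of two close disks -/

/-- The distance of the poles of the potential of two unit disks at distance `ε` from the center. -/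
def pole (ε : ℝ) : ℝ := √(ε + ε ^ 2 / 4)

/-- The difference of the values of the logarithmic potential on the two circles. -/
def logGap (ε : ℝ) : ℝ := Real.log ((2 + ε + 2 * pole ε) / (2 + ε - 2 * pole ε))

/-- The harmonic function outside the unit disks with centers `±(1 + ε / 2)` with the values
`±1 / 2` on the two circles. -/
def gapFun (ε : ℝ) (ζ : ℂ) : ℝ := (Real.log ‖pole ε + ζ‖ - Real.log ‖pole ε - ζ‖) / logGap ε

/-- The complex derivative of `gapFun`. -/
def gapDeriv (ε : ℝ) (ζ : ℂ) : ℂ := (2 * pole ε / logGap ε : ℝ) / ((pole ε : ℂ) ^ 2 - ζ ^ 2)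

section gap

variable {ε : ℝ}

theorem pole_pos (hε : 0 < ε) : 0 < pole ε := Real.sqrt_pos.2 (by positivity)

theorem pole_sq (hε : 0 < ε) : pole ε ^ 2 = ε + ε ^ 2 / 4 := Real.sq_sqrt (by positivity)

theorem two_pole_lt (hε : 0 < ε) : 2 * pole ε < 2 + ε := by
  have := pole_sq hε
  nlinarith [pole_pos hε]

/-- From x ≤ sinh x: since (2 + ε)² - 4p² = 4, the hyperbolic sine of `logGap` is exactly p(2 + ε).
-/
theorem logGap_le (hε : 0 < ε) : logGap ε ≤ pole ε * (2 + ε) := by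
  have hp := pole_pos hε
  have h2 := two_pole_lt hε
  have hx : 1 ≤ (2 + ε + 2 * pole ε) / (2 + ε - 2 * pole ε) := by
    rw [one_le_div (by linarith)]; linarith
  have h3 : logGap ε ≤ Real.sinh (logGap ε) := Real.self_le_sinh_iff.2 (Real.log_nonneg hx)
  refine h3.trans (le_of_eq ?_)
  rw [logGap, Real.sinh_log (by linarith), inv_div]
  have h4 : 2 + ε - 2 * pole ε ≠ 0 := by linarith
  have h5 : 2 + ε + 2 * pole ε ≠ 0 := by linarith
  have h6 : (2 + ε + 2 * pole ε) * (2 + ε - 2 * pole ε) = 4 := by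
    linear_combination -4 * pole_sq hε
  field_simp
  linear_combination (-pole ε * (2 + ε) * 2) * h6

/-- `logGap` is log((1 + t)/(1 - t)) with t = 2p/(2 + ε); the first term 2t of the positive series
is a lower bound. -/
theorem le_logGap (hε : 0 < ε) : 4 * pole ε / (2 + ε) ≤ logGap ε := by
  have hp := pole_pos hε
  have h2 := two_pole_lt hε
  set t := 2 * pole ε / (2 + ε) with ht
  have ht0 : 0 < t := by positivity
  have ht1 : t < 1 := by rw [ht, div_lt_one (by linarith)]; exact h2
  have hs := Real.hasSum_log_sub_log_of_abs_lt_one (x := t) (by rwa [abs_of_pos ht0])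
  have h3 := le_hasSum hs 0 fun k _ => by positivity
  have h4 : logGap ε = Real.log (1 + t) - Real.log (1 - t) := by
    rw [← Real.log_div (by linarith) (by linarith), logGap, ht]
    congr 1
    have : 2 + ε - 2 * pole ε ≠ 0 := by linarith
    field_simp
  rw [h4]
  refine le_trans (le_of_eq ?_) h3
  rw [ht]; norm_num; ring

theorem logGap_pos (hε : 0 < ε) : 0 < logGap ε :=
  lt_of_lt_of_le (by have := pole_pos hε; positivity) (le_logGap hε)

/-- The error O(ε) matters: multiplied by the singular factor, which is at most of order 1/ε, it
stays bounded. -/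
theorem abs_two_pole_div_logGap_sub_one_le (hε : 0 < ε) :
    |2 * pole ε / logGap ε - 1| ≤ ε / 2 := by
  have hp := pole_pos hε
  have h1 := logGap_le hε
  have h2 := le_logGap hε
  have h3 := logGap_pos hε
  rw [div_le_iff₀ (by linarith)] at h2
  rw [abs_le]
  constructor
  · rw [le_sub_iff_add_le, le_div_iff₀ h3]
    nlinarith [mul_pos hε hp, mul_pos (mul_pos hε hp) hε]
  · rw [sub_le_iff_le_add, div_le_iff₀ h3]
    linarith

theorem normSq_pole_add (ζ : ℂ) (s : ℝ) :
    ‖(pole ε : ℂ) + s * ζ‖ ^ 2 = (pole ε + s * ζ.re) ^ 2 + (s * ζ.im) ^ 2 := by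
  rw [← normSq_eq_norm_sq, normSq_apply]
  simp; ring

theorem normSq_pole_add_one (ζ : ℂ) :
    ‖(pole ε : ℂ) + ζ‖ ^ 2 = (pole ε + ζ.re) ^ 2 + ζ.im ^ 2 := by
  simpa using normSq_pole_add ζ 1

theorem normSq_pole_sub (ζ : ℂ) :
    ‖(pole ε : ℂ) - ζ‖ ^ 2 = (pole ε - ζ.re) ^ 2 + ζ.im ^ 2 := by
  simpa [sub_eq_add_neg] using normSq_pole_add ζ (-1)

theorem gapFun_neg (ζ : ℂ) : gapFun ε (-ζ) = -gapFun ε ζ := by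
  rw [gapFun, gapFun, sub_neg_eq_add, ← sub_eq_add_neg]; ring

theorem pole_sub_ne_zero (hε : 0 < ε) {ζ : ℂ} (hR : 1 ≤ (ζ.re - (1 + ε / 2)) ^ 2 + ζ.im ^ 2) :
    (pole ε : ℂ) - ζ ≠ 0 := by
  intro h
  have h1 : ζ = pole ε := (sub_eq_zero.1 h).symm
  rw [h1] at hR
  have := pole_sq hε
  have := two_pole_lt hε
  have := pole_pos hε
  simp only [ofReal_re, ofReal_im] at hR
  nlinarith

theorem pole_add_ne_zero (hε : 0 < ε) {ζ : ℂ} (hL : 1 ≤ (ζ.re + (1 + ε / 2)) ^ 2 + ζ.im ^ 2) :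
    (pole ε : ℂ) + ζ ≠ 0 := by
  have := pole_sub_ne_zero (ζ := -ζ) hε (by simp only [neg_re, neg_im]; nlinarith)
  rwa [sub_neg_eq_add] at this

theorem gapFun_eq_log (ζ : ℂ) (hp : (pole ε : ℂ) + ζ ≠ 0) (hm : (pole ε : ℂ) - ζ ≠ 0) :
    gapFun ε ζ = Real.log (‖(pole ε : ℂ) + ζ‖ ^ 2 / ‖(pole ε : ℂ) - ζ‖ ^ 2) / (2 * logGap ε) := by
  have h1 : ‖(pole ε : ℂ) + ζ‖ ≠ 0 := norm_ne_zero_iff.2 hp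
  have h2 : ‖(pole ε : ℂ) - ζ‖ ≠ 0 := norm_ne_zero_iff.2 hm
  rw [Real.log_div (by positivity) (by positivity), Real.log_pow, Real.log_pow, gapFun]
  push_cast
  rw [← mul_sub, mul_div_mul_left _ _ two_ne_zero]

theorem gapFun_le (hε : 0 < ε) {ζ : ℂ} (hR : 1 ≤ (ζ.re - (1 + ε / 2)) ^ 2 + ζ.im ^ 2)
    (hL : 1 ≤ (ζ.re + (1 + ε / 2)) ^ 2 + ζ.im ^ 2) : gapFun ε ζ ≤ 1 / 2 := by
  have hm := pole_sub_ne_zero hε hR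
  have hp := pole_add_ne_zero hε hL
  have h1 : 0 < ‖(pole ε : ℂ) + ζ‖ := norm_pos_iff.2 hp
  have h2 : 0 < ‖(pole ε : ℂ) - ζ‖ := norm_pos_iff.2 hm
  have h3 := logGap_pos hε
  have h4 := two_pole_lt hε
  rw [gapFun_eq_log ζ hp hm, div_le_div_iff₀ (by positivity) two_pos]
  suffices Real.log (‖(pole ε : ℂ) + ζ‖ ^ 2 / ‖(pole ε : ℂ) - ζ‖ ^ 2) ≤ logGap ε by linarith
  refine Real.log_le_log (by positivity) ?_
  rw [div_le_div_iff₀ (by positivity) (by linarith), normSq_pole_add_one, normSq_pole_sub]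
  have h5 : 0 ≤ pole ε * ((ζ.re - (1 + ε / 2)) ^ 2 + ζ.im ^ 2 - 1) :=
    mul_nonneg (pole_pos hε).le (by linarith)
  nlinarith [pole_sq hε]

/-- On the right circle |ζ|² = (2 + ε)x - p², so |p ± ζ|² = x(2 + ε ± 2p) and the quotient of the
two is constant. -/
theorem gapFun_eq (hε : 0 < ε) {ζ : ℂ} (hR : (ζ.re - (1 + ε / 2)) ^ 2 + ζ.im ^ 2 = 1)
    (hL : 1 ≤ (ζ.re + (1 + ε / 2)) ^ 2 + ζ.im ^ 2) : gapFun ε ζ = 1 / 2 := by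
  have hm := pole_sub_ne_zero hε hR.ge
  have hp := pole_add_ne_zero hε hL
  have h2 : 0 < ‖(pole ε : ℂ) - ζ‖ := norm_pos_iff.2 hm
  have h3 := logGap_pos hε
  have h4 := two_pole_lt hε
  rw [gapFun_eq_log ζ hp hm]
  have : ‖(pole ε : ℂ) + ζ‖ ^ 2 / ‖(pole ε : ℂ) - ζ‖ ^ 2 =
      (2 + ε + 2 * pole ε) / (2 + ε - 2 * pole ε) := by
    rw [div_eq_div_iff (by positivity) (by linarith), normSq_pole_add_one, normSq_pole_sub]
    linear_combination (-4 * pole ε) * hR + (-4 * pole ε) * pole_sq hε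
  rw [this, ← logGap]
  field_simp

theorem abs_gapFun_le (hε : 0 < ε) {ζ : ℂ} (hR : 1 ≤ (ζ.re - (1 + ε / 2)) ^ 2 + ζ.im ^ 2)
    (hL : 1 ≤ (ζ.re + (1 + ε / 2)) ^ 2 + ζ.im ^ 2) : |gapFun ε ζ| ≤ 1 / 2 := by
  refine abs_le'.2 ⟨gapFun_le hε hR hL, ?_⟩
  rw [← gapFun_neg]
  refine gapFun_le hε ?_ ?_ <;> simp only [neg_re, neg_im] <;> nlinarith

/-- Dividing F by its value at z puts the argument of the complex logarithm at 1, away from the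
branch cut. -/
theorem hasGradientAt_log_norm {F : ℂ → ℂ} {F' z : ℂ} (h : HasDerivAt F F' z) (hz : F z ≠ 0) :
    HasGradientAt (fun w => Real.log ‖F w‖) (conj (F' / F z)) z := by
  have h1 : HasDerivAt (fun w => Complex.log (F w / F z)) (F' / F z) z := by
    have := (h.div_const (F z)).clog (by rw [div_self hz]; exact one_mem_slitPlane)
    rwa [div_self hz, div_one] at this
  have h2 := hasGradientAt_re (h1.add_const ((Real.log ‖F z‖ : ℝ) : ℂ))
  refine h2.congr_of_eventuallyEq ?_
  filter_upwards [h.continuousAt.eventually_ne hz] with w hw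
  rw [add_re, log_re, ofReal_re, norm_div, Real.log_div (norm_ne_zero_iff.2 hw)
    (norm_ne_zero_iff.2 hz), sub_add_cancel]

theorem harmonicAt_gapFun_comp {ζ : ℂ → ℂ} {z : ℂ} (hζ : AnalyticAt ℂ ζ z)
    (hp : (pole ε : ℂ) + ζ z ≠ 0) (hm : (pole ε : ℂ) - ζ z ≠ 0) :
    HarmonicAt (fun w => gapFun ε (ζ w)) z := by
  have h1 := AnalyticAt.harmonicAt_log_norm (analyticAt_const.add hζ) hp
  have h2 := AnalyticAt.harmonicAt_log_norm (analyticAt_const.sub hζ) hm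
  convert (h1.sub h2).const_smul (c := (logGap ε)⁻¹) using 1
  ext w
  simp [gapFun, div_eq_inv_mul]

theorem hasGradientAt_gapFun_comp {ζ : ℂ → ℂ} {ζ' z : ℂ} (hζ : HasDerivAt ζ ζ' z)
    (hp : (pole ε : ℂ) + ζ z ≠ 0) (hm : (pole ε : ℂ) - ζ z ≠ 0) :
    HasGradientAt (fun w => gapFun ε (ζ w)) (conj (gapDeriv ε (ζ z) * ζ')) z := by
  have h1 := (hasGradientAt_log_norm (hζ.const_add (pole ε : ℂ)) hp).hasFDerivAt
  have h2 := (hasGradientAt_log_norm (hζ.const_sub (pole ε : ℂ)) hm).hasFDerivAt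
  rw [hasGradientAt_iff_hasFDerivAt]
  have h3 : HasFDerivAt (fun w => gapFun ε (ζ w)) _ z := (h1.sub h2).mul_const (logGap ε)⁻¹
  refine h3.congr_fderiv ?_
  rw [← map_sub, ← map_sub]
  have h4 : (gapDeriv ε (ζ z) * ζ') =
      ((logGap ε)⁻¹ : ℝ) * (ζ' / (pole ε + ζ z) - -ζ' / (pole ε - ζ z)) := by
    have h5 : (pole ε : ℂ) ^ 2 - ζ z ^ 2 = (pole ε + ζ z) * (pole ε - ζ z) := by ring
    rw [gapDeriv, h5]
    push_cast
    field_simp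
    ring
  rw [h4]
  ext v
  simp
  ring

end gap

/-! ### The gradient near the gap between two disks -/

/-- 1 - √(1 - η²) = η²/(1 + √(1 - η²)), and the root is at least 1/2 for η² < 3/4. -/
theorem abs_re_le_of_narrow {ε ξ η : ℝ} (hξ : |ξ| < 1 + ε / 2 - √(1 - η ^ 2)) (hη : |η| < √3 / 2) :
    η ^ 2 < 3 / 4 ∧ |ξ| ≤ ε / 2 + 2 / 3 * η ^ 2 := by
  have h1 : η ^ 2 < 3 / 4 := by
    have h3 : √3 ^ 2 = 3 := Real.sq_sqrt (by norm_num)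
    rw [← sq_abs]
    nlinarith [abs_nonneg η]
  refine ⟨h1, ?_⟩
  have ht : √(1 - η ^ 2) ^ 2 = 1 - η ^ 2 := Real.sq_sqrt (by linarith)
  have ht2 : 1 / 2 ≤ √(1 - η ^ 2) := Real.le_sqrt_of_sq_le (by linarith)
  have ht3 : √(1 - η ^ 2) ≤ 1 := Real.sqrt_le_one.2 (by linarith [sq_nonneg η])
  nlinarith

/-- The asymptotic form of the potential of two close disks in the gap between them. -/
theorem norm_gapDeriv_sub_le {ε : ℝ} (hε : 0 < ε) (hε4 : ε ≤ 1 / 4) {ζ : ℂ}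
    (hξ : |ζ.re| < 1 + ε / 2 - √(1 - ζ.im ^ 2)) (hη : |ζ.im| < √3 / 2) :
    ‖gapDeriv ε ζ - (1 / (ε + ζ.im ^ 2) + 2 * ζ.re * ζ.im / (ε + ζ.im ^ 2) ^ 2 * I)‖ ≤ 15 := by
  obtain ⟨h34, hx⟩ := abs_re_le_of_narrow hξ hη
  set ξ := ζ.re with hξd
  set η := ζ.im with hηd
  set s := ε + η ^ 2 with hs
  have hη0 := sq_nonneg η
  have hs0 : 0 < s := by positivity
  have hs1 : s ≤ 1 := by linarith
  have hxs : |ξ| ≤ s := by linarith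
  have hηs : η ^ 2 ≤ s := by linarith
  have hη1 : |η| ≤ 1 := by rw [← sq_le_one_iff_abs_le_one]; linarith
  have hξ2 : ξ ^ 2 ≤ (ε / 2 + 2 / 3 * η ^ 2) ^ 2 := by
    rw [← sq_abs]; gcongr
  have hξ2s : ξ ^ 2 ≤ s ^ 2 := by rw [← sq_abs]; gcongr
  set D : ℂ := (pole ε : ℂ) ^ 2 - ζ ^ 2 with hD
  have hp2 : (pole ε : ℂ) ^ 2 = ε + ε ^ 2 / 4 := by
    rw [← ofReal_pow, pole_sq hε]; push_cast; ring
  have hDre : D.re = ε + ε ^ 2 / 4 - (ξ ^ 2 - η ^ 2) := by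
    rw [hD, ← ofReal_pow, pole_sq hε, sub_re, ofReal_re, pow_two ζ, mul_re]; ring
  have hDs : s / 2 ≤ ‖D‖ := by
    refine le_trans ?_ (re_le_norm D)
    rw [hDre]
    nlinarith
  have hD0 : D ≠ 0 := norm_pos_iff.1 (lt_of_lt_of_le (by positivity) hDs)
  have hsC : (s : ℂ) ≠ 0 := ofReal_ne_zero.2 hs0.ne'
  -- The denominator p² - ζ² is s + e, where |ξ| ≤ s and |η| ≤ √s make the real part of e of order
  -- s² and its imaginary part of order s^(3/2).
  set e : ℂ := ((ε ^ 2 / 4 - ξ ^ 2 : ℝ) : ℂ) - 2 * ξ * η * I with he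
  have hDe : D = s + e := by
    have hz : ζ = ξ + η * I := (re_add_im ζ).symm
    rw [hD, hp2, he, hs, hz]
    push_cast
    linear_combination (-(η : ℂ) ^ 2) * I_sq
  have hed : |ε ^ 2 / 4 - ξ ^ 2| ≤ s ^ 2 := by
    rw [abs_le]; constructor
    · nlinarith
    · nlinarith [sq_nonneg ξ]
  have hcross : ‖(2 * ξ * η * I : ℂ)‖ ≤ 2 * s * |η| := by
    simp only [norm_mul, norm_I, mul_one, norm_real, norm_ofNat, Real.norm_eq_abs]
    gcongr
  have hen : ‖e‖ ≤ s ^ 2 + 2 * s * |η| := by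
    rw [he]
    refine (norm_sub_le _ _).trans (add_le_add ?_ hcross)
    rwa [norm_real, Real.norm_eq_abs]
  -- Second order expansion of 1/(s + e). Only the contribution of 2ξηi to the linear term is kept;
  -- the numerator left is of order s³, as is the denominator.
  have hident : 1 / D - (1 / (s : ℂ) + 2 * ξ * η / (s : ℂ) ^ 2 * I) =
      (-(s : ℂ) * ((ε ^ 2 / 4 - ξ ^ 2 : ℝ) : ℂ) - 2 * ξ * η * I * e) / ((s : ℂ) ^ 2 * D) := by
    have h1 : (s : ℂ) + e ≠ 0 := hDe ▸ hD0
    rw [hDe]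
    field_simp
    rw [he]
    ring_nf
  have hmain : ‖1 / D - (1 / (s : ℂ) + 2 * ξ * η / (s : ℂ) ^ 2 * I)‖ ≤ 14 := by
    rw [hident, norm_div, div_le_iff₀ (norm_pos_iff.2 (by positivity)), norm_mul, norm_pow, norm_real,
      Real.norm_of_nonneg hs0.le]
    have h1 : ‖-(s : ℂ) * ((ε ^ 2 / 4 - ξ ^ 2 : ℝ) : ℂ)‖ ≤ s * s ^ 2 := by
      rw [norm_mul, norm_neg, norm_real, norm_real, Real.norm_of_nonneg hs0.le, Real.norm_eq_abs]
      gcongr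
    have h2 : ‖2 * ξ * η * I * e‖ ≤ 2 * s * |η| * (s ^ 2 + 2 * s * |η|) := by
      rw [norm_mul]; gcongr
    have h3 : 2 * s * |η| * (s ^ 2 + 2 * s * |η|) ≤ 6 * s ^ 3 := by
      have h4 : |η| ^ 2 ≤ s := by rwa [sq_abs]
      have h5 : s ^ 3 * |η| ≤ s ^ 3 * 1 := by gcongr
      have h6 : s ^ 2 * |η| ^ 2 ≤ s ^ 2 * s := by gcongr
      nlinarith
    calc _ ≤ s * s ^ 2 + 6 * s ^ 3 := (norm_sub_le _ _).trans (add_le_add h1 (h2.trans h3))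
      _ = 14 * (s ^ 2 * (s / 2)) := by ring
      _ ≤ 14 * (s ^ 2 * ‖D‖) := by gcongr
  have hB : ‖((2 * pole ε / logGap ε - 1 : ℝ) : ℂ) / D‖ ≤ 1 := by
    rw [norm_div, norm_real, Real.norm_eq_abs, div_le_one (norm_pos_iff.2 hD0)]
    refine (abs_two_pole_div_logGap_sub_one_le hε).trans (le_trans ?_ hDs)
    linarith
  have hsplit : gapDeriv ε ζ - (1 / ((ε : ℂ) + η ^ 2) + 2 * ξ * η / ((ε : ℂ) + η ^ 2) ^ 2 * I) =
      ((2 * pole ε / logGap ε - 1 : ℝ) : ℂ) / D +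
        (1 / D - (1 / (s : ℂ) + 2 * ξ * η / (s : ℂ) ^ 2 * I)) := by
    rw [gapDeriv, ← hD, hs]
    push_cast
    ring
  rw [hsplit]
  exact (norm_add_le _ _).trans (by linarith)

/-- In a neighbourhood of `z` that meets only the two disks with centers `m ± e(1 + ε' / 2)`, the
gradient of `u` is that of the potential of these two disks, up to a bounded remainder. -/
theorem norm_gradient_sub_gapDeriv_le {ε δ ε' k V M : ℝ} (hδ : 0 < δ) (hε' : 0 < ε') {u : ℂ → ℝ}
    {m e z : ℂ} (he : ‖e‖ = 1) (hcont : ContinuousOn u (closedExterior ε δ))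
    (hharm : HarmonicOnNhd u (exterior ε δ)) (hz : z ∈ exterior ε δ)
    (h₁ : m - e * (1 + ε' / 2 : ℝ) ∈ centers ε δ) (h₂ : m + e * (1 + ε' / 2 : ℝ) ∈ centers ε δ)
    (hu₁ : ∀ y, dist y (m - e * (1 + ε' / 2 : ℝ)) = 1 → u y = k - V / 2)
    (hu₂ : ∀ y, dist y (m + e * (1 + ε' / 2 : ℝ)) = 1 → u y = k + V / 2)
    (hfar : ∀ c ∈ centers ε δ, c ≠ m - e * (1 + ε' / 2 : ℝ) → c ≠ m + e * (1 + ε' / 2 : ℝ) →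
      6 / 5 < dist z c)
    (hM : ∀ y ∈ closedExterior ε δ, dist y z ≤ 1 / 5 → |u y - k| ≤ M) :
    ‖gradient u z - V * (e * conj (gapDeriv ε' (e⁻¹ * (z - m))))‖ ≤
      gradConst (1 / 5) * (M + |V| / 2) := by
  have he0 : e ≠ 0 := norm_pos_iff.1 (by rw [he]; exact one_pos)
  set ζ : ℂ → ℂ := fun y => e⁻¹ * (y - m) with hζ
  have hdist : ∀ (y : ℂ) (s : ℝ), dist y (m + e * s) ^ 2 = ((ζ y).re - s) ^ 2 + (ζ y).im ^ 2 := by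
    intro y s
    have : y - (m + e * s) = e * (ζ y - s) := by
      simp only [hζ]; field_simp; ring
    rw [dist_eq, this, norm_mul, he, one_mul, ← normSq_eq_norm_sq, normSq_apply]
    simp; ring
  have hd₂ : ∀ y, dist y (m + e * (1 + ε' / 2 : ℝ)) ^ 2 =
      ((ζ y).re - (1 + ε' / 2)) ^ 2 + (ζ y).im ^ 2 := fun y => hdist y _
  have hd₁ : ∀ y, dist y (m - e * (1 + ε' / 2 : ℝ)) ^ 2 =
      ((ζ y).re + (1 + ε' / 2)) ^ 2 + (ζ y).im ^ 2 := fun y => by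
    have := hdist y (-(1 + ε' / 2))
    rw [sub_neg_eq_add] at this
    rw [← this, ofReal_neg, mul_neg, sub_eq_add_neg]
  have hR : ∀ y ∈ closedExterior ε δ, 1 ≤ ((ζ y).re - (1 + ε' / 2)) ^ 2 + (ζ y).im ^ 2 :=
    fun y hy => by rw [← hd₂]; exact one_le_pow₀ (hy _ h₂)
  have hL : ∀ y ∈ closedExterior ε δ, 1 ≤ ((ζ y).re + (1 + ε' / 2)) ^ 2 + (ζ y).im ^ 2 :=
    fun y hy => by rw [← hd₁]; exact one_le_pow₀ (hy _ h₁)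
  have hζa : ∀ y, AnalyticAt ℂ ζ y := fun y => by rw [hζ]; fun_prop
  have hgh : ∀ y ∈ closedExterior ε δ, HarmonicAt (fun w => gapFun ε' (ζ w)) y := fun y hy =>
    harmonicAt_gapFun_comp (hζa y) (pole_add_ne_zero hε' (hL y hy)) (pole_sub_ne_zero hε' (hR y hy))
  -- The unit factor e turns the gap into the standard position, and k is the mean of the two
  -- boundary values, so w vanishes on both circles.
  set w : ℂ → ℝ := (u - fun _ => k) - V • (fun y => gapFun ε' (ζ y)) with hw
  have hwv : ∀ y, w y = u y - k - V * gapFun ε' (ζ y) := fun y => rfl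
  have hvan : VanishesNear ε δ w z (1 / 5) (M + |V| / 2) := by
    refine ⟨?_, ?_, ?_, ?_⟩
    · refine ((hcont.sub continuousOn_const).sub (ContinuousOn.const_smul (fun y hy => ?_) V)).mono
        inter_subset_left
      exact (hgh y hy).1.continuousAt.continuousWithinAt
    · refine HarmonicOnNhd.mono ?_ inter_subset_left
      have hconst : HarmonicOnNhd (fun _ : ℂ => k) (exterior ε δ) := fun y _ => by
        simp
      exact (hharm.sub hconst).sub (HarmonicOnNhd.const_smul fun y hy =>
        hgh y (exterior_subset hδ hy))
    · rintro y ⟨hyK, hyz⟩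
      rw [hwv]
      have h1 := hM y hyK hyz
      have h2 := abs_gapFun_le hε' (hR y hyK) (hL y hyK)
      have h3 : |V * gapFun ε' (ζ y)| ≤ |V| * (1 / 2) := by rw [abs_mul]; gcongr
      have h4 := abs_sub (u y - k) (V * gapFun ε' (ζ y))
      linarith
    · rintro y ⟨hyK, hyz⟩ hyE
      obtain ⟨c, hc, hyc⟩ := exists_center_of_mem_diff hδ hyK hyE
      rw [hwv]
      rcases eq_or_ne c (m - e * (1 + ε' / 2 : ℝ)) with rfl | hne₁
      · have h1 : gapFun ε' (ζ y) = -(1 / 2) := by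
          rw [← neg_neg (gapFun ε' (ζ y)), ← gapFun_neg, gapFun_eq hε']
          · have := hd₁ y
            rw [hyc] at this
            simp only [neg_re, neg_im]
            linarith
          · have := hR y hyK
            simp only [neg_re, neg_im]
            linarith
        rw [hu₁ y hyc, h1]; ring
      · rcases eq_or_ne c (m + e * (1 + ε' / 2 : ℝ)) with rfl | hne₂
        · have h1 : gapFun ε' (ζ y) = 1 / 2 := by
            refine gapFun_eq hε' ?_ (hL y hyK)
            rw [← hd₂, hyc, one_pow]
          rw [hu₂ y hyc, h1]; ring
        -- Within 1/5 of z no third circle occurs, since its center is farther than 6/5 = 1 + 1/5.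
        · exfalso
          have h1 := hfar c hc hne₁ hne₂
          have h2 := dist_triangle z y c
          rw [mem_closedBall] at hyz
          rw [dist_comm z y] at h2
          linarith
  have hgrad := hvan.norm_gradient_le hδ (by norm_num) hz
  have hzK := exterior_subset hδ hz
  have hζd : HasDerivAt ζ e⁻¹ z := by
    simpa using ((hasDerivAt_id z).sub_const m).const_mul e⁻¹
  have hgq := hasGradientAt_gapFun_comp hζd (pole_add_ne_zero hε' (hL z hzK))
    (pole_sub_ne_zero hε' (hR z hzK))
  have hud : DifferentiableAt ℝ u z := (hharm z hz).1.differentiableAt two_ne_zero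
  have hwg : gradient w z = gradient u z - V * (e * conj (gapDeriv ε' (e⁻¹ * (z - m)))) := by
    refine HasGradientAt.gradient ?_
    rw [hasGradientAt_iff_hasFDerivAt]
    have h1 : HasFDerivAt w _ z := (hud.hasFDerivAt.sub_const k).sub (hgq.hasFDerivAt.const_smul V)
    refine h1.congr_fderiv ?_
    have hec : conj e⁻¹ = e := by
      rw [map_inv₀, inv_eq_of_mul_eq_one_left]
      rw [mul_conj, normSq_eq_norm_sq, he]; simp
    rw [map_mul, hec, map_sub, toDual_gradient]
    congr 1
    rw [mul_comm (conj _) e, ← real_smul, map_smulₛₗ]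
    rfl
  rw [← hwg]
  exact hgrad

/-! ### The gradient in the narrow regions -/

theorem lt_dist_of_sq_lt {z c : ℂ} (h : 36 / 25 < (z.re - c.re) ^ 2 + (z.im - c.im) ^ 2) :
    6 / 5 < dist z c := by
  rw [dist_eq_re_im]
  exact Real.lt_sqrt_of_sq_lt (by norm_num; linarith)

/-- A point of the gap between two unit disks is outside of both. -/
theorem one_lt_of_narrow {ε ξ η : ℝ} (hξ : |ξ| < 1 + ε / 2 - √(1 - η ^ 2)) (hη : |η| < √3 / 2) :
    1 < (ξ - (1 + ε / 2)) ^ 2 + η ^ 2 ∧ 1 < (ξ + (1 + ε / 2)) ^ 2 + η ^ 2 := by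
  obtain ⟨h34, -⟩ := abs_re_le_of_narrow hξ hη
  have ht : √(1 - η ^ 2) ^ 2 = 1 - η ^ 2 := Real.sq_sqrt (by linarith)
  have ht0 := Real.sqrt_nonneg (1 - η ^ 2)
  have h1 := le_abs_self ξ
  have h2 := neg_le_abs ξ
  constructor <;> nlinarith

/-- A point of the gap between two unit disks is far from the disks of a parallel gap. -/
theorem far_of_narrow {ε ξ η t s : ℝ} (hξ : |ξ| < 1 + ε / 2 - √(1 - η ^ 2)) (hη : |η| < √3 / 2)
    (hs : |s| = 1 + ε / 2) (ht : 2 ≤ |t|) : 36 / 25 < (ξ - s) ^ 2 + (η - t) ^ 2 := by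
  obtain ⟨h34, -⟩ := abs_re_le_of_narrow hξ hη
  have hr : √(1 - η ^ 2) ^ 2 = 1 - η ^ 2 := Real.sq_sqrt (by linarith)
  have hr0 := Real.sqrt_nonneg (1 - η ^ 2)
  have h1 : √(1 - η ^ 2) ≤ |ξ - s| := by
    have := abs_sub_abs_le_abs_sub s ξ
    rw [abs_sub_comm] at this
    linarith
  have h7 : |η| < 87 / 100 := by
    have h3 : √3 ^ 2 = 3 := Real.sq_sqrt (by norm_num)
    nlinarith [Real.sqrt_nonneg 3]
  have h2 : 2 - |η| ≤ |η - t| := by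
    have := abs_sub_abs_le_abs_sub t η
    rw [abs_sub_comm] at this
    linarith
  have h3 : √(1 - η ^ 2) ^ 2 ≤ |ξ - s| ^ 2 := by gcongr
  have h4 : (2 - |η|) ^ 2 ≤ |η - t| ^ 2 := by gcongr; linarith
  rw [sq_abs] at h3 h4
  have h5 := sq_abs η
  nlinarith

theorem two_le_abs_mul_period {δ : ℝ} (hδ : 0 < δ) {n : ℤ} (hn : n ≠ 0) :
    2 ≤ |(n : ℝ) * (2 + δ)| := by
  have h1 : (1 : ℝ) ≤ |(n : ℝ)| := by
    rw [← Int.cast_abs]; exact_mod_cast Int.one_le_abs hn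
  rw [abs_mul, abs_of_pos (by linarith : 0 < 2 + δ)]
  nlinarith

theorem centerL_re_abs {ε δ : ℝ} (hε : 0 < ε) (n : ℤ) : |(centerL ε δ n).re| = 1 + ε / 2 := by
  rw [show (centerL ε δ n).re = -(1 + ε / 2) by simp [centerL]; ring, abs_neg,
    abs_of_pos (by linarith)]

theorem centerR_re_abs {ε δ : ℝ} (hε : 0 < ε) (n : ℤ) : |(centerR ε δ n).re| = 1 + ε / 2 :=
  abs_of_pos (by simp only [centerR]; linarith)

theorem far_of_mem_narrowV {ε δ : ℝ} (hε : 0 < ε) (hδ : 0 < δ) {z : ℂ} (hz : z ∈ narrowV ε) {c : ℂ}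
    (hc : c ∈ centers ε δ) (hL : c ≠ centerL ε δ 0) (hR : c ≠ centerR ε δ 0) : 6 / 5 < dist z c := by
  apply lt_dist_of_sq_lt
  rcases hc with ⟨n, rfl⟩ | ⟨n, rfl⟩
  · exact far_of_narrow hz.1 hz.2 (centerL_re_abs hε n)
      (two_le_abs_mul_period hδ fun h => hL (by rw [h]))
  · exact far_of_narrow hz.1 hz.2 (centerR_re_abs hε n)
      (two_le_abs_mul_period hδ fun h => hR (by rw [h]))

theorem narrowV_subset_exterior {ε δ : ℝ} (hδ : 0 < δ) : narrowV ε ⊆ exterior ε δ := by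
  intro z hz
  obtain ⟨h1, h2⟩ := one_lt_of_narrow hz.1 hz.2
  obtain ⟨h34, -⟩ := abs_re_le_of_narrow hz.1 hz.2
  refine mem_exterior_of_abs_im_le hδ ?_ (by rwa [show z.re - (-1 - ε / 2) = z.re + (1 + ε / 2) by ring])
    h1
  have : |z.im| ≤ 1 := by rw [← sq_le_one_iff_abs_le_one]; linarith
  linarith

theorem far_of_mul_I {ε δ : ℝ} (hε : 0 < ε) (hδ : 0 < δ) {y : ℝ} (hy : |y| ≤ 1 + δ / 2) {c : ℂ}
    (hc : c ∈ centers ε δ) (hL : c ≠ centerL ε δ 0) (hR : c ≠ centerR ε δ 0) :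
    6 / 5 < dist (y * I) c := by
  have key : ∀ (n : ℤ) (x : ℝ), n ≠ 0 → |x| = 1 + ε / 2 →
      36 / 25 < (0 - x) ^ 2 + (y - n * (2 + δ)) ^ 2 := by
    intro n x hn hx
    have h1 := abs_im_sub_ge hδ hy hn
    rw [zero_sub, neg_sq, ← sq_abs x, hx, ← sq_abs (y - n * (2 + δ))]
    nlinarith
  apply lt_dist_of_sq_lt
  rw [show (y * I : ℂ).re = 0 by simp, show (y * I : ℂ).im = y by simp]
  rcases hc with ⟨n, rfl⟩ | ⟨n, rfl⟩
  · exact key n _ (fun h => hL (by rw [h])) (centerL_re_abs hε n)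
  · exact key n _ (fun h => hR (by rw [h])) (centerR_re_abs hε n)

theorem abs_im_le_of_mem_narrowH {ε δ : ℝ} {z : ℂ} (hz : z ∈ narrowH ε δ) :
    |z.im - 1 - δ / 2| ≤ δ / 2 + 1 / 2 ∧ |z.re - 1 - ε / 2| < 87 / 100 := by
  obtain ⟨h34, h⟩ := abs_re_le_of_narrow hz.1 hz.2
  refine ⟨by linarith, ?_⟩
  have h3 : √3 ^ 2 = 3 := Real.sq_sqrt (by norm_num)
  nlinarith [Real.sqrt_nonneg 3, hz.2]

theorem five_halves_le_of_mem_narrowH {ε δ : ℝ} (hδ : 0 < δ) {z : ℂ} (hz : z ∈ narrowH ε δ) {n : ℤ}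
    (h0 : n ≠ 0) (h1 : n ≠ 1) : 25 / 4 ≤ (z.im - n * (2 + δ)) ^ 2 := by
  obtain ⟨hi, -⟩ := abs_im_le_of_mem_narrowH hz
  rw [abs_le] at hi
  rcases lt_or_gt_of_ne h0 with hn | hn
  · have : (n : ℝ) ≤ -1 := by exact_mod_cast (by omega : n ≤ -1)
    nlinarith [mul_nonneg (by linarith : (0:ℝ) ≤ -1 - n) (by linarith : (0:ℝ) ≤ 2 + δ)]
  · have : (2 : ℝ) ≤ n := by exact_mod_cast (by omega : 2 ≤ n)
    nlinarith [mul_nonneg (by linarith : (0:ℝ) ≤ n - 2) (by linarith : (0:ℝ) ≤ 2 + δ)]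

/-- After a quarter turn the left disks at the heights 0 and 2 + δ bound a parallel gap shifted by 2
+ ε, so `far_of_narrow` applies to them; all other disks differ in height by at least 5/2. -/
theorem far_left_of_mem_narrowH {ε δ : ℝ} (hε : 0 < ε) (hδ : 0 < δ) {z : ℂ} (hz : z ∈ narrowH ε δ)
    (n : ℤ) : 36 / 25 < (z.re - (-1 - ε / 2)) ^ 2 + (z.im - n * (2 + δ)) ^ 2 := by
  by_cases h : n = 0 ∨ n = 1
  · have hs : |(n : ℝ) * (2 + δ) - (1 + δ / 2)| = 1 + δ / 2 := by
      rcases h with rfl | rfl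
      · rw [Int.cast_zero, zero_mul, zero_sub, abs_neg, abs_of_pos (by linarith)]
      · rw [Int.cast_one, abs_of_pos (by linarith)]; ring
    have h1 := far_of_narrow hz.1 hz.2 hs (t := -(2 + ε))
      (by rw [abs_neg, abs_of_pos (by linarith)]; linarith)
    linarith
  · push Not at h
    have := five_halves_le_of_mem_narrowH hδ hz h.1 h.2
    nlinarith [sq_nonneg (z.re - (-1 - ε / 2))]

theorem far_of_mem_narrowH {ε δ : ℝ} (hε : 0 < ε) (hδ : 0 < δ) {z : ℂ} (hz : z ∈ narrowH ε δ) {c : ℂ}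
    (hc : c ∈ centers ε δ) (h0 : c ≠ centerR ε δ 0) (h1 : c ≠ centerR ε δ 1) : 6 / 5 < dist z c := by
  apply lt_dist_of_sq_lt
  rcases hc with ⟨n, rfl⟩ | ⟨n, rfl⟩
  · exact far_left_of_mem_narrowH hε hδ hz n
  · have := five_halves_le_of_mem_narrowH (ε := ε) hδ hz (n := n) (fun h => h0 (by rw [h]))
      (fun h => h1 (by rw [h]))
    simp only [centerR]
    nlinarith [sq_nonneg (z.re - (1 + ε / 2))]

theorem narrowH_subset_exterior {ε δ : ℝ} (hε : 0 < ε) (hδ : 0 < δ) :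
    narrowH ε δ ⊆ exterior ε δ := by
  intro z hz
  obtain ⟨h1, h2⟩ := one_lt_of_narrow hz.1 hz.2
  rw [mem_exterior_iff hδ]
  intro n
  refine ⟨by linarith [far_left_of_mem_narrowH hε hδ hz n], ?_⟩
  by_cases hn0 : n = 0
  · subst hn0; push_cast; linarith
  by_cases hn1 : n = 1
  · subst hn1; push_cast; linarith
  · nlinarith [five_halves_le_of_mem_narrowH hδ hz hn0 hn1, sq_nonneg (z.re - (1 + ε / 2))]

namespace PeriodicSolution

variable {ε δ a b cL cR : ℝ} {u : ℂ → ℝ}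

/-- The gradient near the gap between the disks of the left and of the right row. -/
theorem norm_gradient_sub_le_of_far (h : PeriodicSolution ε δ a b cL cR u) (hε : 0 < ε)
    (hδ : 0 < δ) {z : ℂ} (hz : z ∈ exterior ε δ)
    (hfar : ∀ c ∈ centers ε δ, c ≠ centerL ε δ 0 → c ≠ centerR ε δ 0 → 6 / 5 < dist z c) {M : ℝ}
    (hM : ∀ y ∈ closedExterior ε δ, dist y z ≤ 1 / 5 → |u y - (cL + cR) / 2| ≤ M) :
    ‖gradient u z - (cR - cL : ℝ) * conj (gapDeriv ε z)‖ ≤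
      gradConst (1 / 5) * (M + |cR - cL| / 2) := by
  have e1 : (0 : ℂ) - 1 * (1 + ε / 2 : ℝ) = centerL ε δ 0 := by
    apply Complex.ext <;> simp [centerL]; ring
  have e2 : (0 : ℂ) + 1 * (1 + ε / 2 : ℝ) = centerR ε δ 0 := by
    apply Complex.ext <;> simp [centerR]
  have := norm_gradient_sub_gapDeriv_le (V := cR - cL) (m := 0) (e := 1) hδ hε (by simp) h.cont
    h.harmonic hz (e1 ▸ Or.inl ⟨0, rfl⟩) (e2 ▸ Or.inr ⟨0, rfl⟩)
    (fun y hy => by rw [h.left y (e1 ▸ hy)]; ring) (fun y hy => by rw [h.right y (e2 ▸ hy)]; ring)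
    (fun c hc h1 h2 => hfar c hc (e1 ▸ h1) (e2 ▸ h2)) hM
  simpa using this

theorem abs_sub_le_of_abs_le (h : PeriodicSolution ε δ a b cL cR u) (hε : 0 < ε) (hε1 : ε < 1)
    (hδ : 0 < δ) {y : ℂ} (hy : y ∈ closedExterior ε δ) {t : ℝ} (hre : |y.re| ≤ t) (him : |y.im| ≤ t) :
    |u y - (cL + cR) / 2| ≤ |cR - cL| / 2 + (3 + t) * (|a| + |b|) := by
  have h1 := h.abs_sub_linearPotential_le hε hε1 hδ hy
  have h2 : |linearPotential a b y| ≤ |a| * t + |b| * t := by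
    rw [linearPotential]
    refine (abs_add_le _ _).trans ?_
    rw [abs_mul, abs_mul]
    gcongr
  have h3 := abs_add_le (u y - linearPotential a b y - (cL + cR) / 2) (linearPotential a b y)
  rw [show u y - linearPotential a b y - (cL + cR) / 2 + linearPotential a b y =
    u y - (cL + cR) / 2 by ring] at h3
  linarith

theorem norm_gradient_sub_le (h : PeriodicSolution ε δ a b cL cR u) (hε : 0 < ε) (hε1 : ε < 1)
    (hδ : 0 < δ) {z : ℂ} (hz : z ∈ exterior ε δ)
    (hfar : ∀ c ∈ centers ε δ, c ≠ centerL ε δ 0 → c ≠ centerR ε δ 0 → 6 / 5 < dist z c)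
    (hre : |z.re| ≤ 9 / 5) (him : |z.im| ≤ 9 / 5) :
    ‖gradient u z - (cR - cL : ℝ) * conj (gapDeriv ε z)‖ ≤
      gradConst (1 / 5) * (|cR - cL| + 5 * (|a| + |b|)) := by
  refine (h.norm_gradient_sub_le_of_far hε hδ hz hfar
    (M := |cR - cL| / 2 + 5 * (|a| + |b|)) fun y hy hd => ?_).trans (le_of_eq (by ring))
  rw [dist_eq] at hd
  have h1 := (abs_re_le_norm (y - z)).trans hd
  have h2 := (abs_im_le_norm (y - z)).trans hd
  rw [sub_re] at h1
  rw [sub_im] at h2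
  have h3 := abs_sub_abs_le_abs_sub y.re z.re
  have h4 := abs_sub_abs_le_abs_sub y.im z.im
  refine (h.abs_sub_le_of_abs_le hε hε1 hδ hy (t := 2) (by linarith) (by linarith)).trans (le_of_eq ?_)
  ring

/-- The gradient in the gap between two neighbouring disks of the right row. -/
theorem norm_gradient_sub_le_narrowH (h : PeriodicSolution ε δ a b cL cR u) (hε : 0 < ε)
    (hε1 : ε < 1) (hδ : 0 < δ) (hδ1 : δ < 1) {z : ℂ} (hz : z ∈ narrowH ε δ) :
    ‖gradient u z - (b * (2 + δ) : ℝ) * (I * conj (gapDeriv δ ⟨z.im - 1 - δ / 2, -(z.re - 1 - ε / 2)⟩))‖ ≤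
      gradConst (1 / 5) * (|cR - cL| + 12 * (|a| + |b|)) := by
  obtain ⟨hi, hr⟩ := abs_im_le_of_mem_narrowH hz
  set m : ℂ := ⟨1 + ε / 2, 1 + δ / 2⟩ with hm
  have e1 : m - I * (1 + δ / 2 : ℝ) = centerR ε δ 0 := by
    apply Complex.ext <;> simp [centerR, hm]
  have e2 : m + I * (1 + δ / 2 : ℝ) = centerR ε δ 1 := by
    apply Complex.ext <;> simp [centerR, hm]; ring
  have e3 : I⁻¹ * (z - m) = ⟨z.im - 1 - δ / 2, -(z.re - 1 - ε / 2)⟩ := by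
    apply Complex.ext <;> simp [hm] <;> ring
  have hb : |b * (2 + δ) / 2| ≤ 3 / 2 * |b| := by
    rw [abs_div, abs_mul, abs_two, abs_of_pos (by linarith : 0 < 2 + δ)]
    nlinarith [abs_nonneg b]
  have ha := abs_nonneg a
  have hb0 := abs_nonneg b
  -- Periodicity prescribes the potential difference b(2 + δ) of vertical neighbours, so the leading
  -- coefficient is explicit; cR - cL enters only the remainder.
  have := norm_gradient_sub_gapDeriv_le (V := b * (2 + δ)) (k := cR + b * (2 + δ) / 2) (m := m) (e := I)
    (M := |cR - cL| + 10 * (|a| + |b|)) hδ hδ (by simp) h.cont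
    h.harmonic (narrowH_subset_exterior hε hδ hz) (e1 ▸ Or.inr ⟨0, rfl⟩) (e2 ▸ Or.inr ⟨1, rfl⟩)
    (fun y hy => by rw [h.right y (e1 ▸ hy)]; ring)
    (fun y hy => by rw [h.eq_right hε hδ (e2 ▸ hy)]; push_cast; ring)
    (fun c hc h1 h2 => far_of_mem_narrowH hε hδ hz hc (e1 ▸ h1) (e2 ▸ h2)) (fun y hy hd => by
      rw [dist_eq] at hd
      have h1 := (abs_re_le_norm (y - z)).trans hd
      have h2 := (abs_im_le_norm (y - z)).trans hd
      rw [sub_re, abs_le] at h1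
      rw [sub_im, abs_le] at h2
      rw [abs_le] at hi
      rw [abs_lt] at hr
      have h3 := h.abs_sub_le_of_abs_le hε hε1 hδ hy (t := 3) (abs_le.2 ⟨by linarith, by linarith⟩)
        (abs_le.2 ⟨by linarith, by linarith⟩)
      have h4 := abs_sub (u y - (cL + cR) / 2 - (cR - cL) / 2) (b * (2 + δ) / 2)
      have h5 := abs_sub (u y - (cL + cR) / 2) ((cR - cL) / 2)
      rw [abs_div, abs_two] at h5
      rw [show u y - (cR + b * (2 + δ) / 2) =
        u y - (cL + cR) / 2 - (cR - cL) / 2 - b * (2 + δ) / 2 by ring]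
      linarith)
  rw [e3] at this
  refine this.trans ?_
  have hG := gradConst_pos (ρ := 1 / 5) (by norm_num)
  rw [abs_div, abs_two] at hb
  refine mul_le_mul_of_nonneg_left ?_ hG.le
  linarith

end PeriodicSolution

/-! ### The potential difference of the two rows -/

/-- The integrand is the value of `gapDeriv` on the imaginary axis, so this is the flux of the model
potential. -/
theorem integral_gapDeriv_mul_I {ε : ℝ} (hε : 0 < ε) (t : ℝ) :
    ∫ y in (-t)..t, 2 * pole ε / logGap ε / (pole ε ^ 2 + y ^ 2) =
      4 / logGap ε * Real.arctan (t / pole ε) := by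
  have hp := pole_pos hε
  have hΛ := logGap_pos hε
  have hd : ∀ y : ℝ, HasDerivAt (fun y => 2 / logGap ε * Real.arctan (y / pole ε))
      (2 * pole ε / logGap ε / (pole ε ^ 2 + y ^ 2)) y := fun y => by
    have h1 := (((hasDerivAt_id y).div_const (pole ε)).arctan).const_mul (2 / logGap ε)
    refine h1.congr_deriv ?_
    have h2 : pole ε ^ 2 + y ^ 2 ≠ 0 := by positivity
    have h3 : 1 + (y / pole ε) ^ 2 ≠ 0 := by positivity
    simp only [id]
    field_simp
  rw [intervalIntegral.integral_eq_sub_of_hasDerivAt (fun y _ => hd y)]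
  · rw [neg_div, Real.arctan_neg]; ring
  · refine Continuous.intervalIntegrable ?_ _ _
    exact continuous_const.div (by fun_prop) fun y => by positivity

theorem sqrt_le_pole {ε : ℝ} : √ε ≤ pole ε := Real.sqrt_le_sqrt (by nlinarith [sq_nonneg ε])

theorem pole_le {ε : ℝ} (hε : 0 < ε) (hε1 : ε < 1) : pole ε ≤ 2 * √ε := by
  rw [pole, Real.sqrt_le_left (by positivity), mul_pow, Real.sq_sqrt hε.le]
  nlinarith

/-- `logGap` and `pole` are comparable to √ε, and the arctangent lies between π/4 and π/2. The large
flux per unit of potential difference forces the difference itself to be of order √ε. -/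
theorem gapFlux_bounds {ε t : ℝ} (hε : 0 < ε) (hε1 : ε < 1 / 2) (ht : 1 ≤ t) :
    1 / (2 * √ε) ≤ 4 / logGap ε * Real.arctan (t / pole ε) ∧
      4 / logGap ε * Real.arctan (t / pole ε) ≤ 8 / √ε := by
  have hp := pole_pos hε
  have hΛ := logGap_pos hε
  have hs : 0 < √ε := Real.sqrt_pos.2 hε
  have h1 := logGap_le hε
  have h2 := le_logGap hε
  have h3 := pole_le hε (by linarith)
  have h4 := sqrt_le_pole (ε := ε)
  have hp1 : pole ε ≤ 1 := by nlinarith [pole_sq hε]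
  have hpi := Real.pi_gt_three
  have hpi' := Real.pi_le_four
  have ha : Real.pi / 4 ≤ Real.arctan (t / pole ε) := by
    rw [← Real.arctan_one]
    exact Real.arctan_strictMono.monotone (by rw [one_le_div hp]; linarith)
  have ha' := Real.arctan_lt_pi_div_two (t / pole ε)
  constructor
  · calc 1 / (2 * √ε) ≤ 1 / pole ε := by gcongr
      _ = 4 / (3 * pole ε) * (3 / 4) := by field_simp
      _ ≤ 4 / logGap ε * Real.arctan (t / pole ε) := by
        gcongr
        · nlinarith
        · linarith
  · calc 4 / logGap ε * Real.arctan (t / pole ε) ≤ 4 / (4 * pole ε / 4) * 2 := by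
          gcongr
          · refine le_trans ?_ h2
            gcongr
            linarith
          · linarith
      _ = 8 / pole ε := by field_simp; norm_num
      _ ≤ 8 / √ε := by gcongr

namespace PeriodicSolution

variable {ε δ a b cL cR : ℝ} {u : ℂ → ℝ}

/-- The flux through the line `x = 0` is that of the potential of two close disks. -/
theorem abs_flux_sub_le (h : PeriodicSolution ε δ a b cL cR u) (hε : 0 < ε)
    (hδ : 0 < δ) {M : ℝ}
    (hM : ∀ y ∈ closedExterior ε δ, |y.re| ≤ 1 / 5 → |y.im| ≤ 6 / 5 + δ / 2 →
      |u y - (cL + cR) / 2| ≤ M) :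
    |a * (2 + δ) - (cR - cL) * (4 / logGap ε * Real.arctan ((1 + δ / 2) / pole ε))| ≤
      gradConst (1 / 5) * (M + |cR - cL| / 2) * (2 + δ) := by
  have hp := pole_pos hε
  have hΛ := logGap_pos hε
  have hcg : Continuous fun y : ℝ => 2 * pole ε / logGap ε / (pole ε ^ 2 + y ^ 2) :=
    continuous_const.div (by fun_prop) fun y => by positivity
  rw [← h.flux, ← integral_gapDeriv_mul_I hε, ← intervalIntegral.integral_const_mul,
    ← intervalIntegral.integral_sub ((h.continuous_fderiv_one hε hδ).intervalIntegrable _ _)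
      ((hcg.const_mul _).intervalIntegrable _ _), ← Real.norm_eq_abs]
  refine (intervalIntegral.norm_integral_le_of_norm_le_const
    (C := gradConst (1 / 5) * (M + |cR - cL| / 2)) fun y hy => ?_).trans (le_of_eq ?_)
  · have hy' : |y| ≤ 1 + δ / 2 := by
      rw [uIoc_of_le (by linarith)] at hy
      exact abs_le.2 ⟨hy.1.le, hy.2⟩
    have h1 := h.norm_gradient_sub_le_of_far hε hδ (mul_I_mem_exterior hε hδ y)
      (fun c hc => far_of_mul_I hε hδ hy' hc) (M := M) (fun w hw hd => by
        rw [dist_eq] at hd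
        have h1 := (abs_re_le_norm (w - y * I)).trans hd
        have h2 := (abs_im_le_norm (w - y * I)).trans hd
        simp only [sub_re, mul_re, ofReal_re, I_re, mul_zero, ofReal_im, I_im, mul_one, sub_self,
          sub_zero, sub_im, mul_im, add_zero] at h1 h2
        have h3 := abs_sub_abs_le_abs_sub w.im y
        exact hM w hw h1 (by linarith))
    refine le_trans ?_ ((abs_re_le_norm _).trans h1)
    refine le_of_eq ?_
    have h2 : gapDeriv ε (y * I) = ((2 * pole ε / logGap ε / (pole ε ^ 2 + y ^ 2) : ℝ) : ℂ) := by
      rw [gapDeriv, mul_pow, I_sq]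
      push_cast
      congr 1
      ring
    rw [h2, conj_ofReal, ← ofReal_mul, sub_re, ofReal_re, gradient_eq_fderiv]
    simp
  · rw [show (1 + δ / 2 - -(1 + δ / 2)) = 2 + δ by ring, abs_of_pos (by linarith : 0 < 2 + δ)]

/-- The potential difference of the two rows is at most of order `√ε`. -/
theorem abs_sub_le_sqrt (h : PeriodicSolution ε δ a b cL cR u) (hε : 0 < ε) (hε1 : ε < 1 / 2)
    (hδ : 0 < δ) (hδ1 : δ < 1) (hG : 12 * gradConst (1 / 5) * √ε ≤ 1) :
    |cR - cL| ≤ 4 * (3 + 15 * gradConst (1 / 5)) * √ε * (|a| + |b|) := by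
  have hG0 := gradConst_pos (ρ := 1 / 5) (by norm_num)
  set G := gradConst (1 / 5) with hGd
  have h1 := h.abs_flux_sub_le hε hδ (M := |cR - cL| / 2 + 5 * (|a| + |b|)) (fun y hy hr hi =>
    (h.abs_sub_le_of_abs_le hε (by linarith) hδ hy (t := 2) (by linarith) (by linarith)).trans
      (le_of_eq (by ring)))
  obtain ⟨hΦ, -⟩ := gapFlux_bounds (t := 1 + δ / 2) hε hε1 (by linarith)
  set Φ := 4 / logGap ε * Real.arctan ((1 + δ / 2) / pole ε)
  have hs : 0 < √ε := Real.sqrt_pos.2 hε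
  have hΦ0 : 0 < Φ := lt_of_lt_of_le (by positivity) hΦ
  set V := |cR - cL| with hV
  have hV0 : 0 ≤ V := abs_nonneg _
  have h2 : V * Φ ≤ |a * (2 + δ)| + G * (V / 2 + 5 * (|a| + |b|) + V / 2) * (2 + δ) := by
    have h3 := abs_sub_abs_le_abs_sub ((cR - cL) * Φ) (a * (2 + δ))
    rw [abs_sub_comm, abs_mul, abs_of_pos hΦ0] at h3
    linarith
  have ha := abs_nonneg a
  have hb := abs_nonneg b
  have h3 : V * Φ ≤ |a| * 3 + G * (V + 5 * (|a| + |b|)) * 3 := by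
    refine h2.trans ?_
    rw [abs_mul, abs_of_pos (by linarith : 0 < 2 + δ)]
    have e : V / 2 + 5 * (|a| + |b|) + V / 2 = V + 5 * (|a| + |b|) := by ring
    rw [e]
    gcongr <;> linarith
  have h4 : V * (1 / (2 * √ε)) ≤ |a| * 3 + G * (V + 5 * (|a| + |b|)) * 3 :=
    (mul_le_mul_of_nonneg_left hΦ hV0).trans h3
  rw [mul_one_div, div_le_iff₀ (by positivity)] at h4
  -- The smallness of √ε absorbs the part of the remainder proportional to V into the left side.
  have h5 : V * (12 * G * √ε) ≤ V * 1 := by gcongr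
  have h6 : 0 ≤ |b| * √ε := by positivity
  nlinarith

/-- The potential difference of the two rows is at least of order `√ε`, once the potential is
nearly between its values on the two rows near the line `x = 0`. -/
theorem sqrt_le_sub (h : PeriodicSolution ε δ 1 0 cL cR u) (hε : 0 < ε) (hε1 : ε < 1 / 2)
    (hδ : 0 < δ) {η : ℝ} (hη : gradConst (1 / 5) * (|cR - cL| + η) ≤ 1 / 2)
    (hM : ∀ y ∈ closedExterior ε δ, |y.re| ≤ 1 / 5 → |u y - (cL + cR) / 2| ≤ |cR - cL| / 2 + η) :
    √ε / 8 ≤ cR - cL := by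
  have h1 := h.abs_flux_sub_le hε hδ (M := |cR - cL| / 2 + η) (fun y hy hr _ => hM y hy hr)
  obtain ⟨hΦ', hΦ⟩ := gapFlux_bounds (t := 1 + δ / 2) hε hε1 (by linarith)
  set Φ := 4 / logGap ε * Real.arctan ((1 + δ / 2) / pole ε)
  have hs : 0 < √ε := Real.sqrt_pos.2 hε
  have hΦ0 : 0 < Φ := lt_of_lt_of_le (by positivity) hΦ'
  have h2 := (abs_le.1 h1).2
  -- The remainder is at most half of the total flux 2 + δ, so the model carries at least the other
  -- half. This also fixes the sign of cR - cL.
  have h3 : 1 ≤ (cR - cL) * Φ := by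
    have e : |cR - cL| / 2 + η + |cR - cL| / 2 = |cR - cL| + η := by ring
    rw [e] at h2
    have h4 := mul_le_mul_of_nonneg_right hη (by linarith : 0 ≤ 2 + δ)
    linarith
  have hV : 0 < cR - cL := pos_of_mul_pos_left (by linarith) hΦ0.le
  have h5 : 1 ≤ (cR - cL) * (8 / √ε) := h3.trans (by gcongr)
  rw [mul_div_assoc', le_div_iff₀ hs] at h5
  linarith

end PeriodicSolution

/-! ### Screening by a row of disks -/

theorem cosh_re_eq (ζ : ℂ) : (cosh ζ).re = Real.cosh ζ.re * Real.cos ζ.im := by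
  conv_lhs => rw [← re_add_im ζ]
  rw [cosh_add, cosh_mul_I, sinh_mul_I, ← ofReal_cosh, ← ofReal_sinh, ← ofReal_cos, ← ofReal_sin]
  simp only [add_re, ← ofReal_mul, ← mul_assoc, ofReal_re, re_ofReal_mul, I_re, mul_zero, add_zero]

theorem half_le_cos {x : ℝ} (hx : |x| ≤ 1) : 1 / 2 ≤ Real.cos x := by
  have h1 := Real.one_sub_sq_div_two_le_cos (x := x)
  have h2 : x ^ 2 ≤ 1 := (sq_le_one_iff_abs_le_one x).2 hx
  linarith

theorem sq_div_four_le_cosh {x : ℝ} (hx : 0 ≤ x) : x ^ 2 / 4 ≤ Real.cosh x := by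
  rw [Real.cosh_eq]
  have h1 := Real.quadratic_le_exp_of_nonneg hx
  have h2 := Real.exp_pos (-x)
  linarith

/-- The gap between the disks with centers `m ± (1 + δ / 2) i` is thin near its waist. -/
theorem abs_im_sub_le_of_gap {ε δ s : ℝ} {m : ℂ}
    (h₁ : m - (1 + δ / 2 : ℝ) * I ∈ centers ε δ) (h₂ : m + (1 + δ / 2 : ℝ) * I ∈ centers ε δ) {z : ℂ}
    (hz : z ∈ closedExterior ε δ) (hre : |z.re - m.re| ≤ s) (him : |z.im - m.im| ≤ 1 + δ / 2) :
    |z.im - m.im| ≤ δ / 2 + s ^ 2 := by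
  have e₁ := one_le_dist_iff.1 (hz _ h₁)
  have e₂ := one_le_dist_iff.1 (hz _ h₂)
  simp only [sub_re, add_re, sub_im, add_im, mul_re, mul_im, ofReal_re, ofReal_im, I_re, I_im,
    mul_zero, mul_one, sub_zero, add_zero, sub_self] at e₁ e₂
  have hx : (z.re - m.re) ^ 2 ≤ s ^ 2 := by rw [← sq_abs]; gcongr
  have h3 : 1 ≤ s ^ 2 + (1 + δ / 2 - |z.im - m.im|) ^ 2 := by
    rcases abs_cases (z.im - m.im) with ⟨h, -⟩ | ⟨h, -⟩ <;> rw [h] <;> nlinarith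
  have hs0 : 0 ≤ s := (abs_nonneg _).trans hre
  by_contra! hlt
  have h4 : (1 + δ / 2 - |z.im - m.im|) ^ 2 < (1 - s ^ 2) ^ 2 := by
    have : 0 < 1 - s ^ 2 := by nlinarith
    apply sq_lt_sq' <;> linarith
  nlinarith

/-- Screening: a harmonic function that vanishes on the disks is small at the waist of a thin gap. -/
theorem le_of_gap {ε δ s M : ℝ} (hδ : 0 < δ) (hs : 0 < s) (hs1 : s < 1) (hδs : δ ≤ 2 * s ^ 2)
    (hM0 : 0 ≤ M) {m : ℂ}
    (h₁ : m - (1 + δ / 2 : ℝ) * I ∈ centers ε δ) (h₂ : m + (1 + δ / 2 : ℝ) * I ∈ centers ε δ)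
    {w : ℂ → ℝ} (hcont : ContinuousOn w (closedExterior ε δ))
    (hharm : HarmonicOnNhd w (exterior ε δ))
    (hzero : ∀ z ∈ closedExterior ε δ, z ∉ exterior ε δ → |z.re - m.re| ≤ s → w z = 0)
    (hM : ∀ z ∈ closedExterior ε δ, |z.re - m.re| ≤ s → |z.im - m.im| ≤ 1 + δ / 2 → w z ≤ M) {z : ℂ}
    (hz : z ∈ closedExterior ε δ) (hre : z.re = m.re) (him : |z.im - m.im| ≤ 1 + δ / 2) :
    w z ≤ 32 * M * s ^ 2 := by
  -- The gap has half-height at most δ/2 + s² ≤ 2s² for |x| ≤ s, so κ times the height is at most 1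
  -- and the cosine of the barrier stays above 1/2.
  set κ : ℝ := 1 / (2 * s ^ 2) with hκ
  have hκ0 : 0 < κ := by positivity
  have hκs : κ * (2 * s ^ 2) = 1 := by rw [hκ]; field_simp
  have hch : 0 < Real.cosh (κ * s) := Real.cosh_pos _
  -- Normalized so that the barrier A cosh(κx) cos(κy) dominates M on the ends |x| = s; at the waist
  -- it is at most A.
  set A : ℝ := 2 * M / Real.cosh (κ * s) with hA
  have hA0 : 0 ≤ A := by positivity
  set β : ℂ → ℝ := fun y => (cosh (κ * (y - m))).re with hβ
  have hβv : ∀ y, β y = Real.cosh (κ * (y.re - m.re)) * Real.cos (κ * (y.im - m.im)) := fun y => by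
    simp only [hβ, cosh_re_eq]
    simp
  have hβh : ∀ y, HarmonicAt β y := fun y =>
    AnalyticAt.harmonicAt_re (f := fun y => cosh (κ * (y - m))) (by fun_prop)
  set B : Set ℂ := {y | |y.re - m.re| ≤ s ∧ |y.im - m.im| ≤ 1 + δ / 2} with hB
  have hBc : IsCompact B := by
    have : B = Icc (m.re - s) (m.re + s) ×ℂ Icc (m.im - (1 + δ / 2)) (m.im + (1 + δ / 2)) := by
      ext y
      simp only [hB, mem_ofPred_eq, mem_reProdIm, mem_Icc, abs_le]
      constructor <;> rintro ⟨⟨_, _⟩, _, _⟩ <;> refine ⟨⟨?_, ?_⟩, ?_, ?_⟩ <;> linarith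
    rw [this]
    exact isCompact_Icc.reProdIm isCompact_Icc
  set U : Set ℂ := exterior ε δ ∩ {y | |y.re - m.re| < s ∧ |y.im - m.im| < 1 + δ / 2} with hU
  have hUo : IsOpen U := by
    refine (isOpen_exterior ε δ).inter (IsOpen.and ?_ ?_)
    · exact isOpen_lt (f := fun y : ℂ => |y.re - m.re|) (by fun_prop) continuous_const
    · exact isOpen_lt (f := fun y : ℂ => |y.im - m.im|) (by fun_prop) continuous_const
  set g : ℂ → ℝ := w - A • β with hg
  have hgv : ∀ y, g y = w y - A * β y := fun y => rfl
  have hcos : ∀ y ∈ closedExterior ε δ ∩ B, 1 / 2 ≤ Real.cos (κ * (y.im - m.im)) := by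
    rintro y ⟨hyK, hyr, hyi⟩
    apply half_le_cos
    rw [abs_mul, abs_of_pos hκ0, ← hκs]
    have := abs_im_sub_le_of_gap h₁ h₂ hyK hyr hyi
    gcongr
    linarith
  have hmax := le_of_harmonicOnNhd (P := closedExterior ε δ ∩ B) (U := U) (C₀ := closedExterior ε δ ∩ B)
    (w := g) (m := 0) hUo (fun y hy => ⟨exterior_subset hδ hy.1, hy.2.1.le, hy.2.2.le⟩)
    (hBc.inter_left (isClosed_closedExterior ε δ)) subset_rfl
    ((hcont.mono inter_subset_left).sub (ContinuousOn.const_smul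
      (fun y _ => (hβh y).1.continuousAt.continuousWithinAt) A))
    ((hharm.mono inter_subset_left).sub (HarmonicOnNhd.const_smul fun y _ => hβh y))
    (fun y hy => ⟨y, hy, rfl, rfl⟩) (fun y hy hyU => by
      have hc := hcos y hy
      obtain ⟨hyK, hyr, hyi⟩ := hy
      have hthin := abs_im_sub_le_of_gap h₁ h₂ hyK hyr hyi
      rw [hgv, hβv]
      by_cases hyE : y ∈ exterior ε δ
      · have hys : |y.re - m.re| = s := by
          refine le_antisymm hyr (not_lt.1 fun hlt => hyU ⟨hyE, hlt, ?_⟩)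
          nlinarith
        have h3 : Real.cosh (κ * (y.re - m.re)) = Real.cosh (κ * s) := by
          rw [← Real.cosh_abs, abs_mul, hys, abs_of_pos hκ0]
        have h4 : A * (Real.cosh (κ * s) * Real.cos (κ * (y.im - m.im))) =
            2 * M * Real.cos (κ * (y.im - m.im)) := by rw [hA]; field_simp
        rw [h3, h4]
        nlinarith [hM y hyK hyr hyi]
      · rw [hzero y hyK hyE hyr]
        have := Real.cosh_pos (κ * (y.re - m.re))
        have : 0 ≤ A * (Real.cosh (κ * (y.re - m.re)) * Real.cos (κ * (y.im - m.im))) := by positivity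
        linarith)
  have h3 := hmax z ⟨hz, by simp [hB, hre, hs.le, him]⟩
  rw [hgv, hβv, hre, sub_self, mul_zero, Real.cosh_zero, one_mul] at h3
  have h4 : A * Real.cos (κ * (z.im - m.im)) ≤ A * 1 := by
    gcongr
    exact Real.cos_le_one _
  -- The quadratic bound on cosh suffices: cosh(κs) ≥ (κs)²/4 = 1/(16s²).
  have h5 : A ≤ 32 * M * s ^ 2 := by
    rw [hA, div_le_iff₀ hch]
    have h6 := sq_div_four_le_cosh (x := κ * s) (by positivity)
    have h7 : (κ * s) ^ 2 / 4 * (16 * s ^ 2) = 1 := by rw [hκ]; field_simp; norm_num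
    have h8 : 1 ≤ Real.cosh (κ * s) * (16 * s ^ 2) := by rw [← h7]; gcongr
    nlinarith
  linarith

theorem exists_gap_center {δ : ℝ} (hδ : 0 < δ) (y : ℝ) :
    ∃ n : ℤ, |y - (2 * n + 1) * (1 + δ / 2)| ≤ 1 + δ / 2 := by
  obtain ⟨n, hn⟩ := exists_period_abs_im_le hδ ⟨0, y - (1 + δ / 2)⟩
  refine ⟨-n, ?_⟩
  convert hn using 2
  simp; ring

namespace PeriodicSolution

variable {ε δ a cL cR : ℝ} {u : ℂ → ℝ}

/-- At the waist of the gaps between the disks of one row, the potential is almost the one of the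
row. -/
theorem abs_sub_le_of_waist (h : PeriodicSolution ε δ a 0 cL cR u) (hε : 0 < ε) (hε1 : ε < 1)
    (hδ : 0 < δ) {s : ℝ} (hs : 0 < s) (hs1 : s < 1) (hδs : δ ≤ 2 * s ^ 2) {z : ℂ}
    (hz : z ∈ closedExterior ε δ) (hre : |z.re| = 1 + ε / 2) :
    |u z - (cL + cR) / 2| ≤ |cR - cL| / 2 + 32 * (|cR - cL| + 6 * |a|) * s ^ 2 := by
  have hbound : ∀ y ∈ closedExterior ε δ, |y.re| ≤ 3 →
      |u y - (cL + cR) / 2| ≤ |cR - cL| / 2 + 6 * |a| := by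
    intro y hy hr
    have h1 := h.abs_sub_linearPotential_le hε hε1 hδ hy
    have h2 : |linearPotential a 0 y| ≤ |a| * 3 := by
      rw [linearPotential, zero_mul, add_zero, abs_mul]
      gcongr
    have h3 := abs_add_le (u y - linearPotential a 0 y - (cL + cR) / 2) (linearPotential a 0 y)
    rw [show u y - linearPotential a 0 y - (cL + cR) / 2 + linearPotential a 0 y =
      u y - (cL + cR) / 2 by ring] at h3
    rw [abs_zero, add_zero] at h1
    linarith
  have key : ∀ (σ k : ℝ), |σ| = 1 → z.re = σ * (1 + ε / 2) →
      (∀ n : ℤ, (⟨σ * (1 + ε / 2), n * (2 + δ)⟩ : ℂ) ∈ centers ε δ) →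
      (∀ y ∈ closedExterior ε δ, y ∉ exterior ε δ → |y.re - σ * (1 + ε / 2)| ≤ s → u y = k) →
      |k - (cL + cR) / 2| = |cR - cL| / 2 →
      |u z - (cL + cR) / 2| ≤ |cR - cL| / 2 + 32 * (|cR - cL| + 6 * |a|) * s ^ 2 := by
    intro σ k hσ hzr hcen hk hkV
    -- The waist line |x| = 1 + ε/2 runs through the centers of a row; m is the middle of the gap
    -- nearest to z, and σ tells the row.
    obtain ⟨n, hn⟩ := exists_gap_center hδ z.im
    set m : ℂ := ⟨σ * (1 + ε / 2), (2 * n + 1) * (1 + δ / 2)⟩ with hm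
    have h₁ : m - (1 + δ / 2 : ℝ) * I ∈ centers ε δ := by
      convert hcen n using 1
      apply Complex.ext <;> simp [hm]; ring
    have h₂ : m + (1 + δ / 2 : ℝ) * I ∈ centers ε δ := by
      convert hcen (n + 1) using 1
      apply Complex.ext <;> simp [hm]; ring
    have hMb : ∀ y ∈ closedExterior ε δ, |y.re - m.re| ≤ s → |u y - k| ≤ |cR - cL| + 6 * |a| := by
      intro y hy hr
      have h3 : |m.re| = 1 + ε / 2 := by
        simp only [hm]; rw [abs_mul, hσ, one_mul, abs_of_pos (by linarith)]
      have h4 := abs_sub_abs_le_abs_sub y.re m.re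
      have h5 := hbound y hy (by linarith)
      have h6 := abs_sub (u y - (cL + cR) / 2) (k - (cL + cR) / 2)
      rw [sub_sub_sub_cancel_right] at h6
      linarith
    have hconst : HarmonicOnNhd (fun _ : ℂ => k) (exterior ε δ) := fun y _ => by simp
    have hM0 : 0 ≤ |cR - cL| + 6 * |a| := by positivity
    have h3 := le_of_gap (w := u - fun _ => k) hδ hs hs1 hδs hM0 h₁ h₂ (h.cont.sub continuousOn_const)
      (h.harmonic.sub hconst) (fun y hy hyE hr => by simp [hk y hy hyE hr])
      (fun y hy hr _ => (le_abs_self _).trans (hMb y hy hr)) hz hzr hn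
    have h4 := le_of_gap (w := (fun _ => k) - u) hδ hs hs1 hδs hM0 h₁ h₂ (continuousOn_const.sub h.cont)
      (hconst.sub h.harmonic) (fun y hy hyE hr => by simp [hk y hy hyE hr])
      (fun y hy hr _ => by
        have := hMb y hy hr
        rw [abs_sub_comm] at this
        exact (le_abs_self _).trans this) hz hzr hn
    simp only [Pi.sub_apply] at h3 h4
    have h5 : |u z - k| ≤ 32 * (|cR - cL| + 6 * |a|) * s ^ 2 := abs_le.2 ⟨by linarith, h3⟩
    have h6 := abs_add_le (u z - k) (k - (cL + cR) / 2)
    rw [sub_add_sub_cancel] at h6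
    linarith
  have hside : ∀ (y c : ℂ), dist y c = 1 → |y.re - c.re| ≤ 1 := fun y c hd => by
    rw [← hd, dist_eq, ← sub_re]; exact abs_re_le_norm _
  rcases abs_cases z.re with ⟨hab, -⟩ | ⟨hab, -⟩
  · refine key 1 cR abs_one (by linarith) (fun n => Or.inr ⟨n, by simp [centerR]⟩) ?_ ?_
    · intro y hy hyE hr
      obtain ⟨c, ⟨n, rfl⟩ | ⟨n, rfl⟩, hd⟩ := exists_center_of_mem_diff hδ hy hyE
      · exfalso
        have h1 := abs_le.1 (hside _ _ hd)
        simp only [centerL] at h1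
        linarith [(abs_le.1 hr).1]
      · rw [h.eq_right hε hδ hd]; ring
    · rw [show cR - (cL + cR) / 2 = (cR - cL) / 2 by ring, abs_div, abs_two]
  · refine key (-1) cL (by simp) (by linarith) (fun n => Or.inl ⟨n, by simp [centerL]; ring⟩) ?_ ?_
    · intro y hy hyE hr
      obtain ⟨c, ⟨n, rfl⟩ | ⟨n, rfl⟩, hd⟩ := exists_center_of_mem_diff hδ hy hyE
      · rw [h.eq_left hε hδ hd]; ring
      · exfalso
        have h1 := abs_le.1 (hside _ _ hd)
        simp only [centerR] at h1
        linarith [(abs_le.1 hr).2]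
    · rw [show cL - (cL + cR) / 2 = -((cR - cL) / 2) by ring, abs_neg, abs_div, abs_two]

/-- Between the two rows, the potential is almost between its values on the rows. -/
theorem abs_sub_le_of_abs_re_le (h : PeriodicSolution ε δ a 0 cL cR u) (hε : 0 < ε) (hε1 : ε < 1)
    (hδ : 0 < δ) {s : ℝ} (hs : 0 < s) (hs1 : s < 1) (hδs : δ ≤ 2 * s ^ 2) {z : ℂ}
    (hz : z ∈ closedExterior ε δ) (hre : |z.re| ≤ 1 + ε / 2) :
    |u z - (cL + cR) / 2| ≤ |cR - cL| / 2 + 32 * (|cR - cL| + 6 * |a|) * s ^ 2 := by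
  set T : ℝ := |cR - cL| / 2 + 32 * (|cR - cL| + 6 * |a|) * s ^ 2 with hT
  set P : Set ℂ := closedExterior ε δ ∩ {y | |y.re| ≤ 1 + ε / 2} with hP
  set U : Set ℂ := exterior ε δ ∩ {y | |y.re| < 1 + ε / 2} with hU
  set C₀ : Set ℂ := closedExterior ε δ ∩ {y | |y.re| ≤ 1 + ε / 2 ∧ |y.im| ≤ 1 + δ / 2} with hC₀
  have hC₀c : IsCompact C₀ := by
    refine IsCompact.inter_left ?_ (isClosed_closedExterior ε δ)
    have : {y : ℂ | |y.re| ≤ 1 + ε / 2 ∧ |y.im| ≤ 1 + δ / 2} =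
        Icc (-(1 + ε / 2)) (1 + ε / 2) ×ℂ Icc (-(1 + δ / 2)) (1 + δ / 2) := by
      ext y
      simp only [mem_ofPred_eq, mem_reProdIm, mem_Icc, abs_le]
    rw [this]
    exact isCompact_Icc.reProdIm isCompact_Icc
  have hUo : IsOpen U := (isOpen_exterior ε δ).inter (isOpen_lt (by fun_prop) continuous_const)
  have hUP : U ⊆ P := fun y hy => by
    have h1 : |y.re| < 1 + ε / 2 := hy.2
    exact ⟨exterior_subset hδ hy.1, h1.le⟩
  have hCP : C₀ ⊆ P := fun y hy => ⟨hy.1, hy.2.1⟩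
  -- Since b = 0, u itself is periodic, so one period represents the whole infinite strip.
  have hrep : ∀ y ∈ P, ∃ y' ∈ C₀, y'.re = y.re ∧ u y' = u y := by
    rintro y ⟨hyK, hyr⟩
    obtain ⟨n, hn⟩ := exists_period_abs_im_le hδ y
    have hr : (y + n * (2 + δ : ℝ) * I).re = y.re := by simp
    refine ⟨_, ⟨(add_period_mem_closedExterior n).2 hyK, ?_, hn⟩, hr, ?_⟩
    · rw [hr]; exact hyr
    · rw [h.periodic_int hyK]; ring
  have hbd : ∀ y ∈ P, y ∉ U → |u y - (cL + cR) / 2| ≤ T := by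
    rintro y ⟨hyK, hyr⟩ hyU
    by_cases hyE : y ∈ exterior ε δ
    · exact h.abs_sub_le_of_waist hε hε1 hδ hs hs1 hδs hyK
        (le_antisymm hyr (not_lt.1 fun hlt => hyU ⟨hyE, hlt⟩))
    · have hT0 : |cR - cL| / 2 ≤ T := le_add_of_nonneg_right (by positivity)
      refine le_trans (le_of_eq ?_) hT0
      obtain ⟨c, ⟨n, rfl⟩ | ⟨n, rfl⟩, hd⟩ := exists_center_of_mem_diff hδ hyK hyE
      · rw [h.eq_left hε hδ hd, show cL + n * (0 * (2 + δ)) - (cL + cR) / 2 = -((cR - cL) / 2) by ring,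
          abs_neg, abs_div, abs_two]
      · rw [h.eq_right hε hδ hd, show cR + n * (0 * (2 + δ)) - (cL + cR) / 2 = (cR - cL) / 2 by ring,
          abs_div, abs_two]
  have h1 := le_of_harmonicOnNhd (w := u) (m := (cL + cR) / 2 + T) hUo hUP hC₀c hCP
    (h.cont.mono inter_subset_left) (h.harmonic.mono inter_subset_left) hrep
    (fun y hy hyU => by linarith [(abs_le.1 (hbd y hy hyU)).2]) z ⟨hz, hre⟩
  have h2 := le_of_harmonicOnNhd (w := -u) (m := -((cL + cR) / 2) + T) hUo hUP hC₀c hCP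
    (h.cont.mono inter_subset_left).neg (h.harmonic.mono inter_subset_left).neg
    (fun y hy => by
      obtain ⟨y', hy', hr, he⟩ := hrep y hy
      exact ⟨y', hy', hr, by simp [he]⟩)
    (fun y hy hyU => by
      simp only [Pi.neg_apply]
      linarith [(abs_le.1 (hbd y hy hyU)).1]) z ⟨hz, hre⟩
  simp only [Pi.neg_apply] at h2
  exact abs_le.2 ⟨by linarith, by linarith⟩

end PeriodicSolution

/-! ### Asymptotics of the gradient -/

/-- The constant in the bound of the potential difference of the two rows. -/
def gapConst : ℝ := 4 * (3 + 15 * gradConst (1 / 5))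

theorem twelve_lt_gapConst : 12 < gapConst := by
  have := gradConst_pos (ρ := 1 / 5) (by norm_num)
  rw [gapConst]; linarith

section asymptotics

variable {ε δ : ℝ}

/-- The potential difference of the two rows is `a μ₀ √ε` with `μ₀` independent of the solution. -/
theorem exists_potential_difference (hε : 0 < ε) (hδ : 0 < δ)
    (hεs : 4 * gapConst * (gradConst (1 / 5) + 1) * √ε ≤ 1)
    (hδs : 500 * (gradConst (1 / 5) + 1) * δ ≤ 1) :
    ∃ μ : ℝ, 1 / 8 ≤ μ ∧ μ ≤ gapConst ∧ ∀ (a b cL cR : ℝ) (u : ℂ → ℝ),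
      PeriodicSolution ε δ a b cL cR u → cR - cL = a * μ * √ε := by
  have hG := gradConst_pos (ρ := 1 / 5) (by norm_num)
  have hK := twelve_lt_gapConst
  set G := gradConst (1 / 5) with hGd
  have hs : 0 < √ε := Real.sqrt_pos.2 hε
  have hK0 : 0 < gapConst := by linarith
  have hKs : 0 < gapConst * √ε := by positivity
  have hGKs : 0 < G * (gapConst * √ε) := by positivity
  have hGs : 0 < G * √ε := by positivity
  have hs1 : √ε ≤ 1 / 48 := by nlinarith
  have hε2 : ε < 1 / 2 := by
    rw [← Real.sq_sqrt hε.le]; nlinarith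
  have hδ1 : δ < 1 := by nlinarith [mul_pos hG hδ]
  have h12 : 12 * G * √ε ≤ 1 := by nlinarith
  have hdiff : ∀ {a b cL cR : ℝ} {u : ℂ → ℝ}, PeriodicSolution ε δ a b cL cR u →
      |cR - cL| ≤ gapConst * √ε * (|a| + |b|) := fun h =>
    h.abs_sub_le_sqrt hε hε2 hδ hδ1 h12
  -- Averaging with the reflection in the x-axis changes b to 0 and keeps both constants, since the
  -- disks D_L0 and D_R0 are symmetric.
  have hsymm : ∀ {a b cL cR : ℝ} {u : ℂ → ℝ}, PeriodicSolution ε δ a b cL cR u →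
      ∃ u', PeriodicSolution ε δ a 0 cL cR u' := fun {a b cL cR u} h => by
    have h1 := h.linear (h.reflect hε hδ) hε hδ (1 / 2) (1 / 2)
    refine ⟨(1 / 2 : ℝ) • u + (1 / 2 : ℝ) • fun z => u (conj z), ?_⟩
    convert h1 using 1 <;> ring
  have hzero : ∀ {cL cR : ℝ} {u : ℂ → ℝ}, PeriodicSolution ε δ 0 0 cL cR u → cR - cL = 0 :=
    fun h => by
    have h1 := hdiff h
    simpa using h1
  by_cases hex : ∃ (cL cR : ℝ) (u : ℂ → ℝ), PeriodicSolution ε δ 1 0 cL cR u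
  · obtain ⟨cL, cR, u, h⟩ := hex
    have hV := hdiff h
    rw [abs_one, abs_zero, add_zero, mul_one] at hV
    refine ⟨(cR - cL) / √ε, ?_, ?_, ?_⟩
    · rw [le_div_iff₀ hs]
      -- G · gapConst · √ε ≤ 1/4 and G · 32 · 7 · s² ≤ 224/1000 together stay below 1/2, while 2s² =
      -- 1/(500(G + 1)) is the bound assumed on δ.
      set s : ℝ := √(1 / (1000 * (G + 1))) with hsd
      have hs0 : 0 < s := Real.sqrt_pos.2 (by positivity)
      have hs2 : s ^ 2 * (1000 * (G + 1)) = 1 := by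
        rw [hsd, Real.sq_sqrt (by positivity)]; field_simp
      have hGs2 : 0 < G * s ^ 2 := by positivity
      have h1 := h.sqrt_le_sub hε hε2 hδ (η := 32 * (|cR - cL| + 6 * |1|) * s ^ 2) (by
          have h2 : |cR - cL| + 6 * |(1 : ℝ)| ≤ 7 := by rw [abs_one]; nlinarith
          have h3 : G * (|cR - cL| + 32 * (|cR - cL| + 6 * |(1 : ℝ)|) * s ^ 2) ≤
              G * (gapConst * √ε + 32 * 7 * s ^ 2) := by gcongr
          refine h3.trans ?_
          nlinarith [sq_nonneg s])
        (fun y hy hr => h.abs_sub_le_of_abs_re_le hε (by linarith) hδ hs0 (by nlinarith)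
          (by nlinarith [mul_pos hG hδ]) hy (by linarith))
      linarith
    · rw [div_le_iff₀ hs]; exact (le_abs_self _).trans hV
    · intro a b cL' cR' u' h'
      obtain ⟨v, hv⟩ := hsymm h'
      have h1 := hv.linear h hε hδ 1 (-a)
      rw [show 1 * a + -a * 1 = 0 by ring, show (1 : ℝ) * 0 + -a * 0 = 0 by ring] at h1
      have h2 := hzero h1
      field_simp
      linarith
  -- Without a solution for (1, 0), scaling excludes every solution with a ≠ 0; for a = 0 the
  -- difference is zero and any μ will do.
  · refine ⟨1, by norm_num, by linarith, fun a b cL cR u h => ?_⟩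
    obtain ⟨v, hv⟩ := hsymm h
    rcases eq_or_ne a 0 with rfl | ha
    · rw [hzero hv]; ring
    · exfalso
      have h1 := hv.linear hv hε hδ a⁻¹ 0
      rw [show a⁻¹ * a + 0 * a = 1 by field_simp; ring, show a⁻¹ * 0 + 0 * 0 = (0 : ℝ) by ring] at h1
      exact hex ⟨_, _, _, h1⟩

/-- The field in the horizontal gap is the expansion from `norm_gapDeriv_sub_le` turned by a quarter
turn; S is its cross term 2ξη/s². -/
theorem asympH_eq (hδ : 0 < δ) (z : ℂ) : asympH ε δ z =
    I * conj (1 / ((δ : ℂ) + (-(z.re - 1 - ε / 2) : ℝ) ^ 2) + 2 * (z.im - 1 - δ / 2 : ℝ) *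
      (-(z.re - 1 - ε / 2) : ℝ) / ((δ : ℂ) + (-(z.re - 1 - ε / 2) : ℝ) ^ 2) ^ 2 * I) := by
  have hs : √δ ≠ 0 := (Real.sqrt_pos.2 hδ).ne'
  set x := z.re - 1 - ε / 2 with hx
  set y := z.im - 1 - δ / 2 with hy
  have e1 : (1 : ℂ) / ((δ : ℂ) + (-x : ℝ) ^ 2) + 2 * (y : ℝ) * (-x : ℝ) / ((δ : ℂ) + (-x : ℝ) ^ 2) ^ 2 * I =
      (1 / (δ + x ^ 2) : ℝ) + (2 * y * (-x) / (δ + x ^ 2) ^ 2 : ℝ) * I := by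
    push_cast; ring
  have e2 : 1 / √δ * S ε δ z = 2 * y * (-x) / (δ + x ^ 2) ^ 2 := by
    rw [S, ← hx, ← hy]
    field_simp
    ring
  rw [e1, asympH, e2, map_add, map_mul, conj_ofReal, conj_ofReal, conj_I, real_smul, real_smul]
  linear_combination ((2 * y * (-x) / (δ + x ^ 2) ^ 2 : ℝ) : ℂ) * I_sq

theorem norm_asympH_le (hδ : 0 < δ) {z : ℂ} (hz : z ∈ narrowH ε δ) :
    ‖asympH ε δ z‖ ≤ 3 / δ := by
  obtain ⟨h34, hy⟩ := abs_re_le_of_narrow hz.1 hz.2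
  have hs : √δ ≠ 0 := (Real.sqrt_pos.2 hδ).ne'
  set x := z.re - 1 - ε / 2 with hx
  set y := z.im - 1 - δ / 2 with hyd
  have hx0 := sq_nonneg x
  have hx1 : |x| ≤ 1 := by rw [← sq_le_one_iff_abs_le_one]; linarith
  have hpos : 0 < δ + x ^ 2 := by positivity
  have e2 : 1 / √δ * S ε δ z = -(2 * y * x / (δ + x ^ 2) ^ 2) := by
    rw [S, ← hx, ← hyd]
    field_simp
    ring
  have h1 : |1 / (δ + x ^ 2)| ≤ 1 / δ := by
    rw [abs_of_pos (by positivity)]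
    gcongr
    linarith
  have h2 : |2 * y * x / (δ + x ^ 2) ^ 2| ≤ 2 / δ := by
    rw [abs_div, abs_mul, abs_mul, abs_two, abs_of_pos (by positivity : 0 < (δ + x ^ 2) ^ 2)]
    calc 2 * |y| * |x| / (δ + x ^ 2) ^ 2 ≤ 2 * (δ + x ^ 2) * 1 / (δ + x ^ 2) ^ 2 := by
          gcongr; linarith
      _ = 2 / (δ + x ^ 2) := by field_simp
      _ ≤ 2 / δ := by gcongr; linarith
  rw [asympH, e2, ← hx]
  refine (norm_add_le _ _).trans ?_
  rw [norm_smul, norm_smul, norm_I, norm_one, mul_one, mul_one, Real.norm_eq_abs, Real.norm_eq_abs,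
    abs_neg]
  calc _ ≤ 1 / δ + 2 / δ := add_le_add h1 h2
    _ = 3 / δ := by ring

variable {a b cL cR : ℝ} {u : ℂ → ℝ}

/-- Replacing the coefficient b(2 + δ) by 2b costs bδ times a field of size at most 3/δ, which is
bounded. -/
theorem PeriodicSolution.norm_gradient_sub_asympH_le (h : PeriodicSolution ε δ a b cL cR u)
    (hε : 0 < ε) (hε1 : ε < 1) (hδ : 0 < δ) (hδ4 : δ ≤ 1 / 4) (hV : |cR - cL| ≤ |a| + |b|) {z : ℂ}
    (hz : z ∈ narrowH ε δ) :
    ‖gradient u z - (2 * b) • asympH ε δ z‖ ≤ (13 * gradConst (1 / 5) + 48) * (|a| + |b|) := by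
  have hG := gradConst_pos (ρ := 1 / 5) (by norm_num)
  set G := gradConst (1 / 5) with hGd
  have h1 := h.norm_gradient_sub_le_narrowH hε hε1 hδ (by linarith) hz
  set ζ : ℂ := ⟨z.im - 1 - δ / 2, -(z.re - 1 - ε / 2)⟩ with hζ
  have h2 := norm_gapDeriv_sub_le hδ hδ4 (ζ := ζ) (by simp only [hζ, neg_sq]; exact hz.1)
    (by simp only [hζ, abs_neg]; exact hz.2)
  have h3 : ‖I * conj (gapDeriv δ ζ) - asympH ε δ z‖ ≤ 15 := by
    rw [asympH_eq hδ, ← mul_sub, ← map_sub, norm_mul, norm_I, one_mul, norm_conj]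
    exact h2
  have h4 := norm_asympH_le (ε := ε) hδ hz
  have hsplit : gradient u z - (2 * b) • asympH ε δ z =
      (gradient u z - (b * (2 + δ) : ℝ) * (I * conj (gapDeriv δ ζ))) +
        (b * (2 + δ) : ℝ) * (I * conj (gapDeriv δ ζ) - asympH ε δ z) + (b * δ : ℝ) * asympH ε δ z := by
    rw [real_smul]; push_cast; ring
  have ha := abs_nonneg a
  have hb := abs_nonneg b
  have h5 : ‖((b * (2 + δ) : ℝ) : ℂ) * (I * conj (gapDeriv δ ζ) - asympH ε δ z)‖ ≤ |b| * 3 * 15 := by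
    rw [norm_mul, norm_real, Real.norm_eq_abs, abs_mul, abs_of_pos (by linarith : 0 < 2 + δ)]
    gcongr
    linarith
  have h6 : ‖((b * δ : ℝ) : ℂ) * asympH ε δ z‖ ≤ |b| * 3 := by
    rw [norm_mul, norm_real, Real.norm_eq_abs, abs_mul, abs_of_pos hδ]
    calc |b| * δ * ‖asympH ε δ z‖ ≤ |b| * δ * (3 / δ) := by gcongr
      _ = |b| * 3 := by field_simp
  have h7 : G * (|cR - cL| + 12 * (|a| + |b|)) ≤ G * ((|a| + |b|) + 12 * (|a| + |b|)) := by gcongr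
  rw [hsplit]
  refine (norm_add₃_le).trans ?_
  linarith

/-- Here the cross term of the expansion can be dropped: the coefficient is O(√ε|a|), and 2√ε|y| ≤ ε
+ y² makes its product with the cross term bounded. In the horizontal gap the coefficient is not
small in this way, which is why S appears there. -/
theorem PeriodicSolution.norm_gradient_sub_asympV_le (h : PeriodicSolution ε δ a b cL cR u)
    (hε : 0 < ε) (hε4 : ε ≤ 1 / 4) (hδ : 0 < δ) {K μ : ℝ} (hK : 0 ≤ K) (hKε : K * √ε ≤ 1)
    (hμ : |μ| ≤ K) (hV : cR - cL = a * μ * √ε) {z : ℂ} (hz : z ∈ narrowV ε) :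
    ‖gradient u z - (a * μ) • asympV ε z‖ ≤
      (6 * gradConst (1 / 5) + 15 + K) * (|a| + |b|) := by
  have hG := gradConst_pos (ρ := 1 / 5) (by norm_num)
  set G := gradConst (1 / 5) with hGd
  obtain ⟨h34, hx⟩ := abs_re_le_of_narrow hz.1 hz.2
  have hs : 0 < √ε := Real.sqrt_pos.2 hε
  have hs2 : √ε ^ 2 = ε := Real.sq_sqrt hε.le
  have ha := abs_nonneg a
  have hb := abs_nonneg b
  have hy1 : |z.im| ≤ 1 := by rw [← sq_le_one_iff_abs_le_one]; linarith
  have h1 := h.norm_gradient_sub_le hε (by linarith) hδ (narrowV_subset_exterior hδ hz)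
    (fun c hc => far_of_mem_narrowV hε hδ hz hc) (by linarith) (by linarith)
  have h2 := norm_gapDeriv_sub_le hε hε4 hz.1 hz.2
  set x := z.re with hxd
  set y := z.im with hyd
  set t := ε + y ^ 2 with ht
  have hy0 := sq_nonneg y
  have ht0 : 0 < t := by positivity
  have hVabs : |cR - cL| ≤ |a| * K * √ε := by
    rw [hV, abs_mul, abs_mul, abs_of_pos hs]
    gcongr
  have hVa : |cR - cL| ≤ |a| := by
    refine hVabs.trans ?_
    rw [mul_assoc]
    exact mul_le_of_le_one_right ha hKε
  have e : (1 : ℂ) / (ε + y ^ 2) + 2 * x * y / (ε + y ^ 2) ^ 2 * I =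
      (1 / t : ℝ) + (2 * x * y / t ^ 2 : ℝ) * I := by
    rw [ht]; push_cast; ring
  rw [e] at h2
  have h3 : ‖conj (gapDeriv ε z) - ((1 / t : ℝ) - (2 * x * y / t ^ 2 : ℝ) * I)‖ ≤ 15 := by
    rw [← norm_conj, map_sub, map_sub, map_mul, conj_conj, conj_ofReal, conj_ofReal, conj_I, mul_neg,
      sub_neg_eq_add]
    exact h2
  have hsplit : gradient u z - (a * μ) • asympV ε z =
      (gradient u z - (cR - cL : ℝ) * conj (gapDeriv ε z)) +
        (cR - cL : ℝ) * (conj (gapDeriv ε z) - ((1 / t : ℝ) - (2 * x * y / t ^ 2 : ℝ) * I)) -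
        ((cR - cL) * (2 * x * y / t ^ 2) : ℝ) * I := by
    rw [asympV, smul_smul, real_smul, hV, ← hyd, ← ht]
    push_cast
    ring
  have h4 : ‖((cR - cL : ℝ) : ℂ) * (conj (gapDeriv ε z) -
      ((1 / t : ℝ) - (2 * x * y / t ^ 2 : ℝ) * I))‖ ≤ |a| * 15 := by
    rw [norm_mul, norm_real, Real.norm_eq_abs]
    gcongr
  have h5 : ‖(((cR - cL) * (2 * x * y / t ^ 2) : ℝ) : ℂ) * I‖ ≤ |a| * K := by
    rw [norm_mul, norm_I, mul_one, norm_real, Real.norm_eq_abs, abs_mul, abs_div, abs_mul, abs_mul,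
      abs_two, abs_of_pos (by positivity : 0 < t ^ 2)]
    have h6 : 2 * √ε * |y| ≤ t := by
      have := sq_abs y
      nlinarith [sq_nonneg (√ε - |y|)]
    calc |cR - cL| * (2 * |x| * |y| / t ^ 2) ≤ |a| * K * √ε * (2 * t * |y| / t ^ 2) := by
          gcongr; linarith
      _ = |a| * K * ((2 * √ε * |y|) / t) := by field_simp
      _ ≤ |a| * K * 1 := by
        gcongr
        rwa [div_le_one ht0]
      _ = |a| * K := mul_one _
  have h7 : G * (|cR - cL| + 5 * (|a| + |b|)) ≤ G * (|a| + 5 * (|a| + |b|)) := by gcongr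
  have h8 : 0 ≤ G * |b| := by positivity
  have h9 : 0 ≤ K * |b| := by positivity
  rw [hsplit]
  refine (norm_sub_le _ _).trans ((add_le_add_left (norm_add_le _ _) _).trans ?_)
  linarith

end asymptotics

end TwoRows

end

/-! ### Choice of the constants and optimality of the rates -/

theorem theorem1p3 :
    ∃ C > (0 : ℝ), ∃ r > (0 : ℝ), ∀ ε δ : ℝ, 0 < ε → ε < r → 0 < δ → δ < r →
      ∃ μ₀ : ℝ, 1 / C < μ₀ ∧ μ₀ < C ∧
        ∀ (a b : ℝ) (u : ℂ → ℝ), TwoRows.IsSolution ε δ (TwoRows.linearPotential a b) u →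
          -- the two asymptotes, with uniformly bounded remainders
          (∃ R₁ R₂ : ℂ → ℂ,
            (∀ z ∈ TwoRows.narrowH ε δ,
              gradient u z = (2 * b) • TwoRows.asympH ε δ z + R₁ z) ∧
            (∀ z ∈ TwoRows.narrowV ε,
              gradient u z = (a * μ₀) • TwoRows.asympV ε z + R₂ z) ∧
            (∀ z ∈ TwoRows.narrowH ε δ, ∀ w ∈ TwoRows.narrowV ε,
              ‖R₁ z‖ + ‖R₂ w‖ ≤ C * (|a| + |b|))) ∧
          -- the blow-up rate `1 / δ` in the horizontal region, and its optimality
          (∀ z ∈ TwoRows.narrowH ε δ, ‖gradient u z‖ ≤ C * (|a| + |b|) / δ) ∧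
          (C * δ * (|a| + |b|) ≤ |b| →
            ∃ z ∈ TwoRows.narrowH ε δ, |b| / (C * δ) ≤ ‖gradient u z‖) ∧
          -- the blow-up rate `1 / √ε` in the vertical region, and its optimality
          (∀ z ∈ TwoRows.narrowV ε, ‖gradient u z‖ ≤ C * (|a| + |b|) / √ε) ∧
          (C * √ε * (|a| + |b|) ≤ |a| →
            ∃ z ∈ TwoRows.narrowV ε, |a| / (C * √ε) ≤ ‖gradient u z‖) := by
  have hG := TwoRows.gradConst_pos (ρ := 1 / 5) (by norm_num)
  have hK := TwoRows.twelve_lt_gapConst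
  set G := TwoRows.gradConst (1 / 5) with hGd
  set K := TwoRows.gapConst with hKd
  have hK0 : 0 < K := by linarith
  -- The bracket dominates the sum of the two remainder bounds and, in each region, the remainder
  -- plus the size of the model. The factor 16 is for the optimality in the vertical gap, where only
  -- μ ≥ 1/8 is known.
  set C : ℝ := 16 * (19 * G + 100 + 2 * K) with hC
  have hC0 : 0 < C := by positivity
  -- The bound on √ε demanded by `exists_potential_difference`; ρ² is also small enough for its
  -- condition on δ because K > 12.
  set ρ : ℝ := 1 / (4 * K * (G + 1)) with hρ
  have hρ0 : 0 < ρ := by positivity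
  have hρ1 : 4 * K * (G + 1) * ρ = 1 := by rw [hρ]; field_simp
  have hρ2 : 48 * (G + 1) * ρ ≤ 1 := by
    refine le_trans ?_ hρ1.le
    gcongr
    linarith
  have hρ3 : 48 * ρ ≤ 1 := by nlinarith [mul_pos hG hρ0]
  refine ⟨C, hC0, ρ ^ 2, by positivity, fun ε δ hε hεr hδ hδr => ?_⟩
  have hs : 0 < √ε := Real.sqrt_pos.2 hε
  have hsρ : √ε ≤ ρ := (Real.sqrt_le_left hρ0.le).2 hεr.le
  have hεs : 4 * K * (G + 1) * √ε ≤ 1 := le_trans (by gcongr) hρ1.le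
  have hρsq : ρ ^ 2 ≤ 1 / 4 := by nlinarith
  have hδs : 500 * (G + 1) * δ ≤ 1 := by
    have h1 : 500 * (G + 1) * δ ≤ 500 * (G + 1) * ρ ^ 2 := by gcongr
    nlinarith
  have hKε : K * √ε ≤ 1 := by nlinarith [mul_pos hK0 hs, mul_pos hG (mul_pos hK0 hs)]
  have hs1 : √ε ≤ 1 := by linarith
  obtain ⟨μ, hμ8, hμK, hμ⟩ := TwoRows.exists_potential_difference hε hδ hεs hδs
  have hμ0 : 0 < μ := by linarith
  refine ⟨μ, ?_, by linarith, fun a b u hu => ?_⟩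
  · rw [div_lt_iff₀ hC0]; nlinarith
  obtain ⟨cL, cR, h⟩ := hu.exists_periodicSolution hε (by linarith) hδ
  have hV := hμ a b cL cR u h
  have ha := abs_nonneg a
  have hb := abs_nonneg b
  have hVab : |cR - cL| ≤ |a| + |b| := by
    rw [hV, mul_assoc, abs_mul, abs_of_pos (by positivity : 0 < μ * √ε)]
    have h1 : μ * √ε ≤ 1 := le_trans (by gcongr) hKε
    nlinarith
  have hH := fun z hz =>
    h.norm_gradient_sub_asympH_le hε (by linarith) hδ (by linarith) hVab (z := z) hz
  have hVv := fun z hz => h.norm_gradient_sub_asympV_le hε (by linarith) hδ hK0.le hKε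
    (by rwa [abs_of_pos hμ0]) hV (z := z) hz
  set N := |a| + |b| with hN
  have hN0 : 0 ≤ N := by positivity
  have haN : |a| ≤ N := by linarith
  have hbN : |b| ≤ N := by linarith
  have hGN : 0 ≤ G * N := by positivity
  have hKN : 0 ≤ K * N := by positivity
  refine ⟨⟨fun z => gradient u z - (2 * b) • TwoRows.asympH ε δ z,
    fun z => gradient u z - (a * μ) • TwoRows.asympV ε z, fun z _ => by simp, fun z _ => by simp,
    fun z hz w hw => ?_⟩, fun z hz => ?_, fun hsmall => ?_, fun z hz => ?_, fun hsmall => ?_⟩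
  · have h1 := hH z hz
    have h2 := hVv w hw
    rw [hC]
    linarith
  · have h1 := hH z hz
    have h2 := norm_le_norm_sub_add (gradient u z) ((2 * b) • TwoRows.asympH ε δ z)
    have h3 : ‖(2 * b) • TwoRows.asympH ε δ z‖ ≤ 2 * N * (3 / δ) := by
      rw [norm_smul, Real.norm_eq_abs, abs_mul, abs_two]
      gcongr
      exact TwoRows.norm_asympH_le hδ hz
    rw [le_div_iff₀ hδ]
    have h4 : ‖gradient u z‖ * δ ≤ ((13 * G + 48) * N + 2 * N * (3 / δ)) * δ := by
      gcongr; linarith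
    refine h4.trans ?_
    have h5 : ((13 * G + 48) * N + 2 * N * (3 / δ)) * δ = (13 * G + 48) * N * δ + 6 * N := by
      field_simp; ring
    have h6 : (13 * G + 48) * N * δ ≤ (13 * G + 48) * N * 1 := by
      gcongr; linarith
    rw [h5, hC]
    linarith
  -- At the middle of the gap S vanishes and the model has size 2|b|/δ. The smallness assumption
  -- makes the remainder at most half of it.
  · set z₀ : ℂ := ⟨1 + ε / 2, 1 + δ / 2⟩ with hz₀
    have hz : z₀ ∈ TwoRows.narrowH ε δ := by
      constructor
      · simp only [hz₀]
        rw [show 1 + δ / 2 - 1 - δ / 2 = 0 by ring, show 1 + ε / 2 - 1 - ε / 2 = 0 by ring]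
        simp [hδ]
      · simp only [hz₀]
        rw [show 1 + ε / 2 - 1 - ε / 2 = 0 by ring]
        simp
    refine ⟨z₀, hz, ?_⟩
    have h1 := hH z₀ hz
    have h2 : TwoRows.asympH ε δ z₀ = (1 / δ) • Complex.I := by
      rw [TwoRows.asympH, TwoRows.S]
      simp only [hz₀]
      rw [show 1 + δ / 2 - 1 - δ / 2 = 0 by ring, show 1 + ε / 2 - 1 - ε / 2 = 0 by ring]
      simp
    have h3 : ‖(2 * b) • TwoRows.asympH ε δ z₀‖ = 2 * |b| / δ := by
      rw [h2, norm_smul, norm_smul, Complex.norm_I, Real.norm_eq_abs, Real.norm_eq_abs, abs_mul, abs_two,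
        abs_of_pos (by positivity : 0 < 1 / δ)]
      ring
    have h4 := norm_sub_norm_le ((2 * b) • TwoRows.asympH ε δ z₀) (gradient u z₀)
    rw [norm_sub_rev, h3] at h4
    have h5 : (13 * G + 48) * N ≤ |b| / δ := by
      rw [le_div_iff₀ hδ]
      refine le_trans ?_ hsmall
      rw [show (13 * G + 48) * N * δ = (13 * G + 48) * δ * N by ring]
      gcongr
      rw [hC]; linarith
    have h6 : |b| / (C * δ) ≤ |b| / δ := by
      gcongr
      exact le_mul_of_one_le_left hδ.le (by rw [hC]; linarith)
    have h7 : 2 * |b| / δ = |b| / δ + |b| / δ := by ring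
    linarith
  · have h1 := hVv z hz
    have h2 := norm_le_norm_sub_add (gradient u z) ((a * μ) • TwoRows.asympV ε z)
    have h3 : ‖(a * μ) • TwoRows.asympV ε z‖ ≤ N * K * (√ε / ε) := by
      rw [TwoRows.asympV, norm_smul, norm_smul, norm_one, mul_one, Real.norm_eq_abs, Real.norm_eq_abs, abs_mul,
        abs_of_pos hμ0, abs_of_pos (by positivity : 0 < √ε / (ε + z.im ^ 2))]
      gcongr
      linarith [sq_nonneg z.im]
    rw [Real.sqrt_div_self'] at h3
    rw [le_div_iff₀ hs]
    have h4 : ‖gradient u z‖ * √ε ≤ ((6 * G + 15 + K) * N + N * K * (1 / √ε)) * √ε := by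
      gcongr; linarith
    refine h4.trans ?_
    have h5 : ((6 * G + 15 + K) * N + N * K * (1 / √ε)) * √ε = (6 * G + 15 + K) * N * √ε + K * N := by
      field_simp
    have h6 : (6 * G + 15 + K) * N * √ε ≤ (6 * G + 15 + K) * N * 1 := by gcongr
    rw [h5, hC]
    linarith
  · have hz : (0 : ℂ) ∈ TwoRows.narrowV ε := by
      constructor
      · simp [hε]
      · simp
    refine ⟨0, hz, ?_⟩
    have h1 := hVv 0 hz
    have h3 : ‖(a * μ) • TwoRows.asympV ε 0‖ = |a| * μ / √ε := by
      rw [TwoRows.asympV, norm_smul, norm_smul, norm_one, mul_one, Real.norm_eq_abs, Real.norm_eq_abs, abs_mul,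
        abs_of_pos hμ0, Complex.zero_im, zero_pow two_ne_zero, add_zero, Real.sqrt_div_self',
        abs_of_pos (by positivity : 0 < 1 / √ε)]
      ring
    have h4 := norm_sub_norm_le ((a * μ) • TwoRows.asympV ε 0) (gradient u 0)
    rw [norm_sub_rev, h3] at h4
    -- At the origin the model is at least |a|/(8√ε), so a remainder of at most half of this leaves
    -- |a|/(16√ε).
    have h5 : (6 * G + 15 + K) * N ≤ |a| / (16 * √ε) := by
      rw [le_div_iff₀ (by positivity)]
      refine le_trans ?_ hsmall
      rw [show (6 * G + 15 + K) * N * (16 * √ε) = 16 * (6 * G + 15 + K) * √ε * N by ring]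
      gcongr
      rw [hC]; linarith
    have h6 : |a| / (C * √ε) ≤ |a| / (16 * √ε) := by
      gcongr
      rw [hC]; linarith
    have h7 : |a| / (16 * √ε) + |a| / (16 * √ε) ≤ |a| * μ / √ε := by
      have : |a| / (16 * √ε) + |a| / (16 * √ε) = |a| * (1 / 8) / √ε := by ring
      rw [this]
      gcongr
    linarith
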